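/- A dyadic interval is $I=[m2^k,(m+1)2^k)$ with $k,m\in\mathbb Z$. Let $\mathcal I$ be a finite set of dyadic intervals, $N\ge 100$ an integer and $A$ a real number. A family $(\phi_I)_{I\in\mathcal I}$ of Schwartz functions $\phi_I:\mathbb R\to\mathbb C$ is called $L^2$-normalized lacunary with decay exponent $N$ and constant $A$ if $\int_{\mathbb R}\phi_I=0$ and $$|\partial^\alpha\phi_I(x)|\le A\,|I|^{-1/2}\,|I|^{-\alpha}\Big(1+\frac{\mathrm{dist}(x,I)}{|I|}\Big)^{-N}\qquad(I\in\mathcal I,\ x\in\mathbb R,\ 0\le\alpha\le 10).$$ Let $n\ge 0$, $0<p<\infty$ and $Q=(q_1,\dots,q_n)$ with $0<q_i<\infty$. For $\sigma$-finite measure spaces $(S_i,\Sigma_i,\mu_i)$, $1\le i\le n$, and a function $g$ on $S=\prod_i S_i$ put $\|g\|_{Q}=\big\|\cdots\|g(s_1,\dots,s_n)\|_{L^{q_n}(S_n)}\cdots\big\|_{L^{q_1}(S_1)}$ (for $n=0$ this is $|g|$), and for a function $h_s(x)$ of $s\in S$, $x\in\mathbb R$ put $\|h\|_{L^p(L^Q)}=\big\|\,\|h_s(x)\|_{Q}\,\big\|_{L^p(\mathbb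 R,dx)}$. Let $(\phi^1_{I,s})_{I\in\mathcal I}$ and $(\phi^2_{I,s})_{I\in\mathcal I}$ be, for every $s\in S$, $L^2$-normalized lacunary families with decay exponent $N$ and constant $A$ (the same $N$ and $A$ for all $s$; in particular families that do not depend on $s$ are allowed), and let $f=f_s(x)$ be complex-valued, all of these being jointly measurable in $(s,x)$ and such that the integrals $\langle f_s,\phi^1_{I,s}\rangle=\int_{\mathbb R} f_s\,\overline{\phi^1_{I,s}}\,dx$ converge absolutely (for instance, every $f_s$ is a Schwartz function). Put $$T f_s(x)=\sum_{I\in\mathcal I}\langle f_s,\phi^1_{I,s}\rangle\,\phi^2_{I,s}(x),\qquad \mathcal S f_s(x)=\Big(\sum_{I\in\mathcal I}\frac{|\langle f_s,\phi^1_{I,s}\rangle|^2}{|I|}\mathbf 1_I(x)\Big)^{1/2}.$$ (1) If $Np>1$ and $Nq_i>1$ for all $i$ (for $N=100$: if $p$ and all the $q_i$ exceed $1/100$), then $$\|T f\|_{L^p(L^Q)}\le C\,\|\mathcal S f\|_{L^p(L^Q)},$$ where $C<\infty$ depends only on $n,p,Q,N,A$. (2) If $Np\ge 100$ and $Nq_i\ge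 100$ for all $i$ (for $N=100$: if $p$ and all the $q_i$ are at least $1$), then for every $\epsilon>0$, every measurable $E\subseteq\mathbb R$ and every integer $M$ with $|I|\le 2^M$ for all $I\in\mathcal I$, $$\|(T f)\,\mathbf 1_E\|_{L^p(L^Q)}\le C\,\|\mathcal S f\|_{L^p(L^Q)}\,\big(\mathrm{size}_{\mathcal I}\mathbf 1_E\big)^{1/p-\epsilon},$$ where $C<\infty$ depends only on $n,p,Q,N,A,\epsilon$ and $$\mathrm{size}_{\mathcal I}\mathbf 1_E=\sup_J\ \frac1{|J|}\int_{E}\Big(1+\frac{\mathrm{dist}(x,J)}{|J|}\Big)^{-100}dx,$$ the supremum being over all dyadic intervals $J$ with $|J|\le 2^M$ that contain some $I\in\mathcal I$. In particular, in (1) and (2) the constant $C$ does not depend on $\mathcal I$, on the families, on $f$, on $M$ and $E$, or on the measure spaces. -/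

import Mathlib

open MeasureTheory
open scoped ENNReal NNReal ComplexConjugate

universe u

/-- A dyadic interval, given by its scale `k` and its position `m`. -/
structure DyadicInterval where
  k : ℤ
  m : ℤ

namespace DyadicInterval

/-- The length `|I| = 2 ^ k`. -/
noncomputable def length (I : DyadicInterval) : ℝ := (2 : ℝ) ^ I.k

/-- The underlying set `[m 2 ^ k, (m + 1) 2 ^ k)`. -/
def toSet (I : DyadicInterval) : Set ℝ :=
  Set.Ico ((I.m : ℝ) * (2 : ℝ) ^ I.k) (((I.m : ℝ) + 1) * (2 : ℝ) ^ I.k)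

/-- The quantity `1 + dist(x, I) / |I|`. -/
noncomputable def relDist (I : DyadicInterval) (x : ℝ) : ℝ :=
  1 + Metric.infDist x I.toSet / I.length

end DyadicInterval

/-- `(φ_I)`, `I ∈ 𝓘`, is an `L²`-normalized lacunary family of Schwartz functions with constant `A`
and decay exponent `N`. -/
structure IsLacunary (N : ℕ) (A : ℝ) (𝓘 : Finset DyadicInterval)
    (φ : DyadicInterval → SchwartzMap ℝ ℂ) : Prop where
  bound : ∀ I ∈ 𝓘, ∀ α : ℕ, α ≤ 10 → ∀ x : ℝ,
    ‖iteratedDeriv α (fun y => φ I y) x‖ ≤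
      A * (1 / Real.sqrt I.length) * (1 / I.length ^ α) * (1 / I.relDist x ^ N)
  integral_eq_zero : ∀ I ∈ 𝓘, ∫ x, φ I x = 0

/-- The iterated (quasi-)norm `‖ … ‖g(s₁, …, sₙ)‖_{L^{qₙ}(Sₙ)} … ‖_{L^{q₁}(S₁)}` of a function
with values in `[0, ∞]`; the last variable is the innermost one. -/
noncomputable def mixedNorm : {n : ℕ} → (S : Fin n → Type u) → [∀ i, MeasurableSpace (S i)] →
    (∀ i, Measure (S i)) → (Fin n → ℝ) → ((∀ i, S i) → ℝ≥0∞) → ℝ≥0∞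
  | 0, _, _, _, _, g => g (fun i => i.elim0)
  | _ + 1, S, _, μ, q, g =>
    eLpNorm (fun s₁ : S 0 =>
      mixedNorm (fun i => S i.succ) (fun i => μ i.succ) (fun i => q i.succ)
        (fun t => g (Fin.cons s₁ t)))
      (ENNReal.ofReal (q 0)) (μ 0)

/-- The (quasi-)norm of `L^p(ℝ; L^Q)`: first the iterated norm in `s = (s₁, …, sₙ)`, then the
`L^p` norm in `x ∈ ℝ`. -/
noncomputable def lpMixedNorm {F : Type*} [NormedAddCommGroup F] {n : ℕ} {S : Fin n → Type u}
    [∀ i, MeasurableSpace (S i)] (μ : ∀ i, Measure (S i)) (q : Fin n → ℝ) (p : ℝ)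
    (h : (∀ i, S i) → ℝ → F) : ℝ≥0∞ :=
  eLpNorm (fun x : ℝ => mixedNorm S μ q (fun s => ‖h s x‖ₑ)) (ENNReal.ofReal p) volume

/-- The pairing `⟨f, φ⟩ = ∫ f \bar φ`. -/
noncomputable def pairing (f : ℝ → ℂ) (φ : SchwartzMap ℝ ℂ) : ℂ :=
  ∫ x, f x * conj (φ x)

/-- The function `∑_I ⟨f, φ¹_I⟩ φ²_I`. -/
noncomputable def discreteSum (𝓘 : Finset DyadicInterval)
    (φ₁ φ₂ : DyadicInterval → SchwartzMap ℝ ℂ) (f : ℝ → ℂ) (x : ℝ) : ℂ :=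
  ∑ I ∈ 𝓘, pairing f (φ₁ I) * φ₂ I x

/-- The discrete square function `(∑_I |⟨f, φ¹_I⟩|² |I|⁻¹ 1_I)^{1/2}`. -/
noncomputable def squareFun (𝓘 : Finset DyadicInterval)
    (φ₁ : DyadicInterval → SchwartzMap ℝ ℂ) (f : ℝ → ℂ) (x : ℝ) : ℝ :=
  Real.sqrt (∑ I ∈ 𝓘, ‖pairing f (φ₁ I)‖ ^ 2 / I.length * I.toSet.indicator (fun _ => (1 : ℝ)) x)

/-- The relevant dyadic intervals: those of length at most `2 ^ M` that contain some `I ∈ 𝓘`. -/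
def relevant (𝓘 : Finset DyadicInterval) (M : ℤ) : Set DyadicInterval :=
  {J | (∃ I ∈ 𝓘, I.toSet ⊆ J.toSet) ∧ J.length ≤ (2 : ℝ) ^ M}

/-- The size of `1_E`: the supremum over the relevant intervals `J` of
`|J|⁻¹ ∫_E (1 + dist(x, J) / |J|)^{-100} dx`. -/
noncomputable def size (𝓘 : Finset DyadicInterval) (M : ℤ) (E : Set ℝ) : ℝ≥0∞ :=
  ⨆ J ∈ relevant 𝓘 M,
    ENNReal.ofReal (1 / J.length) * ∫⁻ x in E, ENNReal.ofReal (1 / J.relDist x ^ 100)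

/-- The admissible data over a finite collection `𝓘`: two `L²`-normalized lacunary families that
may depend on `s`, with bounds uniform in `s`, and a function `f_s(x)`; all of them are jointly
measurable in `(s, x)`, and the pairings `⟨f_s, φ¹_{I,s}⟩` converge absolutely. -/
structure IsAdmissible {n : ℕ} {S : Fin n → Type u} [∀ i, MeasurableSpace (S i)]
    (N : ℕ) (A : ℝ) (𝓘 : Finset DyadicInterval)
    (φ₁ φ₂ : DyadicInterval → (∀ i, S i) → SchwartzMap ℝ ℂ)
    (f : (∀ i, S i) → ℝ → ℂ) : Prop where
  lacunary₁ : ∀ s, IsLacunary N A 𝓘 (fun I => φ₁ I s)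
  lacunary₂ : ∀ s, IsLacunary N A 𝓘 (fun I => φ₂ I s)
  measurable₁ : ∀ I ∈ 𝓘, Measurable (fun z : (∀ i, S i) × ℝ => φ₁ I z.1 z.2)
  measurable₂ : ∀ I ∈ 𝓘, Measurable (fun z : (∀ i, S i) × ℝ => φ₂ I z.1 z.2)
  measurable_f : Measurable (fun z : (∀ i, S i) × ℝ => f z.1 z.2)
  integrable : ∀ I ∈ 𝓘, ∀ s, Integrable (fun x => f s x * conj (φ₁ I s x))

-- Multiplying φ²_I by |I|^{1/2} turns T f into a sum Σ a_I ψ_I of `L^∞`-normalized mean-zero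
-- molecules, and the square function into (Σ |a_I|² 1_I)^{1/2}. Both claims follow from one
-- weighted inequality, `weightedBound`: for every t > 1, ∫ ‖T‖_Q^p w ≤ C ∫ ‖S‖_Q^p M_t w, where M_t
-- is the maximal function of L^t averages with tail weights, taken over the intervals of the
-- collection only. The weight 1 gives (1). For w = 1_E, M_t w is at most size^{1/t}, and t = 1 + pε
-- gives (2).
--
-- The inequality is proved by induction on n. Each stage needs, for arbitrarily large p, a local
-- bound: if all intervals lie in K and the norm of the square function is at most l, then the L^p
-- norm of the sum near K is O(l |K|^{1/p}). For n = 0 this is a John-Nirenberg inequality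
-- (`exists_lintegral_localSum_rpow_le`). Its start is the L² bound from almost orthogonality; its
-- iteration works because the molecules not localized near an interval oscillate by O(1) on it. For
-- n + 1, Fubini turns the bound for n variables with p = q₁ into one for n + 1 variables with the
-- same p (`WeightedBound.succ`). Extrapolation (`exists_extrapolation`) raises p, and the weight 1
-- gives the local bound (`WeightedBound.localBound`).
--
-- From local bounds one descends to a small exponent r ≤ min(1, p, q_i)
-- (`WeightedBound.of_localBound`). The intervals are grouped into trees by the dyadic size of the
-- infimum of the square norm over them. The r-th power of the mixed norm is subadditive, so trees
-- may be treated separately: near the top the local bound and Hölder apply, and far away the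
-- molecular decay is enough provided Nr ≥ κ > 1. The tree tops add up to a geometric series
-- controlled by the square norm. Extrapolation then climbs from r to p.

universe v

/-! ### Dyadic intervals and the relative distance. -/

namespace DyadicInterval

variable (I J : DyadicInterval)

/-- The left endpoint of a dyadic interval. -/
noncomputable def left : ℝ := (I.m : ℝ) * (2 : ℝ) ^ I.k

lemma length_pos : 0 < I.length := by unfold length; positivity

lemma toSet_eq : I.toSet = Set.Ico I.left (I.left + I.length) := by
  unfold toSet left length
  congr 1
  ring

lemma left_mem : I.left ∈ I.toSet := by
  rw [toSet_eq]
  exact ⟨le_rfl, by linarith [I.length_pos]⟩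

lemma measurableSet_toSet : MeasurableSet I.toSet := by
  rw [toSet_eq]
  exact measurableSet_Ico

lemma volume_toSet : volume I.toSet = ENNReal.ofReal I.length := by
  rw [toSet_eq, Real.volume_Ico, add_sub_cancel_left]

lemma ofReal_length_pos : 0 < ENNReal.ofReal I.length := ENNReal.ofReal_pos.2 I.length_pos

variable {I J}

lemma abs_sub_le_length {x y : ℝ} (hx : x ∈ I.toSet) (hy : y ∈ I.toSet) :
    |x - y| ≤ I.length := by
  rw [toSet_eq] at hx hy
  rw [abs_le]
  constructor <;> linarith [hx.1, hx.2, hy.1, hy.2]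

lemma one_le_relDist (x : ℝ) : 1 ≤ I.relDist x := by
  unfold relDist
  have := div_nonneg (Metric.infDist_nonneg (x := x) (s := I.toSet)) I.length_pos.le
  linarith

lemma relDist_pos (x : ℝ) : 0 < I.relDist x := one_pos.trans_le (one_le_relDist x)

lemma relDist_le_of_mem {x z : ℝ} (hz : z ∈ I.toSet) : I.relDist x ≤ 1 + |x - z| / I.length := by
  unfold relDist
  have h := Metric.infDist_le_dist_of_mem (x := x) hz
  rw [Real.dist_eq] at h
  have := div_le_div_of_nonneg_right h I.length_pos.le
  linarith

lemma abs_sub_le_relDist {x z : ℝ} (hz : z ∈ I.toSet) :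
    |x - z| ≤ I.length * I.relDist x := by
  have h : |x - z| - I.length ≤ Metric.infDist x I.toSet := by
    refine (Metric.le_infDist ⟨z, hz⟩).2 fun y hy => ?_
    rw [Real.dist_eq]
    have h1 := abs_sub_le x y z
    have h2 := abs_sub_le_length hy hz
    linarith
  unfold relDist
  rw [mul_add, mul_div_cancel₀ _ I.length_pos.ne']
  linarith

lemma one_add_le_two_mul_relDist {x z : ℝ} (hz : z ∈ I.toSet) :
    1 + |x - z| / I.length ≤ 2 * I.relDist x := by
  have h1 := abs_sub_le_relDist (x := x) hz
  have h2 : |x - z| / I.length ≤ I.relDist x := by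
    rw [div_le_iff₀ I.length_pos]; linarith
  linarith [one_le_relDist (I := I) x]

lemma relDist_le_mul (x y : ℝ) : I.relDist x ≤ I.relDist y * (1 + |x - y| / I.length) := by
  have h := Metric.infDist_le_infDist_add_dist (s := I.toSet) (x := x) (y := y)
  rw [Real.dist_eq] at h
  have h1 : I.relDist x ≤ I.relDist y + |x - y| / I.length := by
    unfold relDist
    have := div_le_div_of_nonneg_right h I.length_pos.le
    rw [add_div] at this
    linarith
  have h2 : 0 ≤ |x - y| / I.length := div_nonneg (abs_nonneg _) I.length_pos.le
  nlinarith [one_le_relDist (I := I) y]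

lemma continuous_relDist : Continuous I.relDist := by
  unfold relDist
  exact continuous_const.add ((Metric.continuous_infDist_pt _).div_const _)

lemma measurable_relDist : Measurable I.relDist := continuous_relDist.measurable

lemma length_le_iff : I.length ≤ J.length ↔ I.k ≤ J.k := by
  unfold length
  exact zpow_le_zpow_iff_right₀ (by norm_num)

lemma subset_of_mem_of_mem {x : ℝ} (hI : x ∈ I.toSet) (hJ : x ∈ J.toSet) (h : I.k ≤ J.k) :
    I.toSet ⊆ J.toSet := by
  obtain ⟨d, hd⟩ := Int.eq_ofNat_of_zero_le (sub_nonneg.2 h)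
  have hk : J.k = d + I.k := by omega
  have e : (2 : ℝ) ^ J.k = (2 : ℝ) ^ d * (2 : ℝ) ^ I.k := by
    rw [hk, zpow_add₀ (by norm_num), zpow_natCast]
  unfold toSet at *
  have hp : (0 : ℝ) < (2 : ℝ) ^ I.k := by positivity
  rw [e] at hJ ⊢
  obtain ⟨a1, a2⟩ := hI
  obtain ⟨b1, b2⟩ := hJ
  have h1 : (I.m : ℝ) < (J.m + 1) * 2 ^ d := by
    by_contra! hc
    nlinarith
  have h2 : (J.m : ℝ) * 2 ^ d < I.m + 1 := by
    by_contra! hc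
    nlinarith
  -- All four endpoints are integer multiples of 2 ^ I.k, so strict inequalities between the
  -- multiples improve by one, which is what nestedness needs.
  have h1' : I.m + 1 ≤ (J.m + 1) * 2 ^ d := by
    have : I.m < (J.m + 1) * 2 ^ d := by exact_mod_cast h1
    omega
  have h2' : J.m * 2 ^ d ≤ I.m := by
    have : J.m * 2 ^ d < I.m + 1 := by exact_mod_cast h2
    omega
  have h1'' : (I.m : ℝ) + 1 ≤ (J.m + 1) * 2 ^ d := by exact_mod_cast h1'
  have h2'' : (J.m : ℝ) * 2 ^ d ≤ I.m := by exact_mod_cast h2'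
  refine Set.Ico_subset_Ico ?_ ?_ <;> nlinarith

lemma eq_of_mem_of_mem {x : ℝ} (hI : x ∈ I.toSet) (hJ : x ∈ J.toSet) (h : I.k = J.k) : I = J := by
  obtain ⟨k, m⟩ := I
  obtain ⟨k', m'⟩ := J
  obtain rfl : k = k' := h
  simp only [toSet, Set.mem_Ico] at hI hJ
  have hp : (0 : ℝ) < (2 : ℝ) ^ k := by positivity
  have h1 : (m : ℝ) < m' + 1 := by nlinarith
  have h2 : (m' : ℝ) < m + 1 := by nlinarith
  have h1' : m < m' + 1 := by exact_mod_cast h1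
  have h2' : m' < m + 1 := by exact_mod_cast h2
  congr 1
  omega

lemma k_le_of_subset (h : I.toSet ⊆ J.toSet) : I.k ≤ J.k := by
  rw [← length_le_iff]
  have := measure_mono (μ := volume) h
  rw [volume_toSet, volume_toSet] at this
  exact (ENNReal.ofReal_le_ofReal_iff J.length_pos.le).1 this

lemma disjoint_of_k_eq (h : I.k = J.k) (hne : I ≠ J) : Disjoint I.toSet J.toSet :=
  Set.disjoint_left.2 fun _ hI hJ => hne (eq_of_mem_of_mem hI hJ h)

/-- The dyadic interval of scale `k` containing `x`. -/
noncomputable def ofPoint (k : ℤ) (x : ℝ) : DyadicInterval := ⟨k, ⌊x / (2 : ℝ) ^ k⌋⟩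

@[simp] lemma ofPoint_k (k : ℤ) (x : ℝ) : (ofPoint k x).k = k := rfl

lemma length_ofPoint (k : ℤ) (x : ℝ) : (ofPoint k x).length = (2 : ℝ) ^ k := rfl

lemma mem_ofPoint (k : ℤ) (x : ℝ) : x ∈ (ofPoint k x).toSet := by
  have hp : (0 : ℝ) < (2 : ℝ) ^ k := by positivity
  simp only [toSet, ofPoint, Set.mem_Ico]
  constructor
  · rw [← le_div_iff₀ hp]
    exact Int.floor_le _
  · rw [← div_lt_iff₀ hp]
    exact Int.lt_floor_add_one _

end DyadicInterval

open DyadicInterval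

/-! ### Integrals and sums of tails. -/

lemma lintegral_comp_mul_sub {f : ℝ → ℝ≥0∞} (hf : Measurable f) {a : ℝ} (ha : 0 < a) (c : ℝ) :
    ∫⁻ y, f ((y - c) / a) = ENNReal.ofReal a * ∫⁻ y, f y := by
  rw [lintegral_sub_right_eq_self (fun y => f (y / a)) c]
  have h := Real.map_volume_mul_left (inv_ne_zero ha.ne')
  have h2 : ∫⁻ y, f y ∂(Measure.map (a⁻¹ * ·) volume) = ∫⁻ y, f (a⁻¹ * y) :=
    lintegral_map hf (measurable_const_mul _)
  rw [h, lintegral_smul_measure, inv_inv, abs_of_pos ha] at h2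
  simp only [smul_eq_mul] at h2
  rw [h2]
  simp only [div_eq_inv_mul]

/-- The tails `relDist ^ (-κ)`, `κ > 1`, have integral `O(|I|)`. -/
lemma exists_lintegral_relDist_le {κ : ℝ} (hκ : 1 < κ) :
    ∃ C : ℝ≥0, ∀ I : DyadicInterval,
      ∫⁻ y, ENNReal.ofReal (I.relDist y ^ (-κ)) ≤ C * ENNReal.ofReal I.length := by
  have hfin : ∫⁻ x : ℝ, ENNReal.ofReal ((1 + ‖x‖) ^ (-κ)) < ∞ :=
    finite_integral_one_add_norm (by simpa using hκ)
  set B := ∫⁻ x : ℝ, ENNReal.ofReal ((1 + ‖x‖) ^ (-κ)) with hB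
  refine ⟨(ENNReal.ofReal (2 ^ κ) * B).toNNReal, fun I => ?_⟩
  rw [ENNReal.coe_toNNReal (ENNReal.mul_ne_top ENNReal.ofReal_ne_top hfin.ne)]
  have hm : Measurable fun x : ℝ => ENNReal.ofReal ((1 + ‖x‖) ^ (-κ)) := by fun_prop
  have key := lintegral_comp_mul_sub hm I.length_pos I.left
  calc ∫⁻ y, ENNReal.ofReal (I.relDist y ^ (-κ))
      ≤ ∫⁻ y, ENNReal.ofReal (2 ^ κ) *
          ENNReal.ofReal ((1 + ‖(y - I.left) / I.length‖) ^ (-κ)) := by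
        refine lintegral_mono fun y => ?_
        rw [← ENNReal.ofReal_mul (by positivity)]
        refine ENNReal.ofReal_le_ofReal ?_
        have h := one_add_le_two_mul_relDist (x := y) I.left_mem
        have h0 : 0 < 1 + |y - I.left| / I.length := by
          have := div_nonneg (abs_nonneg (y - I.left)) I.length_pos.le
          linarith
        rw [Real.norm_eq_abs, abs_div, abs_of_pos I.length_pos]
        have h1 := Real.rpow_le_rpow_of_nonpos h0 h (show -κ ≤ 0 by linarith)
        rw [Real.mul_rpow (by norm_num) (relDist_pos y).le, Real.rpow_neg (by norm_num)] at h1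
        have h2 : (0 : ℝ) < 2 ^ κ := by positivity
        rw [inv_mul_le_iff₀ h2] at h1
        exact h1
    _ = _ := by
        rw [lintegral_const_mul' _ _ ENNReal.ofReal_ne_top, key, ← hB]
        ring

/-- Intervals of one scale are disjoint, and on an interval no longer than `J` the weight
`J.relDist` varies by at most a factor 2, so the sum is dominated by the integral of the tail of
`J`. -/
lemma sum_length_relDist_aux :
    ∃ C : ℝ, 0 ≤ C ∧ ∀ (J : DyadicInterval) (k : ℤ) (𝓢 : Finset DyadicInterval),
      k ≤ J.k → (∀ I ∈ 𝓢, I.k = k) →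
      ∑ I ∈ 𝓢, I.length * (J.relDist I.left ^ 2)⁻¹ ≤ C * J.length := by
  obtain ⟨C, hC⟩ := exists_lintegral_relDist_le (κ := 2) (by norm_num)
  refine ⟨4 * C, by positivity, fun J k 𝓢 hk h𝓢 => ?_⟩
  have h1 : ∀ I ∈ 𝓢, ENNReal.ofReal (I.length * (J.relDist I.left ^ 2)⁻¹) ≤
      ∫⁻ y in I.toSet, 4 * ENNReal.ofReal (J.relDist y ^ (-2 : ℝ)) := by
    intro I hI
    rw [ENNReal.ofReal_mul I.length_pos.le, ← volume_toSet, mul_comm, ← setLIntegral_const]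
    refine setLIntegral_mono' I.measurableSet_toSet fun y hy => ?_
    rw [show (4 : ℝ≥0∞) = ENNReal.ofReal 4 by norm_num, ← ENNReal.ofReal_mul (by norm_num)]
    refine ENNReal.ofReal_le_ofReal ?_
    have hL : I.length ≤ J.length := length_le_iff.2 (by rw [h𝓢 I hI]; exact hk)
    have ha : J.relDist y ≤ 2 * J.relDist I.left := by
      have := relDist_le_mul (I := J) y I.left
      have hb : |y - I.left| / J.length ≤ 1 := by
        rw [div_le_one J.length_pos]
        exact (abs_sub_le_length hy I.left_mem).trans hL
      nlinarith [relDist_pos (I := J) I.left]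
    have hp := relDist_pos (I := J) I.left
    have hp2 := relDist_pos (I := J) y
    rw [Real.rpow_neg hp2.le, Real.rpow_two, ← div_eq_mul_inv, inv_le_comm₀ (by positivity)
      (by positivity), inv_div, div_le_iff₀ (by norm_num)]
    nlinarith
  have h2 : ENNReal.ofReal (∑ I ∈ 𝓢, I.length * (J.relDist I.left ^ 2)⁻¹) ≤
      ENNReal.ofReal (4 * C * J.length) := by
    rw [ENNReal.ofReal_sum_of_nonneg (fun I _ => by have := I.length_pos; positivity)]
    calc _ ≤ ∑ I ∈ 𝓢, ∫⁻ y in I.toSet, 4 * ENNReal.ofReal (J.relDist y ^ (-2 : ℝ)) :=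
          Finset.sum_le_sum h1
      _ = ∫⁻ y in ⋃ I ∈ 𝓢, I.toSet, 4 * ENNReal.ofReal (J.relDist y ^ (-2 : ℝ)) := by
          rw [lintegral_biUnion_finset _ fun I _ => I.measurableSet_toSet]
          intro I hI I' hI' hne
          exact disjoint_of_k_eq ((h𝓢 I hI).trans (h𝓢 I' hI').symm) hne
      _ ≤ ∫⁻ y, 4 * ENNReal.ofReal (J.relDist y ^ (-2 : ℝ)) := setLIntegral_le_lintegral _ _
      _ ≤ 4 * (C * ENNReal.ofReal J.length) := by
          rw [lintegral_const_mul' _ _ (by norm_num)]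
          gcongr
          exact hC J
      _ = _ := by
          rw [ENNReal.ofReal_mul (by positivity), ENNReal.ofReal_mul (by norm_num)]
          simp [mul_assoc]
  exact (ENNReal.ofReal_le_ofReal_iff (by have := J.length_pos; positivity)).1 h2

/-- Every distance to `k₀` is attained at most once on each side of `k₀`, so two geometric series of
sum 2 suffice. -/
lemma sum_zpow_natAbs_le (s : Finset ℤ) (k₀ : ℤ) :
    ∑ k ∈ s, ((1 : ℝ) / 2) ^ (k - k₀).natAbs ≤ 4 := by
  have hs : HasSum (fun n : ℕ => ((1 : ℝ) / 2) ^ n) 2 := hasSum_geometric_two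
  have key : ∀ (t : Finset ℤ) , (∀ a ∈ t, ∀ b ∈ t, (a - k₀).natAbs = (b - k₀).natAbs → a = b) →
      ∑ k ∈ t, ((1 : ℝ) / 2) ^ (k - k₀).natAbs ≤ 2 := by
    intro t ht
    rw [← Finset.sum_image (f := fun n : ℕ => ((1 : ℝ) / 2) ^ n) (g := fun k => (k - k₀).natAbs)
      (s := t) (fun a ha b hb h => ht a ha b hb h)]
    exact sum_le_hasSum _ (fun _ _ => by positivity) hs
  rw [← Finset.sum_filter_add_sum_filter_not s (fun k => k₀ ≤ k)]
  have h1 := key (s.filter fun k => k₀ ≤ k) (by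
    intro a ha b hb h
    simp only [Finset.mem_filter] at ha hb
    omega)
  have h2 := key (s.filter fun k => ¬ k₀ ≤ k) (by
    intro a ha b hb h
    simp only [Finset.mem_filter] at ha hb
    omega)
  linarith

lemma sum_scales_le {c B : ℝ} (hB : 0 ≤ B) (𝓢 : Finset DyadicInterval) (k₀ : ℤ)
    (g : DyadicInterval → ℝ)
    (h : ∀ k, ∑ I ∈ 𝓢.filter (fun I => I.k = k), g I ≤ B * ((1 : ℝ) / 2) ^ (k - k₀).natAbs)
    (hc : c = 4 * B) : ∑ I ∈ 𝓢, g I ≤ c := by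
  classical
  rw [← Finset.sum_fiberwise_of_maps_to (g := fun I : DyadicInterval => I.k)
    (t := 𝓢.image fun I => I.k) (fun I hI => Finset.mem_image_of_mem _ hI)]
  calc _ ≤ ∑ k ∈ 𝓢.image (fun I => I.k), B * ((1 : ℝ) / 2) ^ (k - k₀).natAbs :=
        Finset.sum_le_sum fun k _ => h k
    _ = B * ∑ k ∈ 𝓢.image (fun I => I.k), ((1 : ℝ) / 2) ^ (k - k₀).natAbs := by
        rw [Finset.mul_sum]
    _ ≤ c := by
        rw [hc, mul_comm 4 B]
        exact mul_le_mul_of_nonneg_left (sum_zpow_natAbs_le _ _) hB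

/-- Intervals of arbitrary scales, weighted by the distance of the scale to a fixed one. -/
lemma sum_relDist_point :
    ∃ C : ℝ, 0 ≤ C ∧ ∀ (x : ℝ) (k₀ : ℤ) (𝓢 : Finset DyadicInterval),
      ∑ I ∈ 𝓢, ((1 : ℝ) / 2) ^ (I.k - k₀).natAbs * (I.relDist x ^ 2)⁻¹ ≤ C := by
  obtain ⟨C, hC0, hC⟩ := sum_length_relDist_aux
  refine ⟨4 * (4 * C), by positivity, fun x k₀ 𝓢 => ?_⟩
  refine sum_scales_le (B := 4 * C) (by positivity) 𝓢 k₀ _ (fun k => ?_) rfl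
  -- At a single scale the roles of point and interval can be exchanged: up to a factor 2, the
  -- distance of `x` from `I` is that of the left end of `I` from the interval of this scale
  -- containing `x`.
  set J := ofPoint k x
  have h1 := hC J k (𝓢.filter fun I => I.k = k) le_rfl (fun I hI => (Finset.mem_filter.1 hI).2)
  have hJ : J.length = (2 : ℝ) ^ k := rfl
  have hp : (0 : ℝ) < (2 : ℝ) ^ k := by positivity
  have h2 : ∑ I ∈ 𝓢.filter (fun I => I.k = k), (I.relDist x ^ 2)⁻¹ ≤ 4 * C := by
    have : ∑ I ∈ 𝓢.filter (fun I => I.k = k), (2 : ℝ) ^ k * (I.relDist x ^ 2)⁻¹ ≤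
        ∑ I ∈ 𝓢.filter (fun I => I.k = k), 4 * (I.length * (J.relDist I.left ^ 2)⁻¹) := by
      refine Finset.sum_le_sum fun I hI => ?_
      have hk : I.k = k := (Finset.mem_filter.1 hI).2
      have hL : I.length = (2 : ℝ) ^ k := by unfold length; rw [hk]
      rw [hL, mul_left_comm]
      refine mul_le_mul_of_nonneg_left ?_ hp.le
      have ha : J.relDist I.left ≤ 2 * I.relDist x := by
        refine (relDist_le_of_mem (mem_ofPoint k x)).trans ?_
        rw [abs_sub_comm, length_ofPoint, ← hL]
        exact one_add_le_two_mul_relDist I.left_mem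
      have hp1 := relDist_pos (I := J) I.left
      have hp2 := relDist_pos (I := I) x
      rw [← div_eq_mul_inv, inv_le_comm₀ (by positivity) (by positivity), inv_div,
        div_le_iff₀ (by norm_num)]
      nlinarith
    rw [← Finset.mul_sum, ← Finset.mul_sum] at this
    rw [hJ] at h1
    nlinarith
  calc _ = ∑ I ∈ 𝓢.filter (fun I => I.k = k),
        ((1 : ℝ) / 2) ^ (k - k₀).natAbs * (I.relDist x ^ 2)⁻¹ := by
        refine Finset.sum_congr rfl fun I hI => ?_
        rw [(Finset.mem_filter.1 hI).2]
    _ ≤ _ := by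
        rw [← Finset.mul_sum, mul_comm]
        gcongr

lemma integrable_relDist_sq :
    ∃ C : ℝ, 0 ≤ C ∧ ∀ I : DyadicInterval, Integrable (fun y => (I.relDist y ^ 2)⁻¹) ∧
      ∫ y, (I.relDist y ^ 2)⁻¹ ≤ C * I.length := by
  obtain ⟨C, hC⟩ := exists_lintegral_relDist_le (κ := 2) (by norm_num)
  refine ⟨C, C.2, fun I => ?_⟩
  have h := hC I
  simp only [Real.rpow_neg (relDist_pos _).le, Real.rpow_two] at h
  have hnn : ∀ y, 0 ≤ (I.relDist y ^ 2)⁻¹ := fun y => by have := relDist_pos (I := I) y; positivity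
  have hm : Measurable fun y => (I.relDist y ^ 2)⁻¹ := (measurable_relDist.pow_const 2).inv
  have hint : Integrable fun y => (I.relDist y ^ 2)⁻¹ := by
    refine ⟨hm.aestronglyMeasurable, ?_⟩
    rw [hasFiniteIntegral_iff_ofReal (Filter.Eventually.of_forall hnn)]
    exact h.trans_lt (ENNReal.mul_lt_top ENNReal.coe_lt_top ENNReal.ofReal_lt_top)
  refine ⟨hint, ?_⟩
  rw [← ofReal_integral_eq_lintegral_ofReal hint (Filter.Eventually.of_forall hnn),
    show (C : ℝ≥0∞) = ENNReal.ofReal C by simp, ← ENNReal.ofReal_mul NNReal.zero_le_coe] at h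
  exact (ENNReal.ofReal_le_ofReal_iff (mul_nonneg C.2 I.length_pos.le)).1 h

/-! ### Molecules, almost orthogonality and the L² bound. -/

/-- A function adapted to `I` with mean zero, normalized in `L^∞`. -/
structure IsMolecule (N : ℕ) (A : ℝ) (I : DyadicInterval) (ψ : ℝ → ℂ) : Prop where
  differentiable : Differentiable ℝ ψ
  norm_le : ∀ x, ‖ψ x‖ ≤ A * (I.relDist x ^ N)⁻¹
  norm_deriv_le : ∀ x, ‖deriv ψ x‖ ≤ A / I.length * (I.relDist x ^ N)⁻¹
  integral_eq_zero : ∫ x, ψ x = 0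

lemma inv_pow_le_inv_pow {a b : ℕ} (h : a ≤ b) (I : DyadicInterval) (x : ℝ) :
    (I.relDist x ^ b)⁻¹ ≤ (I.relDist x ^ a)⁻¹ := by
  have := relDist_pos (I := I) x
  exact inv_anti₀ (by positivity) (pow_le_pow_right₀ (one_le_relDist x) h)

namespace IsMolecule

variable {N : ℕ} {A : ℝ} {I J : DyadicInterval} {ψ ψ' : ℝ → ℂ}

lemma norm_le_pow (h : IsMolecule N A I ψ) (hA : 0 ≤ A) {a : ℕ} (ha : a ≤ N) (x : ℝ) :
    ‖ψ x‖ ≤ A * (I.relDist x ^ a)⁻¹ :=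
  (h.norm_le x).trans (mul_le_mul_of_nonneg_left (inv_pow_le_inv_pow ha I x) hA)

lemma norm_le_const (h : IsMolecule N A I ψ) (hA : 0 ≤ A) (x : ℝ) : ‖ψ x‖ ≤ A := by
  simpa using h.norm_le_pow hA (zero_le (a := N)) x

lemma integrable (h : IsMolecule N A I ψ) (hA : 0 ≤ A) (hN : 2 ≤ N) : Integrable ψ := by
  obtain ⟨C, -, hC⟩ := integrable_relDist_sq
  exact ((hC I).1.const_mul A).mono' h.differentiable.continuous.aestronglyMeasurable
    (Filter.Eventually.of_forall fun x => h.norm_le_pow hA hN x)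

/-- Mean value inequality on the segment from `y` to `x`. Moving the decay factor from a point of
the segment to `y` costs the squared factor in |x - y| / |I|. -/
lemma norm_sub_le (h : IsMolecule N A I ψ) (hA : 0 ≤ A) (hN : 2 ≤ N) (x y : ℝ) :
    ‖ψ x - ψ y‖ ≤
      A / I.length * ((I.relDist y ^ 2)⁻¹ * (1 + |x - y| / I.length) ^ 2) * |x - y| := by
  have hconv : Convex ℝ (Set.uIcc y x) := convex_uIcc y x
  have := hconv.norm_image_sub_le_of_norm_deriv_le (f := ψ) (x := y) (y := x)
    (C := A / I.length * ((I.relDist y ^ 2)⁻¹ * (1 + |x - y| / I.length) ^ 2))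
    (fun z _ => h.differentiable z) (fun z hz => ?_) Set.left_mem_uIcc Set.right_mem_uIcc
  · rwa [Real.norm_eq_abs] at this
  refine (h.norm_deriv_le z).trans ?_
  have hl := I.length_pos
  refine mul_le_mul_of_nonneg_left ?_ (by positivity)
  refine (inv_pow_le_inv_pow hN I z).trans ?_
  have h1 : |y - z| ≤ |x - y| := by
    rw [abs_sub_comm y z, abs_sub_comm x y]
    rw [abs_sub_comm y x]
    exact Set.abs_sub_left_of_mem_uIcc hz
  have h2 : I.relDist y ≤ I.relDist z * (1 + |x - y| / I.length) := by
    refine (relDist_le_mul y z).trans ?_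
    have := relDist_pos (I := I) z
    gcongr
  have hy := relDist_pos (I := I) y
  have hz := relDist_pos (I := I) z
  have hr : 0 ≤ |x - y| / I.length := by positivity
  rw [← div_eq_inv_mul, inv_le_comm₀ (by positivity) (by positivity), inv_div,
    div_le_iff₀ (by positivity), ← mul_pow]
  exact pow_le_pow_left₀ hy.le h2 2

lemma star (h : IsMolecule N A I ψ) : IsMolecule N A I (fun x => conj (ψ x)) where
  differentiable := Complex.conjCLE.differentiable.comp h.differentiable
  norm_le x := by simpa using h.norm_le x
  norm_deriv_le x := by
    have := (Complex.conjCLE.hasFDerivAt.comp_hasDerivAt x (h.differentiable x).hasDerivAt).deriv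
    have h2 : deriv (fun x => (starRingEnd ℂ) (ψ x)) x = (starRingEnd ℂ) (deriv ψ x) := this
    rw [h2]
    simpa using h.norm_deriv_le x
  integral_eq_zero := by rw [integral_conj, h.integral_eq_zero, map_zero]

lemma integrable_mul (h : IsMolecule N A I ψ) (h' : IsMolecule N A J ψ') (hA : 0 ≤ A)
    (hN : 2 ≤ N) : Integrable fun x => ψ x * ψ' x :=
  (h.integrable hA hN).mul_bdd (c := A) h'.differentiable.continuous.aestronglyMeasurable
    (Filter.Eventually.of_forall fun x => h'.norm_le_const hA x)

end IsMolecule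

/-- Almost orthogonality of two molecules. -/
lemma exists_norm_integral_mul_le (N : ℕ) (hN : 5 ≤ N) {A : ℝ} (hA : 0 ≤ A) :
    ∃ C : ℝ, 0 ≤ C ∧ ∀ (I J : DyadicInterval) (ψ ψ' : ℝ → ℂ), I.k ≤ J.k →
      IsMolecule N A I ψ → IsMolecule N A J ψ' →
      ‖∫ x, ψ x * ψ' x‖ ≤ C * (I.length * (I.length / J.length) * (J.relDist I.left ^ 2)⁻¹) := by
  obtain ⟨C, hC0, hC⟩ := integrable_relDist_sq
  refine ⟨4 * A ^ 2 * C, by positivity, fun I J ψ ψ' hk h h' => ?_⟩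
  have hI := I.length_pos
  have hJ := J.length_pos
  have hL : I.length ≤ J.length := length_le_iff.2 hk
  set c := I.left
  -- The molecule of the shorter interval has mean zero, so the other one may be replaced by its
  -- increment from `c`; its smoothness yields the gain |I| / |J|.
  have e : ∫ x, ψ x * ψ' x = ∫ x, ψ x * (ψ' x - ψ' c) := by
    simp_rw [mul_sub]
    rw [integral_sub (h.integrable_mul h' hA (by omega))
      ((h.integrable hA (by omega)).mul_const _), integral_mul_const, h.integral_eq_zero]
    simp
  set D := 4 * A ^ 2 * ((I.length / J.length) * (J.relDist c ^ 2)⁻¹) with hD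
  have hc := relDist_pos (I := J) c
  calc ‖∫ x, ψ x * ψ' x‖ ≤ ∫ x, D * (I.relDist x ^ 2)⁻¹ := by
        rw [e]
        refine norm_integral_le_of_norm_le ((hC I).1.const_mul _)
          (Filter.Eventually.of_forall fun x => ?_)
        rw [norm_mul]
        have h1 := h.norm_le_pow hA hN x
        have h2 := h'.norm_sub_le hA (by omega) x c
        set ρ := I.relDist x with hρ
        have hρ0 : 0 < ρ := relDist_pos x
        have h3 : |x - c| ≤ I.length * ρ := abs_sub_le_relDist I.left_mem
        have h4 : 1 + |x - c| / J.length ≤ 2 * ρ := by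
          refine le_trans ?_ (one_add_le_two_mul_relDist I.left_mem)
          gcongr
        have h5 : ‖ψ' x - ψ' c‖ ≤
            A / J.length * ((J.relDist c ^ 2)⁻¹ * (2 * ρ) ^ 2) * (I.length * ρ) := by
          refine h2.trans ?_
          gcongr
        -- Of five powers of decay, two pay for moving the weight to `c`, one pays for |x - c|, and
        -- two remain for integrability; hence 5 ≤ N.
        calc ‖ψ x‖ * ‖ψ' x - ψ' c‖ ≤ A * (ρ ^ 5)⁻¹ *
              (A / J.length * ((J.relDist c ^ 2)⁻¹ * (2 * ρ) ^ 2) * (I.length * ρ)) := by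
              gcongr
          _ = D * (ρ ^ 2)⁻¹ := by
              rw [hD]
              field_simp
              ring
    _ = D * ∫ x, (I.relDist x ^ 2)⁻¹ := integral_const_mul _ _
    _ ≤ D * (C * I.length) := by
        refine mul_le_mul_of_nonneg_left (hC I).2 ?_
        rw [hD]
        positivity
    _ = _ := by
        rw [hD]
        ring

lemma length_div_length_eq {I J : DyadicInterval} (h : I.k ≤ J.k) :
    I.length / J.length = ((1 : ℝ) / 2) ^ (J.k - I.k).natAbs := by
  obtain ⟨d, hd⟩ := Int.eq_ofNat_of_zero_le (sub_nonneg.2 h)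
  have hk : J.k = I.k + d := by omega
  rw [hd, Int.natAbs_natCast]
  unfold DyadicInterval.length
  rw [hk, zpow_add₀ (by norm_num), zpow_natCast]
  have : (0 : ℝ) < 2 ^ I.k := by positivity
  rw [one_div, inv_pow]
  field_simp

/-- The kernel controlling the interaction of two intervals. -/
noncomputable def interaction (I J : DyadicInterval) : ℝ :=
  if I.k ≤ J.k then I.length * (I.length / J.length) * (J.relDist I.left ^ 2)⁻¹ else 0

lemma interaction_nonneg (I J : DyadicInterval) : 0 ≤ interaction I J := by
  unfold interaction
  have := I.length_pos
  have := J.length_pos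
  split_ifs <;> positivity

/-- The row and column bounds for Schur's test. Along a row the scale gain |I| / |J| makes the sum
over all longer `J` converge. Along a column, the intervals of each scale contribute O(|J|) times
that same gain. -/
lemma exists_sum_interaction_le :
    ∃ C : ℝ, 0 ≤ C ∧ ∀ 𝓢 : Finset DyadicInterval,
      (∀ I, ∑ J ∈ 𝓢, interaction I J ≤ C * I.length) ∧
      (∀ J, ∑ I ∈ 𝓢, interaction I J ≤ C * J.length) := by
  obtain ⟨C₁, h₁, hC₁⟩ := sum_relDist_point
  obtain ⟨C₂, h₂, hC₂⟩ := sum_length_relDist_aux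
  refine ⟨C₁ + 4 * C₂, by positivity, fun 𝓢 => ⟨fun I => ?_, fun J => ?_⟩⟩
  · have hI := I.length_pos
    calc ∑ J ∈ 𝓢, interaction I J ≤ ∑ J ∈ 𝓢, I.length *
          (((1 : ℝ) / 2) ^ (J.k - I.k).natAbs * (J.relDist I.left ^ 2)⁻¹) := by
          refine Finset.sum_le_sum fun J _ => ?_
          unfold interaction
          split_ifs with h
          · rw [length_div_length_eq h, mul_assoc]
          · positivity
      _ ≤ I.length * C₁ := by
          rw [← Finset.mul_sum]
          exact mul_le_mul_of_nonneg_left (hC₁ _ _ _) hI.le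
      _ ≤ _ := by nlinarith
  · have hJ := J.length_pos
    have : ∑ I ∈ 𝓢, interaction I J ≤ 4 * (C₂ * J.length) := by
      refine sum_scales_le (by positivity) 𝓢 J.k _ (fun k => ?_) rfl
      by_cases hk : k ≤ J.k
      · have := hC₂ J k (𝓢.filter fun I => I.k = k) hk fun I hI => (Finset.mem_filter.1 hI).2
        calc _ = ∑ I ∈ 𝓢.filter (fun I => I.k = k), ((1 : ℝ) / 2) ^ (k - J.k).natAbs *
              (I.length * (J.relDist I.left ^ 2)⁻¹) := by
              refine Finset.sum_congr rfl fun I hI => ?_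
              have hk' : I.k = k := (Finset.mem_filter.1 hI).2
              unfold interaction
              rw [if_pos (hk'.trans_le hk), length_div_length_eq (hk'.trans_le hk), hk',
                show (J.k - k).natAbs = (k - J.k).natAbs by omega]
              ring
          _ ≤ _ := by
              rw [← Finset.mul_sum, mul_comm]
              gcongr
      · have : ∑ I ∈ 𝓢.filter (fun I => I.k = k), interaction I J = 0 := by
          refine Finset.sum_eq_zero fun I hI => ?_
          have hk' : I.k = k := (Finset.mem_filter.1 hI).2
          unfold interaction
          rw [if_neg (by rw [hk']; exact hk)]
        rw [this]
        positivity
    nlinarith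

lemma interaction_bound (N : ℕ) (hN : 5 ≤ N) {A : ℝ} (hA : 0 ≤ A) :
    ∃ C : ℝ, 0 ≤ C ∧ ∀ (I J : DyadicInterval) (ψ ψ' : ℝ → ℂ),
      IsMolecule N A I ψ → IsMolecule N A J ψ' →
      ‖∫ x, ψ x * ψ' x‖ ≤ C * (interaction I J + interaction J I) := by
  obtain ⟨C, hC0, hC⟩ := exists_norm_integral_mul_le N hN hA
  refine ⟨C, hC0, fun I J ψ ψ' h h' => ?_⟩
  rcases le_total I.k J.k with hk | hk
  · refine (hC I J ψ ψ' hk h h').trans (mul_le_mul_of_nonneg_left ?_ hC0)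
    have := interaction_nonneg J I
    have e : interaction I J = _ := if_pos hk
    rw [← e]
    linarith
  · simp_rw [mul_comm (ψ _)]
    refine (hC J I ψ' ψ hk h' h).trans (mul_le_mul_of_nonneg_left ?_ hC0)
    have := interaction_nonneg I J
    have e : interaction J I = _ := if_pos hk
    rw [← e]
    linarith

/-- The `L²` estimate for sums of molecules. -/
lemma exists_integral_norm_sq_le (N : ℕ) (hN : 5 ≤ N) {A : ℝ} (hA : 0 ≤ A) :
    ∃ C : ℝ, 0 ≤ C ∧ ∀ (𝓘 : Finset DyadicInterval) (a : DyadicInterval → ℂ)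
      (ψ : DyadicInterval → ℝ → ℂ), (∀ I ∈ 𝓘, IsMolecule N A I (ψ I)) →
      Integrable (fun x => ‖∑ I ∈ 𝓘, a I * ψ I x‖ ^ 2) ∧
      ∫ x, ‖∑ I ∈ 𝓘, a I * ψ I x‖ ^ 2 ≤ C * ∑ I ∈ 𝓘, ‖a I‖ ^ 2 * I.length := by
  obtain ⟨C₁, h₁, hC₁⟩ := interaction_bound N hN hA
  obtain ⟨C₂, h₂, hC₂⟩ := exists_sum_interaction_le
  refine ⟨2 * (C₁ * C₂), by positivity, fun 𝓘 a ψ hψ => ?_⟩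
  have e : ∀ x, ((‖∑ I ∈ 𝓘, a I * ψ I x‖ ^ 2 : ℝ) : ℂ) =
      ∑ I ∈ 𝓘, ∑ J ∈ 𝓘, (a I * conj (a J)) * (ψ I x * conj (ψ J x)) := by
    intro x
    rw [Complex.ofReal_pow, ← Complex.mul_conj', map_sum, Finset.sum_mul_sum]
    refine Finset.sum_congr rfl fun I _ => Finset.sum_congr rfl fun J _ => ?_
    rw [map_mul]
    ring
  have hint : ∀ I ∈ 𝓘, ∀ J ∈ 𝓘,
      Integrable fun x => (a I * conj (a J)) * (ψ I x * conj (ψ J x)) := fun I hI J hJ =>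
    ((hψ I hI).integrable_mul (hψ J hJ).star hA (by omega)).const_mul _
  have hintS : Integrable fun x => ((‖∑ I ∈ 𝓘, a I * ψ I x‖ ^ 2 : ℝ) : ℂ) := by
    simp_rw [e]
    exact integrable_finsetSum _ fun I hI => integrable_finsetSum _ fun J hJ => hint I hI J hJ
  have hint' : Integrable fun x => ‖∑ I ∈ 𝓘, a I * ψ I x‖ ^ 2 := hintS.re
  refine ⟨hint', ?_⟩
  have e2 : ((∫ x, ‖∑ I ∈ 𝓘, a I * ψ I x‖ ^ 2 : ℝ) : ℂ) =
      ∑ I ∈ 𝓘, ∑ J ∈ 𝓘, (a I * conj (a J)) * ∫ x, ψ I x * conj (ψ J x) := by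
    rw [← integral_complex_ofReal]
    simp_rw [e]
    rw [integral_finsetSum _ fun I hI => integrable_finsetSum _ fun J hJ => hint I hI J hJ]
    refine Finset.sum_congr rfl fun I hI => ?_
    rw [integral_finsetSum _ fun J hJ => hint I hI J hJ]
    exact Finset.sum_congr rfl fun J hJ => integral_const_mul _ _
  have e3 : ∫ x, ‖∑ I ∈ 𝓘, a I * ψ I x‖ ^ 2 ≤
      ‖((∫ x, ‖∑ I ∈ 𝓘, a I * ψ I x‖ ^ 2 : ℝ) : ℂ)‖ := by
    rw [Complex.norm_real]
    exact le_abs_self _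
  refine e3.trans ?_
  rw [e2]
  -- Schur's test in symmetric form: products of coefficients will be split by 2ab ≤ a² + b², after
  -- which only row and column sums of the kernel enter.
  have hs : ∑ I ∈ 𝓘, ∑ J ∈ 𝓘, (‖a I‖ ^ 2 + ‖a J‖ ^ 2) * interaction I J ≤
      2 * C₂ * ∑ I ∈ 𝓘, ‖a I‖ ^ 2 * I.length := by
    simp_rw [add_mul, Finset.sum_add_distrib]
    have t1 : ∑ I ∈ 𝓘, ∑ J ∈ 𝓘, ‖a I‖ ^ 2 * interaction I J ≤
        C₂ * ∑ I ∈ 𝓘, ‖a I‖ ^ 2 * I.length := by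
      rw [Finset.mul_sum]
      refine Finset.sum_le_sum fun I _ => ?_
      rw [← Finset.mul_sum]
      nlinarith [(hC₂ 𝓘).1 I, sq_nonneg ‖a I‖]
    have t2 : ∑ I ∈ 𝓘, ∑ J ∈ 𝓘, ‖a J‖ ^ 2 * interaction I J ≤
        C₂ * ∑ I ∈ 𝓘, ‖a I‖ ^ 2 * I.length := by
      rw [Finset.sum_comm, Finset.mul_sum]
      refine Finset.sum_le_sum fun I _ => ?_
      rw [← Finset.mul_sum]
      nlinarith [(hC₂ 𝓘).2 I, sq_nonneg ‖a I‖]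
    linarith
  have hb : ∀ I ∈ 𝓘, ∀ J ∈ 𝓘, ‖(a I * conj (a J)) * ∫ x, ψ I x * conj (ψ J x)‖ ≤
      C₁ / 2 * ((‖a I‖ ^ 2 + ‖a J‖ ^ 2) * interaction I J) +
      C₁ / 2 * ((‖a J‖ ^ 2 + ‖a I‖ ^ 2) * interaction J I) := by
    intro I hI J hJ
    have h1 := hC₁ I J _ _ (hψ I hI) (hψ J hJ).star
    rw [norm_mul, norm_mul, RCLike.norm_conj]
    have h2 := interaction_nonneg I J
    have h3 := interaction_nonneg J I
    have h4 : ‖a I‖ * ‖a J‖ ≤ (‖a I‖ ^ 2 + ‖a J‖ ^ 2) / 2 := by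
      nlinarith [sq_nonneg (‖a I‖ - ‖a J‖)]
    calc _ ≤ (‖a I‖ ^ 2 + ‖a J‖ ^ 2) / 2 * (C₁ * (interaction I J + interaction J I)) := by
          gcongr
      _ = _ := by ring
  calc _ ≤ ∑ I ∈ 𝓘, ∑ J ∈ 𝓘, ‖(a I * conj (a J)) * ∫ x, ψ I x * conj (ψ J x)‖ :=
        (norm_sum_le _ _).trans (Finset.sum_le_sum fun I _ => norm_sum_le _ _)
    _ ≤ ∑ I ∈ 𝓘, ∑ J ∈ 𝓘, (C₁ / 2 * ((‖a I‖ ^ 2 + ‖a J‖ ^ 2) * interaction I J) +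
          C₁ / 2 * ((‖a J‖ ^ 2 + ‖a I‖ ^ 2) * interaction J I)) :=
        Finset.sum_le_sum fun I hI => Finset.sum_le_sum fun J hJ => hb I hI J hJ
    _ = C₁ * ∑ I ∈ 𝓘, ∑ J ∈ 𝓘, (‖a I‖ ^ 2 + ‖a J‖ ^ 2) * interaction I J := by
        simp_rw [Finset.sum_add_distrib]
        rw [Finset.sum_comm (f := fun I J => C₁ / 2 * ((‖a J‖ ^ 2 + ‖a I‖ ^ 2) * interaction J I))]
        simp_rw [← Finset.mul_sum]
        ring
    _ ≤ C₁ * (2 * C₂ * ∑ I ∈ 𝓘, ‖a I‖ ^ 2 * I.length) := mul_le_mul_of_nonneg_left hs h₁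
    _ = _ := by ring

/-! ### Local oscillation and the John-Nirenberg inequality. -/

namespace DyadicInterval

instance : Countable DyadicInterval :=
  Function.Injective.countable (f := fun I : DyadicInterval => (I.k, I.m)) (by
    rintro ⟨k, m⟩ ⟨k', m'⟩ h
    simpa using h)

/-- The triple of a dyadic interval. -/
def triple (Q : DyadicInterval) : Set ℝ := Set.Ico (Q.left - Q.length) (Q.left + 2 * Q.length)

lemma volume_triple (Q : DyadicInterval) : volume Q.triple = ENNReal.ofReal (3 * Q.length) := by
  unfold triple
  rw [Real.volume_Ico]
  congr 1
  ring

lemma length_le_abs_sub {Q : DyadicInterval} {x z : ℝ} (hx : x ∈ Q.toSet) (hz : z ∉ Q.triple) :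
    Q.length ≤ |x - z| := by
  rw [toSet_eq] at hx
  simp only [triple, Set.mem_Ico, not_and_or, not_le, not_lt] at hz
  obtain ⟨h1, h2⟩ := hx
  rcases hz with hz | hz
  · exact le_trans (by linarith) (le_abs_self _)
  · exact le_trans (by linarith) (neg_le_abs _)

lemma triple_subset {P K : DyadicInterval} (h : P.toSet ⊆ K.toSet) : P.triple ⊆ K.triple := by
  have hl : P.length ≤ K.length := length_le_iff.2 (k_le_of_subset h)
  rw [toSet_eq, toSet_eq, Set.Ico_subset_Ico_iff (by linarith [P.length_pos])] at h
  exact Set.Ico_subset_Ico (by linarith [h.1]) (by linarith [h.2])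

end DyadicInterval

/-- The oscillation on `Q` of the part of a sum of molecules that is not localized near `Q`. -/
lemma exists_osc_le (N : ℕ) (hN : 3 ≤ N) {A : ℝ} (hA : 0 ≤ A) :
    ∃ C : ℝ, 0 ≤ C ∧ ∀ (𝓢 : Finset DyadicInterval) (a : DyadicInterval → ℂ)
      (ψ : DyadicInterval → ℝ → ℂ) (Q : DyadicInterval),
      (∀ I ∈ 𝓢, IsMolecule N A I (ψ I)) → (∀ I ∈ 𝓢, ‖a I‖ ≤ 1) →
      (∀ I ∈ 𝓢, ¬ I.toSet ⊆ Q.triple) → ∀ x ∈ Q.toSet, ∀ y ∈ Q.toSet,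
      ‖∑ I ∈ 𝓢, a I * ψ I x - ∑ I ∈ 𝓢, a I * ψ I y‖ ≤ C := by
  obtain ⟨C, hC0, hC⟩ := sum_relDist_point
  refine ⟨4 * A * (C + C), by positivity, fun 𝓢 a ψ Q hψ ha hQ x hx y hy => ?_⟩
  have hQl := Q.length_pos
  have main : ∀ I ∈ 𝓢, ‖a I * ψ I x - a I * ψ I y‖ ≤ 4 * A *
      (((1 : ℝ) / 2) ^ (I.k - Q.k).natAbs * (I.relDist x ^ 2)⁻¹ +
        ((1 : ℝ) / 2) ^ (I.k - Q.k).natAbs * (I.relDist y ^ 2)⁻¹) := by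
    intro I hI
    have hIl := I.length_pos
    have hρx := relDist_pos (I := I) x
    have hρy := relDist_pos (I := I) y
    rw [← mul_sub, norm_mul]
    have h1 : ‖a I‖ * ‖ψ I x - ψ I y‖ ≤ ‖ψ I x - ψ I y‖ :=
      mul_le_of_le_one_left (norm_nonneg _) (ha I hI)
    refine h1.trans ?_
    -- If |I| ≥ |Q|, smoothness gives the factor |Q| / |I|. If |I| < |Q|, some point of `I` lies
    -- outside the triple of `Q`, so the relative distance is at least |Q| / |I| on `Q`, and one of
    -- three powers of decay gives the factor |I| / |Q|. In both cases the sum over all scales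
    -- converges.
    rcases le_or_gt Q.k I.k with hk | hk
    · have h2 := (hψ I hI).norm_sub_le hA (by omega) x y
      have h3 : |x - y| ≤ Q.length := abs_sub_le_length hx hy
      have h4 : |x - y| / I.length ≤ 1 := by
        rw [div_le_one hIl]
        exact h3.trans (length_le_iff.2 hk)
      have h5 : ‖ψ I x - ψ I y‖ ≤
          A / I.length * ((I.relDist y ^ 2)⁻¹ * (1 + 1) ^ 2) * Q.length := by
        refine h2.trans ?_
        gcongr
      rw [← length_div_length_eq hk]
      have h6 : 0 ≤ 4 * A * (Q.length / I.length * (I.relDist x ^ 2)⁻¹) := by positivity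
      refine h5.trans ?_
      have e : A / I.length * ((I.relDist y ^ 2)⁻¹ * (1 + 1) ^ 2) * Q.length =
        4 * A * (Q.length / I.length * (I.relDist y ^ 2)⁻¹) := by ring
      rw [e]
      linarith
    · rw [show (I.k - Q.k).natAbs = (Q.k - I.k).natAbs by omega, ← length_div_length_eq hk.le]
      have key : ∀ z ∈ Q.toSet, ‖ψ I z‖ ≤ A * (I.length / Q.length * (I.relDist z ^ 2)⁻¹) := by
        intro z hz
        refine ((hψ I hI).norm_le_pow hA hN z).trans (mul_le_mul_of_nonneg_left ?_ hA)
        obtain ⟨t, ht, ht'⟩ := Set.not_subset.1 (hQ I hI)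
        have h2 := (length_le_abs_sub hz ht').trans (abs_sub_le_relDist (x := z) ht)
        have hρ := relDist_pos (I := I) z
        rw [pow_succ, mul_inv, mul_comm]
        refine mul_le_mul_of_nonneg_right ?_ (by positivity)
        rw [inv_le_comm₀ hρ (by positivity), inv_div, div_le_iff₀ hIl]
        linarith
      have h6 : 0 ≤ A * (I.length / Q.length * (I.relDist x ^ 2)⁻¹) := by positivity
      have h7 : 0 ≤ A * (I.length / Q.length * (I.relDist y ^ 2)⁻¹) := by positivity
      have h8 := norm_sub_le (ψ I x) (ψ I y)
      have h9 := key x hx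
      have h10 := key y hy
      nlinarith
  rw [← Finset.sum_sub_distrib]
  refine (norm_sum_le _ _).trans ((Finset.sum_le_sum main).trans ?_)
  rw [← Finset.mul_sum, Finset.sum_add_distrib]
  exact mul_le_mul_of_nonneg_left (add_le_add (hC _ _ _) (hC _ _ _)) (by positivity)

open Classical in
/-- The part of a sum of molecules that is localized in the triple of `Q`. -/
noncomputable def localSum (𝓘 : Finset DyadicInterval) (a : DyadicInterval → ℂ)
    (ψ : DyadicInterval → ℝ → ℂ) (Q : DyadicInterval) (x : ℝ) : ℂ :=
  ∑ I ∈ 𝓘 with I.toSet ⊆ Q.triple, a I * ψ I x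

section JohnNirenberg

variable {N : ℕ} {A : ℝ} {𝓘 : Finset DyadicInterval} {a : DyadicInterval → ℂ}
  {ψ : DyadicInterval → ℝ → ℂ}

lemma continuous_localSum (hψ : ∀ I ∈ 𝓘, IsMolecule N A I (ψ I)) (Q : DyadicInterval) :
    Continuous (localSum 𝓘 a ψ Q) := by
  classical
  unfold localSum
  exact continuous_finsetSum _ fun I hI =>
    continuous_const.mul (hψ I (Finset.mem_filter.1 hI).1).differentiable.continuous

lemma norm_le_one_of_square (ha : ∀ x, ∑ I ∈ 𝓘, I.toSet.indicator (fun _ => ‖a I‖ ^ 2) x ≤ 1)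
    {I : DyadicInterval} (hI : I ∈ 𝓘) : ‖a I‖ ≤ 1 := by
  have h := ha I.left
  have h2 : I.toSet.indicator (fun _ => ‖a I‖ ^ 2) I.left ≤ 1 := by
    refine le_trans ?_ h
    refine Finset.single_le_sum (f := fun J => J.toSet.indicator (fun _ => ‖a J‖ ^ 2) I.left)
      (fun J _ => Set.indicator_nonneg (fun _ _ => by positivity) _) hI
  rw [Set.indicator_of_mem I.left_mem] at h2
  nlinarith [norm_nonneg (a I)]

/-- Integrating the pointwise bound on the square function over `s` gives a Carleson packing
condition. -/
lemma carleson_of_square (ha : ∀ x, ∑ I ∈ 𝓘, I.toSet.indicator (fun _ => ‖a I‖ ^ 2) x ≤ 1)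
    {s : Set ℝ} {c : ℝ} (hc : 0 ≤ c) (hsc : volume s = ENNReal.ofReal c)
    {𝓢 : Finset DyadicInterval} (h𝓢 : 𝓢 ⊆ 𝓘) (h : ∀ I ∈ 𝓢, I.toSet ⊆ s) :
    ∑ I ∈ 𝓢, ‖a I‖ ^ 2 * I.length ≤ c := by
  have h1 : ENNReal.ofReal (∑ I ∈ 𝓢, ‖a I‖ ^ 2 * I.length) ≤ ENNReal.ofReal c := by
    rw [ENNReal.ofReal_sum_of_nonneg (fun I _ => by have := I.length_pos; positivity)]
    calc ∑ I ∈ 𝓢, ENNReal.ofReal (‖a I‖ ^ 2 * I.length)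
        = ∑ I ∈ 𝓢, ∫⁻ x in s, I.toSet.indicator (fun _ => ENNReal.ofReal (‖a I‖ ^ 2)) x := by
          refine Finset.sum_congr rfl fun I hI => ?_
          rw [lintegral_indicator I.measurableSet_toSet, setLIntegral_const,
            Measure.restrict_apply I.measurableSet_toSet,
            Set.inter_eq_left.2 (h I hI), volume_toSet, ENNReal.ofReal_mul (by positivity)]
      _ = ∫⁻ x in s, ∑ I ∈ 𝓢, I.toSet.indicator (fun _ => ENNReal.ofReal (‖a I‖ ^ 2)) x := by
          rw [lintegral_finsetSum]
          exact fun I _ => measurable_const.indicator I.measurableSet_toSet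
      _ ≤ ∫⁻ x in s, 1 := by
          refine lintegral_mono fun x => ?_
          have e : ∀ I ∈ 𝓢, I.toSet.indicator (fun _ => ENNReal.ofReal (‖a I‖ ^ 2)) x =
              ENNReal.ofReal (I.toSet.indicator (fun _ => ‖a I‖ ^ 2) x) := by
            intro I _
            by_cases hx : x ∈ I.toSet <;> simp [hx]
          have hnn : ∀ I : DyadicInterval, 0 ≤ I.toSet.indicator (fun _ => ‖a I‖ ^ 2) x :=
            fun I => Set.indicator_nonneg (fun _ _ => by positivity) _
          dsimp only
          rw [Finset.sum_congr rfl e, ← ENNReal.ofReal_sum_of_nonneg fun I _ => hnn I]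
          refine ENNReal.ofReal_le_one.2 (le_trans ?_ (ha x))
          exact Finset.sum_le_sum_of_subset_of_nonneg h𝓢 fun I _ _ => hnn I
      _ = ENNReal.ofReal c := by simp [hsc]
  exact (ENNReal.ofReal_le_ofReal_iff hc).1 h1

/-- The L² bound for molecules combined with the packing condition on the triple of `Q`. -/
lemma exists_lintegral_localSum_sq_le (N : ℕ) (hN : 5 ≤ N) {A : ℝ} (hA : 0 ≤ A) :
    ∃ C : ℝ≥0, ∀ (𝓘 : Finset DyadicInterval) (a : DyadicInterval → ℂ)
      (ψ : DyadicInterval → ℝ → ℂ), (∀ I ∈ 𝓘, IsMolecule N A I (ψ I)) →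
      (∀ x, ∑ I ∈ 𝓘, I.toSet.indicator (fun _ => ‖a I‖ ^ 2) x ≤ 1) →
      ∀ Q, ∫⁻ x, ‖localSum 𝓘 a ψ Q x‖ₑ ^ (2 : ℝ) ≤ C * ENNReal.ofReal Q.length := by
  classical
  obtain ⟨C, hC0, hC⟩ := exists_integral_norm_sq_le N hN hA
  refine ⟨(C * 3).toNNReal, fun 𝓘 a ψ hψ ha Q => ?_⟩
  set 𝓢 := 𝓘.filter fun I => I.toSet ⊆ Q.triple with h𝓢
  obtain ⟨h1, h2⟩ := hC 𝓢 a ψ fun I hI => hψ I (Finset.mem_filter.1 hI).1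
  have h3 := carleson_of_square ha (s := Q.triple) (c := 3 * Q.length)
    (by have := Q.length_pos; positivity) Q.volume_triple (𝓢 := 𝓢) (Finset.filter_subset _ _)
    fun I hI => (Finset.mem_filter.1 hI).2
  have e : ∀ x, ‖localSum 𝓘 a ψ Q x‖ₑ ^ (2 : ℝ) =
      ENNReal.ofReal (‖∑ I ∈ 𝓢, a I * ψ I x‖ ^ 2) := by
    intro x
    rw [ENNReal.rpow_ofNat, ENNReal.ofReal_pow (norm_nonneg _), ofReal_norm, localSum]
  simp_rw [e]
  rw [← ofReal_integral_eq_lintegral_ofReal h1 (Filter.Eventually.of_forall fun x => by positivity),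
    show (((C * 3).toNNReal : ℝ≥0) : ℝ≥0∞) = ENNReal.ofReal (C * 3) from rfl,
    ← ENNReal.ofReal_mul (by positivity)]
  refine ENNReal.ofReal_le_ofReal (h2.trans ?_)
  have : C * (3 * Q.length) = C * 3 * Q.length := by ring
  exact (mul_le_mul_of_nonneg_left h3 hC0).trans this.le

/-- The dyadic intervals that cover a level set of small relative measure. -/
lemma exists_dyadic_cover (K : DyadicInterval) (e : Set ℝ) (he : MeasurableSet e) (heK : e ⊆ K.toSet)
    (hsmall : 2 * volume e ≤ volume K.toSet)
    (hopen : ∀ x ∈ e, ∃ k ≤ K.k, (ofPoint k x).toSet ⊆ e) :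
    ∃ 𝒬 : Set DyadicInterval, e ⊆ ⋃ Q : 𝒬, Q.1.toSet ∧
      ∑' Q : 𝒬, volume Q.1.toSet ≤ 2 * volume e ∧
      ∀ Q ∈ 𝒬, Q.k < K.k ∧ Q.toSet ⊆ (ofPoint (Q.k + 1) Q.left).toSet ∧
        (ofPoint (Q.k + 1) Q.left).toSet ⊆ K.toSet ∧
        2 * volume ((ofPoint (Q.k + 1) Q.left).toSet ∩ e) ≤
          volume (ofPoint (Q.k + 1) Q.left).toSet := by
  set good : DyadicInterval → Prop := fun Q =>
    Q.toSet ⊆ K.toSet ∧ volume Q.toSet < 2 * volume (Q.toSet ∩ e) with hgood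
  -- The maximal dyadic intervals in which `e` has density above 1/2. They are disjoint, so their
  -- total length is at most twice |e|. By maximality `e` has density at most 1/2 in the dyadic
  -- parent; the smallness of `e` excludes `K` itself, so the parent stays inside `K`.
  refine ⟨{Q | good Q ∧ ∀ Q', good Q' → Q.toSet ⊆ Q'.toSet → Q' = Q}, ?_, ?_, ?_⟩
  · intro x hx
    have hsub : ∀ k ≤ K.k, (ofPoint k x).toSet ⊆ K.toSet := fun k hk =>
      subset_of_mem_of_mem (mem_ofPoint k x) (heK hx) hk
    obtain ⟨k₀, hk₀, hk₀e⟩ := hopen x hx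
    have hne : good (ofPoint k₀ x) := by
      refine ⟨hsub k₀ hk₀, ?_⟩
      rw [Set.inter_eq_left.2 hk₀e, volume_toSet, two_mul]
      exact ENNReal.lt_add_right ENNReal.ofReal_ne_top (ofReal_length_pos _).ne'
    have hbdd : ∀ k, (k ≤ K.k ∧ good (ofPoint k x)) → k ≤ K.k := fun k h => h.1
    obtain ⟨k, ⟨hk, hkg⟩, hmax⟩ := Int.exists_greatest_of_bdd
      (P := fun k => k ≤ K.k ∧ good (ofPoint k x)) ⟨K.k, hbdd⟩ ⟨k₀, hk₀, hne⟩
    refine Set.mem_iUnion.2 ⟨⟨ofPoint k x, hkg, fun Q' hQ' hsub' => ?_⟩, mem_ofPoint k x⟩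
    have hxQ : x ∈ Q'.toSet := hsub' (mem_ofPoint k x)
    have hQ'e : Q' = ofPoint Q'.k x := eq_of_mem_of_mem hxQ (mem_ofPoint _ x) rfl
    have h1 : Q'.k ≤ k := hmax Q'.k ⟨k_le_of_subset hQ'.1, hQ'e ▸ hQ'⟩
    have h2 : k ≤ Q'.k := k_le_of_subset hsub'
    rw [hQ'e]
    congr 1
    omega
  · set 𝒬 := {Q | good Q ∧ ∀ Q', good Q' → Q.toSet ⊆ Q'.toSet → Q' = Q}
    have hdisj : Pairwise (Function.onFun Disjoint fun Q : 𝒬 => Q.1.toSet ∩ e) := by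
      intro Q Q' hne
      refine Set.disjoint_left.2 fun x hx hx' => hne ?_
      rcases le_total Q.1.k Q'.1.k with h | h
      · exact Subtype.ext (Q.2.2 Q'.1 Q'.2.1 (subset_of_mem_of_mem hx.1 hx'.1 h)).symm
      · exact Subtype.ext (Q'.2.2 Q.1 Q.2.1 (subset_of_mem_of_mem hx'.1 hx.1 h))
    calc ∑' Q : 𝒬, volume Q.1.toSet ≤ ∑' Q : 𝒬, 2 * volume (Q.1.toSet ∩ e) :=
          ENNReal.tsum_le_tsum fun Q => Q.2.1.2.le
      _ = 2 * volume (⋃ Q : 𝒬, Q.1.toSet ∩ e) := by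
          rw [ENNReal.tsum_mul_left,
            measure_iUnion hdisj fun Q => Q.1.measurableSet_toSet.inter he]
      _ ≤ 2 * volume e := by
          gcongr
          exact Set.iUnion_subset fun Q => Set.inter_subset_right
  · rintro Q ⟨hQ, hmax⟩
    have hk : Q.k ≤ K.k := k_le_of_subset hQ.1
    have hne : Q.k ≠ K.k := by
      intro h
      have : Q = K := eq_of_mem_of_mem Q.left_mem (hQ.1 Q.left_mem) h
      have h2 := hQ.2
      rw [this] at h2
      refine absurd (h2.trans_le ?_) (lt_irrefl _)
      refine le_trans ?_ hsmall
      gcongr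
      exact Set.inter_subset_right
    set P := ofPoint (Q.k + 1) Q.left with hP
    have hQP : Q.toSet ⊆ P.toSet :=
      subset_of_mem_of_mem Q.left_mem (mem_ofPoint _ _) (by simp [hP])
    have hPK : P.toSet ⊆ K.toSet :=
      subset_of_mem_of_mem (mem_ofPoint _ _) (hQ.1 Q.left_mem)
        (by rw [ofPoint_k]; omega)
    refine ⟨lt_of_le_of_ne hk hne, hQP, hPK, ?_⟩
    by_contra! hc
    have := congrArg DyadicInterval.k (hmax P ⟨hPK, hc⟩ hQP)
    simp [hP] at this

/-- One step of the John-Nirenberg iteration. -/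
lemma exists_localSum_step (N : ℕ) (hN : 5 ≤ N) {A : ℝ} (hA : 0 ≤ A) {p : ℝ} (hp : 1 ≤ p) :
    ∃ B : ℝ≥0, ∀ (𝓘 : Finset DyadicInterval) (a : DyadicInterval → ℂ)
      (ψ : DyadicInterval → ℝ → ℂ), (∀ I ∈ 𝓘, IsMolecule N A I (ψ I)) →
      (∀ x, ∑ I ∈ 𝓘, I.toSet.indicator (fun _ => ‖a I‖ ^ 2) x ≤ 1) → ∀ D : ℝ≥0,
      (∀ K : DyadicInterval, ∫⁻ x in K.toSet, ‖localSum 𝓘 a ψ K x‖ₑ ^ p ≤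
        D * ENNReal.ofReal K.length) →
      ∀ K : DyadicInterval, ∫⁻ x in K.toSet, ‖localSum 𝓘 a ψ K x‖ₑ ^ p ≤
        (B + 2⁻¹ * D : ℝ≥0) * ENNReal.ofReal K.length := by
  classical
  obtain ⟨C₀, hC₀0, hC₀⟩ := exists_osc_le N (by omega) hA
  obtain ⟨C, hC⟩ := exists_lintegral_localSum_sq_le N hN hA
  have hp0 : 0 < p := by linarith
  -- Chosen so that 2^p · 2δ = 1/2, the contraction factor of the iteration: 2^p is lost on each
  -- covering interval and 2 in the total length of the cover.
  set δ : ℝ≥0 := 2⁻¹ * (2 * 2 ^ p)⁻¹ with hδ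
  have h2p : (2 : ℝ≥0) ≤ 2 ^ p := by
    simpa using NNReal.rpow_le_rpow_of_exponent_le (show (1 : ℝ≥0) ≤ 2 by norm_num) hp
  have hδpos : 0 < δ := by positivity
  have hδ4 : δ ≤ 8⁻¹ := by
    rw [hδ]
    calc (2⁻¹ * (2 * 2 ^ p)⁻¹ : ℝ≥0) ≤ 2⁻¹ * (2 * 2)⁻¹ := by gcongr
      _ = 8⁻¹ := by norm_num
  -- By Chebyshev and the L² bound, each local sum exceeds this `L` on a set of measure at most δ
  -- times the length of its interval.
  obtain ⟨L, hL0, hL⟩ : ∃ L : ℝ≥0, 0 < L ∧ C ≤ δ * L ^ 2 := by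
    refine ⟨C / δ + 1, by positivity, ?_⟩
    have : C ≤ δ * (C / δ + 1) := by
      rw [mul_add, mul_div_cancel₀ _ hδpos.ne']
      exact le_self_add
    refine this.trans ?_
    gcongr
    exact le_self_pow₀ le_add_self (by norm_num)
  -- Bounds the difference of two local sums: at most L for each at one common good point, plus the
  -- oscillation of the difference.
  set b : ℝ≥0 := 2 * L + C₀.toNNReal with hb
  refine ⟨L ^ p + b ^ p, fun 𝓘 a ψ hψ ha D hD K => ?_⟩
  have hcont := fun Q => continuous_localSum (a := a) hψ Q
  have hweak : ∀ Q, volume {x | (L : ℝ≥0∞) < ‖localSum 𝓘 a ψ Q x‖ₑ} ≤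
      δ * ENNReal.ofReal Q.length := by
    intro Q
    have h1 := mul_meas_ge_le_lintegral (μ := volume)
      (f := fun x => ‖localSum 𝓘 a ψ Q x‖ₑ ^ (2 : ℝ))
      ((hcont Q).enorm.measurable.pow_const _) ((L : ℝ≥0∞) ^ (2 : ℝ))
    have h2 := h1.trans (hC 𝓘 a ψ hψ ha Q)
    have h3 : volume {x | (L : ℝ≥0∞) < ‖localSum 𝓘 a ψ Q x‖ₑ} ≤
        volume {x | (L : ℝ≥0∞) ^ (2 : ℝ) ≤ ‖localSum 𝓘 a ψ Q x‖ₑ ^ (2 : ℝ)} :=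
      measure_mono fun x hx => ENNReal.rpow_le_rpow (le_of_lt hx) (by norm_num)
    have h4 : (L : ℝ≥0∞) ^ (2 : ℝ) * volume {x | (L : ℝ≥0∞) < ‖localSum 𝓘 a ψ Q x‖ₑ} ≤
        (L : ℝ≥0∞) ^ (2 : ℝ) * (δ * ENNReal.ofReal Q.length) := by
      calc _ ≤ _ := mul_le_mul_right h3 _
        _ ≤ C * ENNReal.ofReal Q.length := h2
        _ ≤ (δ * L ^ 2 : ℝ≥0) * ENNReal.ofReal Q.length := by gcongr
        _ = _ := by
          rw [ENNReal.rpow_ofNat]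
          push_cast
          ring
    refine (ENNReal.mul_le_mul_iff_right ?_ ?_).1 h4
    · simp [hL0.ne']
    · simp
  set e : Set ℝ := K.toSet ∩ {x | (L : ℝ≥0∞) < ‖localSum 𝓘 a ψ K x‖ₑ} with he
  have hopen : IsOpen {x | (L : ℝ≥0∞) < ‖localSum 𝓘 a ψ K x‖ₑ} :=
    isOpen_lt continuous_const (hcont K).enorm
  have hme : MeasurableSet e := K.measurableSet_toSet.inter hopen.measurableSet
  have hve : volume e ≤ δ * ENNReal.ofReal K.length :=
    (measure_mono Set.inter_subset_right).trans (hweak K)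
  have hδ4' : (δ : ℝ≥0∞) ≤ 8⁻¹ := by
    calc (δ : ℝ≥0∞) ≤ ((8⁻¹ : ℝ≥0) : ℝ≥0∞) := by exact_mod_cast hδ4
      _ = _ := by rw [ENNReal.coe_inv (by norm_num)]; norm_num
  have hδ8 : 8 * (δ : ℝ≥0∞) ≤ 1 := by
    calc 8 * (δ : ℝ≥0∞) ≤ 8 * 8⁻¹ := by gcongr
      _ = 1 := ENNReal.mul_inv_cancel (by norm_num) (by norm_num)
  obtain ⟨𝒬, hcov, hsum, h𝒬⟩ := exists_dyadic_cover K e hme Set.inter_subset_left (by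
      rw [volume_toSet]
      calc 2 * volume e ≤ 2 * (δ * ENNReal.ofReal K.length) := by gcongr
        _ ≤ 8 * (δ * ENNReal.ofReal K.length) := by gcongr; norm_num
        _ = (8 * δ) * ENNReal.ofReal K.length := by ring
        _ ≤ 1 * ENNReal.ofReal K.length := by gcongr
        _ = _ := one_mul _) (by
      rintro x ⟨hxK, hx⟩
      obtain ⟨r, hr, hball⟩ := Metric.isOpen_iff.1 hopen x hx
      obtain ⟨n, hn⟩ := exists_pow_lt_of_lt_one hr (show (2⁻¹ : ℝ) < 1 by norm_num)
      refine ⟨min (-(n : ℤ)) K.k, min_le_right _ _, ?_⟩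
      have hsK := subset_of_mem_of_mem (mem_ofPoint (min (-(n : ℤ)) K.k) x) hxK (min_le_right _ _)
      refine Set.subset_inter hsK fun y hy => hball ?_
      rw [Metric.mem_ball, Real.dist_eq]
      refine (abs_sub_le_length hy (mem_ofPoint _ x)).trans_lt ?_
      refine lt_of_le_of_lt ?_ hn
      rw [length_ofPoint, inv_pow, ← zpow_natCast, ← zpow_neg]
      exact zpow_le_zpow_right₀ (by norm_num) (min_le_left _ _))
  have hQ : ∀ Q ∈ 𝒬, ∫⁻ x in Q.toSet, ‖localSum 𝓘 a ψ K x‖ₑ ^ p ≤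
      2 ^ p * (D + b ^ p) * volume Q.toSet := by
    intro Q hQ
    obtain ⟨hk, hQP, hPK, hPe⟩ := h𝒬 Q hQ
    set P := ofPoint (Q.k + 1) Q.left with hP
    have hPl : P.length = 2 * Q.length := by
      rw [hP, length_ofPoint, zpow_add₀ (by norm_num)]
      unfold DyadicInterval.length
      ring
    have hPpos := P.ofReal_length_pos
    -- In the parent `P` the level set of the sum for `K` has density at most 1/2 and that of the
    -- sum for `P` at most δ ≤ 1/8, so some point of `P` avoids both.
    obtain ⟨y, hyP, hyK, hyP'⟩ : ∃ y ∈ P.toSet, ‖localSum 𝓘 a ψ K y‖ₑ ≤ L ∧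
        ‖localSum 𝓘 a ψ P y‖ₑ ≤ L := by
      by_contra! hc
      have hsub : P.toSet ⊆ (P.toSet ∩ e) ∪ {x | (L : ℝ≥0∞) < ‖localSum 𝓘 a ψ P x‖ₑ} := by
        intro y hy
        by_cases h : ‖localSum 𝓘 a ψ K y‖ₑ ≤ L
        · exact Or.inr (hc y hy h)
        · exact Or.inl ⟨hy, hPK hy, not_le.1 h⟩
      have h1 := (measure_mono hsub).trans (measure_union_le (μ := volume) _ _)
      have h2 := hweak P
      have h3 : 2 * volume P.toSet ≤ volume P.toSet + 4⁻¹ * volume P.toSet := by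
        calc 2 * volume P.toSet ≤ 2 * (volume (P.toSet ∩ e) + δ * ENNReal.ofReal P.length) := by
              gcongr
              exact h1.trans (by gcongr)
          _ = 2 * volume (P.toSet ∩ e) + 2 * δ * ENNReal.ofReal P.length := by ring
          _ ≤ volume P.toSet + 4⁻¹ * volume P.toSet := by
              rw [volume_toSet] at *
              gcongr
              calc 2 * (δ : ℝ≥0∞) ≤ 2 * 8⁻¹ := by gcongr
                _ = 4⁻¹ := by
                  rw [show (8 : ℝ≥0∞) = 2 * 4 by norm_num, ENNReal.mul_inv (by simp) (by simp),
                    ← mul_assoc, ENNReal.mul_inv_cancel (by simp) (by simp), one_mul]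
      rw [volume_toSet, two_mul] at h3
      have h4 := (ENNReal.add_le_add_iff_left ENNReal.ofReal_ne_top).1 h3
      have h5 : (4⁻¹ : ℝ≥0∞) * ENNReal.ofReal P.length < 1 * ENNReal.ofReal P.length := by
        refine (ENNReal.mul_lt_mul_iff_left hPpos.ne' ENNReal.ofReal_ne_top).2 ?_
        rw [ENNReal.inv_lt_one]
        norm_num
      rw [one_mul] at h5
      exact absurd h5 (not_lt.2 h4)
    -- Only intervals outside the triple of `P` survive in the difference, so the oscillation bound
    -- applies to it on `P`.
    have hdiff : ∀ x, localSum 𝓘 a ψ K x - localSum 𝓘 a ψ P x =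
        ∑ I ∈ (𝓘.filter fun I => I.toSet ⊆ K.triple).filter fun I => ¬ I.toSet ⊆ P.triple,
          a I * ψ I x := by
      intro x
      have hsub := triple_subset hPK
      have e1 : 𝓘.filter (fun I => I.toSet ⊆ P.triple) =
          (𝓘.filter fun I => I.toSet ⊆ K.triple).filter fun I => I.toSet ⊆ P.triple := by
        rw [Finset.filter_filter]
        refine Finset.filter_congr fun I _ => ⟨fun h => ⟨h.trans hsub, h⟩, fun h => h.2⟩
      unfold localSum
      rw [e1, sub_eq_iff_eq_add', Finset.sum_filter_add_sum_filter_not]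
    have hpt : ∀ x ∈ Q.toSet, ‖localSum 𝓘 a ψ K x‖ₑ ≤ ‖localSum 𝓘 a ψ P x‖ₑ + b := by
      intro x hx
      have h1 := hC₀ ((𝓘.filter fun I => I.toSet ⊆ K.triple).filter fun I => ¬ I.toSet ⊆ P.triple)
        a ψ P (fun I hI => hψ I (Finset.mem_filter.1 (Finset.mem_filter.1 hI).1).1)
        (fun I hI => norm_le_one_of_square ha (Finset.mem_filter.1 (Finset.mem_filter.1 hI).1).1)
        (fun I hI => (Finset.mem_filter.1 hI).2) x (hQP hx) y hyP
      rw [← hdiff, ← hdiff] at h1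
      have h2 : localSum 𝓘 a ψ K x = localSum 𝓘 a ψ P x + (localSum 𝓘 a ψ K y -
          localSum 𝓘 a ψ P y + (localSum 𝓘 a ψ K x - localSum 𝓘 a ψ P x -
          (localSum 𝓘 a ψ K y - localSum 𝓘 a ψ P y))) := by ring
      have h3 : ‖localSum 𝓘 a ψ K x - localSum 𝓘 a ψ P x -
          (localSum 𝓘 a ψ K y - localSum 𝓘 a ψ P y)‖ₑ ≤ (C₀.toNNReal : ℝ≥0∞) := by
        rw [← ofReal_norm]
        exact ENNReal.ofReal_le_ofReal h1
      rw [h2]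
      refine (enorm_add_le _ _).trans ?_
      gcongr
      refine (enorm_add_le _ _).trans ?_
      rw [hb]
      push_cast
      gcongr
      refine (enorm_sub_le).trans ?_
      rw [two_mul]
      gcongr
    calc ∫⁻ x in Q.toSet, ‖localSum 𝓘 a ψ K x‖ₑ ^ p
        ≤ ∫⁻ x in P.toSet, (2 : ℝ≥0∞) ^ (p - 1) * (‖localSum 𝓘 a ψ P x‖ₑ ^ p + (b : ℝ≥0∞) ^ p) := by
          refine (setLIntegral_mono' Q.measurableSet_toSet fun x hx => ?_).trans
            (lintegral_mono_set hQP)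
          refine (ENNReal.rpow_le_rpow (hpt x hx) hp0.le).trans ?_
          exact ENNReal.rpow_add_le_mul_rpow_add_rpow _ _ hp
      _ = 2 ^ (p - 1) * ((∫⁻ x in P.toSet, ‖localSum 𝓘 a ψ P x‖ₑ ^ p) +
            (b : ℝ≥0∞) ^ p * ENNReal.ofReal P.length) := by
          rw [lintegral_const_mul' _ _ (by simp), lintegral_add_right _ measurable_const,
            setLIntegral_const, volume_toSet]
      _ ≤ 2 ^ (p - 1) * (D * ENNReal.ofReal P.length +
            (b : ℝ≥0∞) ^ p * ENNReal.ofReal P.length) := by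
          gcongr
          exact hD P
      _ = (2 ^ (p - 1) * 2) * (D + (b : ℝ≥0∞) ^ p) * volume Q.toSet := by
          rw [hPl, ENNReal.ofReal_mul (by norm_num), volume_toSet]
          norm_num
          ring
      _ = _ := by
          congr 2
          conv_lhs => rw [← ENNReal.rpow_one 2, ← ENNReal.rpow_mul, one_mul]
          rw [← ENNReal.rpow_add _ _ (by simp) (by simp)]
          simp
  have hsplit : ∫⁻ x in K.toSet, ‖localSum 𝓘 a ψ K x‖ₑ ^ p ≤
      (∫⁻ x in e, ‖localSum 𝓘 a ψ K x‖ₑ ^ p) + ∫⁻ x in K.toSet \ e, ‖localSum 𝓘 a ψ K x‖ₑ ^ p := by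
    rw [← lintegral_inter_add_sdiff (μ := volume) (fun x => ‖localSum 𝓘 a ψ K x‖ₑ ^ p) K.toSet hme]
    rw [Set.inter_eq_right.2 (Set.inter_subset_left : e ⊆ K.toSet)]
  have h1 : ∫⁻ x in K.toSet \ e, ‖localSum 𝓘 a ψ K x‖ₑ ^ p ≤
      (L : ℝ≥0∞) ^ p * ENNReal.ofReal K.length := by
    calc _ ≤ ∫⁻ x in K.toSet \ e, (L : ℝ≥0∞) ^ p := by
          refine setLIntegral_mono' (K.measurableSet_toSet.diff hme) fun x hx => ?_
          refine ENNReal.rpow_le_rpow ?_ hp0.le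
          by_contra! hc
          exact hx.2 ⟨hx.1, hc⟩
      _ ≤ (L : ℝ≥0∞) ^ p * volume K.toSet := by
          rw [setLIntegral_const]
          gcongr
          exact Set.sdiff_subset
      _ = _ := by rw [volume_toSet]
  have h2 : ∫⁻ x in e, ‖localSum 𝓘 a ψ K x‖ₑ ^ p ≤
      (2⁻¹ * (D + b ^ p) : ℝ≥0) * ENNReal.ofReal K.length := by
    calc _ ≤ ∫⁻ x in ⋃ Q : 𝒬, Q.1.toSet, ‖localSum 𝓘 a ψ K x‖ₑ ^ p := lintegral_mono_set hcov
      _ ≤ ∑' Q : 𝒬, ∫⁻ x in Q.1.toSet, ‖localSum 𝓘 a ψ K x‖ₑ ^ p := lintegral_iUnion_le _ _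
      _ ≤ ∑' Q : 𝒬, 2 ^ p * (D + (b : ℝ≥0∞) ^ p) * volume Q.1.toSet :=
          ENNReal.tsum_le_tsum fun Q => hQ Q.1 Q.2
      _ ≤ 2 ^ p * (D + (b : ℝ≥0∞) ^ p) * (2 * (δ * ENNReal.ofReal K.length)) := by
          rw [ENNReal.tsum_mul_left]
          gcongr
          exact hsum.trans (by gcongr)
      _ = ((2 ^ p * (D + b ^ p) * (2 * δ) : ℝ≥0) : ℝ≥0∞) * ENNReal.ofReal K.length := by
          push_cast
          rw [ENNReal.coe_rpow_of_nonneg _ hp0.le, ENNReal.coe_rpow_of_nonneg _ hp0.le]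
          push_cast
          ring
      _ ≤ _ := by
          have : (2 ^ p * (D + b ^ p) * (2 * δ) : ℝ≥0) ≤ 2⁻¹ * (D + b ^ p) := by
            rw [hδ, mul_inv]
            have h0 : (2 : ℝ≥0) ^ p ≠ 0 := by positivity
            apply le_of_eq
            field_simp
          gcongr
  refine hsplit.trans ((add_le_add h2 h1).trans ?_)
  rw [← ENNReal.coe_rpow_of_nonneg _ hp0.le, ← add_mul, ← ENNReal.coe_add]
  refine mul_le_mul' (ENNReal.coe_le_coe.2 ?_) le_rfl
  have : (2⁻¹ * b ^ p : ℝ≥0) ≤ b ^ p := mul_le_of_le_one_left (by positivity) (by norm_num)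
  calc (2⁻¹ * (D + b ^ p) + L ^ p : ℝ≥0) = L ^ p + 2⁻¹ * b ^ p + 2⁻¹ * D := by ring
    _ ≤ _ := by gcongr

/-- The John-Nirenberg inequality for sums of molecules. -/
lemma exists_lintegral_localSum_rpow_le (N : ℕ) (hN : 5 ≤ N) {A : ℝ} (hA : 0 ≤ A) {p : ℝ}
    (hp : 1 ≤ p) :
    ∃ B : ℝ≥0, ∀ (𝓘 : Finset DyadicInterval) (a : DyadicInterval → ℂ)
      (ψ : DyadicInterval → ℝ → ℂ), (∀ I ∈ 𝓘, IsMolecule N A I (ψ I)) →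
      (∀ x, ∑ I ∈ 𝓘, I.toSet.indicator (fun _ => ‖a I‖ ^ 2) x ≤ 1) →
      ∀ K : DyadicInterval, ∫⁻ x in K.toSet, ‖localSum 𝓘 a ψ K x‖ₑ ^ p ≤
        B * ENNReal.ofReal K.length := by
  classical
  obtain ⟨B, hB⟩ := exists_localSum_step N hN hA hp
  have hp0 : 0 < p := by linarith
  refine ⟨2 * B + 1, fun 𝓘 a ψ hψ ha => ?_⟩
  -- A crude bound that starts the iteration. It depends on the number of intervals, but the map D ↦
  -- B + D / 2 forgets it: the fixed point is 2B.
  set D : ℝ≥0 := (𝓘.card * A.toNNReal) ^ p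
  have h0 : ∀ K : DyadicInterval, ∫⁻ x in K.toSet, ‖localSum 𝓘 a ψ K x‖ₑ ^ p ≤
      D * ENNReal.ofReal K.length := by
    intro K
    rw [← volume_toSet, ← setLIntegral_const]
    refine lintegral_mono fun x => ?_
    simp only [D]
    rw [ENNReal.coe_rpow_of_nonneg _ hp0.le]
    refine ENNReal.rpow_le_rpow ?_ hp0.le
    rw [← ofReal_norm]
    have h1 : ‖localSum 𝓘 a ψ K x‖ ≤ 𝓘.card * A := by
      unfold localSum
      calc _ ≤ ∑ I ∈ 𝓘 with I.toSet ⊆ K.triple, ‖a I * ψ I x‖ := norm_sum_le _ _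
        _ ≤ ∑ I ∈ 𝓘, ‖a I * ψ I x‖ := Finset.sum_le_sum_of_subset_of_nonneg
            (Finset.filter_subset _ _) fun _ _ _ => norm_nonneg _
        _ ≤ ∑ I ∈ 𝓘, A := by
            refine Finset.sum_le_sum fun I hI => ?_
            rw [norm_mul]
            exact (mul_le_of_le_one_left (norm_nonneg _) (norm_le_one_of_square ha hI)).trans
              ((hψ I hI).norm_le_const hA x)
        _ = _ := by simp
    refine (ENNReal.ofReal_le_ofReal h1).trans ?_
    rw [ENNReal.ofReal_mul (by positivity)]
    push_cast
    simp [ENNReal.ofReal]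
  have hiter : ∀ n : ℕ, ∀ K : DyadicInterval, ∫⁻ x in K.toSet, ‖localSum 𝓘 a ψ K x‖ₑ ^ p ≤
      (2 * B + 2⁻¹ ^ n * D : ℝ≥0) * ENNReal.ofReal K.length := by
    intro n
    induction n with
    | zero =>
      intro K
      refine (h0 K).trans ?_
      gcongr
      rw [pow_zero, one_mul]
      exact le_add_self
    | succ n ih =>
      intro K
      refine (hB 𝓘 a ψ hψ ha _ ih K).trans (le_of_eq ?_)
      congr 2
      rw [pow_succ]
      field_simp
      ring
  -- Enough iterations to bring the contribution of the crude constant below 1, whence the final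
  -- constant 2B + 1.
  obtain ⟨n, hn⟩ := exists_pow_lt_of_lt_one (show (0 : ℝ≥0) < (D + 1)⁻¹ by positivity)
    (show (2⁻¹ : ℝ≥0) < 1 by norm_num)
  intro K
  refine (hiter n K).trans ?_
  gcongr
  calc (2⁻¹ ^ n * D : ℝ≥0) ≤ (D + 1)⁻¹ * (D + 1) := by
        gcongr
        exact le_self_add
    _ = 1 := inv_mul_cancel₀ (by positivity)

end JohnNirenberg

/-! ### Tail averages and their maximal function. -/

/-- The weight `relDist ^ (-κ)` adapted to a dyadic interval. -/
noncomputable def DyadicInterval.tail (I : DyadicInterval) (κ : ℝ) (y : ℝ) : ℝ≥0∞ :=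
  ENNReal.ofReal (I.relDist y ^ (-κ))

lemma measurable_tail (I : DyadicInterval) (κ : ℝ) : Measurable (I.tail κ) :=
  (measurable_relDist.pow_const _).ennreal_ofReal

lemma tail_ne_zero (I : DyadicInterval) (κ y : ℝ) : I.tail κ y ≠ 0 := by
  have := relDist_pos (I := I) y
  exact (ENNReal.ofReal_pos.2 (by positivity)).ne'

lemma tail_ne_top (I : DyadicInterval) (κ y : ℝ) : I.tail κ y ≠ ∞ := ENNReal.ofReal_ne_top

/-- The `L^t` average of `w` with respect to the tail weight of `I`. -/
noncomputable def tailAvg (I : DyadicInterval) (κ t : ℝ) (w : ℝ → ℝ≥0∞) : ℝ≥0∞ :=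
  ((∫⁻ y, w y ^ t * I.tail κ y) / ENNReal.ofReal I.length) ^ (1 / t)

/-- The maximal function over the intervals of `𝓘` associated with `tailAvg`. -/
noncomputable def tailMax (𝓘 : Finset DyadicInterval) (κ t : ℝ) (w : ℝ → ℝ≥0∞) (x : ℝ) : ℝ≥0∞ :=
  ⨆ I ∈ 𝓘, I.toSet.indicator (fun _ => tailAvg I κ t w) x

lemma measurable_tailMax (𝓘 : Finset DyadicInterval) (κ t : ℝ) (w : ℝ → ℝ≥0∞) :
    Measurable (tailMax 𝓘 κ t w) :=
  Measurable.biSup _ 𝓘.countable_toSet fun I _ =>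
    measurable_const.indicator I.measurableSet_toSet

lemma tailAvg_le_tailMax {𝓘 : Finset DyadicInterval} {I : DyadicInterval} (hI : I ∈ 𝓘) {x : ℝ}
    (hx : x ∈ I.toSet) (κ t : ℝ) (w : ℝ → ℝ≥0∞) : tailAvg I κ t w ≤ tailMax 𝓘 κ t w x := by
  refine le_trans ?_ (le_iSup₂ (f := fun (I : DyadicInterval) (_ : I ∈ 𝓘) =>
    I.toSet.indicator (fun _ => tailAvg I κ t w) x) I hI)
  rw [Set.indicator_of_mem hx]

lemma tailMax_le {𝓘 : Finset DyadicInterval} {κ t : ℝ} {w : ℝ → ℝ≥0∞} {x : ℝ} {B : ℝ≥0∞}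
    (h : ∀ I ∈ 𝓘, x ∈ I.toSet → tailAvg I κ t w ≤ B) : tailMax 𝓘 κ t w x ≤ B := by
  refine iSup₂_le fun I hI => ?_
  by_cases hx : x ∈ I.toSet
  · rw [Set.indicator_of_mem hx]
    exact h I hI hx
  · rw [Set.indicator_of_notMem hx]
    exact zero_le

lemma tailAvg_mono {I : DyadicInterval} {κ t : ℝ} (ht : 0 ≤ t) {w w' : ℝ → ℝ≥0∞} (h : w ≤ w') :
    tailAvg I κ t w ≤ tailAvg I κ t w' := by
  unfold tailAvg
  gcongr with y
  · exact h y

lemma tailMax_mono {𝓘 : Finset DyadicInterval} {κ t : ℝ} (ht : 0 ≤ t) {w w' : ℝ → ℝ≥0∞}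
    (h : w ≤ w') (x : ℝ) : tailMax 𝓘 κ t w x ≤ tailMax 𝓘 κ t w' x :=
  tailMax_le fun _ hI hx => (tailAvg_mono ht h).trans (tailAvg_le_tailMax hI hx κ t w')

lemma lintegral_tail_le {κ : ℝ} (hκ : 1 < κ) :
    ∃ C : ℝ≥0, ∀ I : DyadicInterval, ∫⁻ y, I.tail κ y ≤ C * ENNReal.ofReal I.length :=
  exists_lintegral_relDist_le hκ

/-- Hölder's inequality for tail averages. -/
lemma tailAvg_mul_le (I : DyadicInterval) (κ : ℝ) {t τ σ β θ : ℝ} (ht : 0 < t) (hτ : 0 < τ)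
    (hσ : 0 < σ) (hθ : 0 < θ) (hθ1 : θ < 1) (h1 : θ * τ = t * β)
    (h2 : (1 - θ) * σ = t) {w h : ℝ → ℝ≥0∞} (hw : Measurable w) (hh : Measurable h) :
    tailAvg I κ t (fun y => w y ^ β * h y) ≤ tailAvg I κ τ w ^ β * tailAvg I κ σ h := by
  unfold tailAvg
  have hL := I.ofReal_length_pos.ne'
  have hL' : ENNReal.ofReal I.length ≠ ∞ := ENNReal.ofReal_ne_top
  set A := ∫⁻ y, w y ^ τ * I.tail κ y
  set B := ∫⁻ y, h y ^ σ * I.tail κ y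
  have key : ∫⁻ y, (w y ^ β * h y) ^ t * I.tail κ y ≤ A ^ θ * B ^ (1 - θ) := by
    have := ENNReal.lintegral_mul_norm_pow_le (μ := volume) (f := fun y => w y ^ τ * I.tail κ y)
      (g := fun y => h y ^ σ * I.tail κ y)
      ((hw.pow_const _).mul (measurable_tail I κ)).aemeasurable
      ((hh.pow_const _).mul (measurable_tail I κ)).aemeasurable (p := θ) (q := 1 - θ) hθ.le
      (by linarith) (by ring)
    refine le_trans (le_of_eq (lintegral_congr fun y => ?_)) this
    rw [ENNReal.mul_rpow_of_nonneg (w y ^ τ) _ hθ.le,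
      ENNReal.mul_rpow_of_nonneg (h y ^ σ) _ (by linarith),
      ENNReal.mul_rpow_of_nonneg (w y ^ β) _ ht.le, ← ENNReal.rpow_mul, ← ENNReal.rpow_mul,
      ← ENNReal.rpow_mul, mul_comm τ, h1, mul_comm σ, h2, mul_comm t β]
    have e : I.tail κ y = I.tail κ y ^ θ * I.tail κ y ^ (1 - θ) := by
      rw [← ENNReal.rpow_add _ _ (tail_ne_zero I κ y) (tail_ne_top I κ y)]
      simp
    conv_lhs => rw [e]
    ring
  have e : ENNReal.ofReal I.length =
      ENNReal.ofReal I.length ^ θ * ENNReal.ofReal I.length ^ (1 - θ) := by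
    rw [← ENNReal.rpow_add _ _ hL hL']
    simp
  have key2 : (∫⁻ y, (w y ^ β * h y) ^ t * I.tail κ y) / ENNReal.ofReal I.length ≤
      (A / ENNReal.ofReal I.length) ^ θ * (B / ENNReal.ofReal I.length) ^ (1 - θ) := by
    rw [ENNReal.div_rpow_of_nonneg _ _ hθ.le, ENNReal.div_rpow_of_nonneg _ _ (by linarith)]
    conv_lhs => rw [e]
    rw [ENNReal.div_eq_inv_mul, ENNReal.div_eq_inv_mul, ENNReal.div_eq_inv_mul,
      ENNReal.mul_inv (by left; simp [hL]) (by left; exact ENNReal.rpow_ne_top_of_nonneg hθ.le hL')]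
    calc _ ≤ (ENNReal.ofReal I.length ^ θ)⁻¹ * (ENNReal.ofReal I.length ^ (1 - θ))⁻¹ *
          (A ^ θ * B ^ (1 - θ)) := by gcongr
      _ = _ := by ring
  calc _ ≤ ((A / ENNReal.ofReal I.length) ^ θ * (B / ENNReal.ofReal I.length) ^ (1 - θ)) ^ (1 / t) :=
        ENNReal.rpow_le_rpow key2 (by positivity)
    _ = _ := by
        rw [ENNReal.mul_rpow_of_nonneg _ _ (by positivity), ← ENNReal.rpow_mul, ← ENNReal.rpow_mul,
          ← ENNReal.rpow_mul]
        congr 2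
        · field_simp
          linarith
        · field_simp
          linarith

lemma tailMax_mul_le (𝓘 : Finset DyadicInterval) (κ : ℝ) {t τ σ β θ : ℝ} (ht : 0 < t) (hτ : 0 < τ)
    (hσ : 0 < σ) (hβ : 0 < β) (hθ : 0 < θ) (hθ1 : θ < 1) (h1 : θ * τ = t * β)
    (h2 : (1 - θ) * σ = t) {w h : ℝ → ℝ≥0∞} (hw : Measurable w) (hh : Measurable h) (x : ℝ) :
    tailMax 𝓘 κ t (fun y => w y ^ β * h y) x ≤ tailMax 𝓘 κ τ w x ^ β * tailMax 𝓘 κ σ h x := by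
  refine tailMax_le fun I hI hx => ?_
  refine (tailAvg_mul_le I κ ht hτ hσ hθ hθ1 h1 h2 hw hh).trans ?_
  gcongr
  · exact tailAvg_le_tailMax hI hx _ _ _
  · exact tailAvg_le_tailMax hI hx _ _ _

lemma exists_tailAvg_one_le {κ : ℝ} (hκ : 1 < κ) {t : ℝ} (ht : 0 < t) :
    ∃ C : ℝ≥0, ∀ I : DyadicInterval, tailAvg I κ t (fun _ => 1) ≤ C := by
  obtain ⟨C, hC⟩ := lintegral_tail_le hκ
  refine ⟨C ^ (1 / t), fun I => ?_⟩
  rw [ENNReal.coe_rpow_of_nonneg _ (by positivity)]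
  unfold tailAvg
  refine ENNReal.rpow_le_rpow ?_ (by positivity)
  simp only [ENNReal.one_rpow, one_mul]
  exact ENNReal.div_le_of_le_mul (hC I)

/-- Tail averages increase with the exponent. -/
lemma exists_tailAvg_le_tailAvg {κ : ℝ} (hκ : 1 < κ) {t₁ t₂ : ℝ} (h₁ : 0 < t₁) (h : t₁ ≤ t₂) :
    ∃ C : ℝ≥0, ∀ (I : DyadicInterval) (w : ℝ → ℝ≥0∞), Measurable w →
      tailAvg I κ t₁ w ≤ C * tailAvg I κ t₂ w := by
  rcases h.eq_or_lt with rfl | h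
  · exact ⟨1, fun I w _ => by simp⟩
  have hd : 0 < t₂ - t₁ := sub_pos.2 h
  have h₂ : 0 < t₂ := h₁.trans h
  -- The Hölder exponent with 1 / t₁ = 1 / t₂ + 1 / σ; the second factor is the constant 1, whose
  -- tail averages are bounded.
  set σ := t₁ * t₂ / (t₂ - t₁) with hσ
  obtain ⟨C, hC⟩ := exists_tailAvg_one_le hκ (t := σ) (by positivity)
  refine ⟨C, fun I w hw => ?_⟩
  have := tailAvg_mul_le I κ (t := t₁) (τ := t₂) (σ := σ) (β := 1) (θ := t₁ / t₂) h₁ h₂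
    (by positivity) (by positivity) ((div_lt_one h₂).2 h) (by field_simp)
    (by rw [hσ]; field_simp) hw (measurable_const (a := (1 : ℝ≥0∞)))
  simp only [ENNReal.rpow_one, mul_one] at this
  refine this.trans ?_
  rw [mul_comm]
  gcongr
  exact hC I

/-- Decomposing the tail over concentric balls with radii 2^n |I|, the decay 2^{-κn} beats the
growth 2^n of the radii. If the averages over all large balls were small, the tail average would be
small too. This replaces tails by balls, as a covering argument requires. -/
lemma exists_ball_of_lt_lintegral_tail {κ : ℝ} (hκ : 1 < κ) :
    ∃ c : ℝ≥0, 0 < c ∧ ∀ (I : DyadicInterval) (g : ℝ → ℝ≥0∞) (l : ℝ≥0∞), Measurable g →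
      l * ENNReal.ofReal I.length < ∫⁻ y, g y * I.tail κ y →
      ∃ R : ℝ, I.length ≤ R ∧
        c * l * ENNReal.ofReal R ≤ ∫⁻ y in Metric.closedBall I.left R, g y := by
  set ρ : ℝ≥0∞ := 2 ^ (1 - κ) with hρ
  have hρ1 : ρ < 1 := by
    rw [hρ]
    exact ENNReal.rpow_lt_one_of_one_lt_of_neg (by norm_num) (by linarith)
  have hpos : (1 - ρ) ≠ 0 := (tsub_pos_of_lt hρ1).ne'
  have hle : (1 - ρ) ≠ ∞ := (tsub_le_self.trans_lt (by simp)).ne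
  have h2k : (2 : ℝ≥0∞) ^ κ ≠ ∞ := by simp
  have h2k' : (2 : ℝ≥0∞) ^ κ ≠ 0 := by simp
  have hcne : (1 - ρ) / 2 ^ κ ≠ ∞ := ENNReal.div_ne_top hle h2k'
  refine ⟨((1 - ρ) / 2 ^ κ).toNNReal, ENNReal.toNNReal_pos (ENNReal.div_ne_zero.2 ⟨hpos, h2k⟩) hcne,
    fun I g l hg h => ?_⟩
  rw [ENNReal.coe_toNNReal hcne]
  by_contra! hc
  refine absurd h (not_lt.2 ?_)
  have hI := I.length_pos
  set b : ℕ → Set ℝ := fun n => Metric.closedBall I.left (2 ^ n * I.length)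
  have hpt : ∀ y, I.tail κ y ≤ ∑' n : ℕ, (b n).indicator (fun _ => 2 ^ κ * (2 ^ (-κ)) ^ n) y := by
    intro y
    have hex : ∃ n : ℕ, |y - I.left| ≤ 2 ^ n * I.length := by
      obtain ⟨n, hn⟩ := pow_unbounded_of_one_lt (|y - I.left| / I.length) (show (1 : ℝ) < 2 by norm_num)
      exact ⟨n, ((div_lt_iff₀ hI).1 hn).le⟩
    classical
    -- For the first ball containing `y`, minimality gives relative distance at least 2^{n-1} when n
    -- > 0. The lost power of two is the factor 2^κ.
    set n := Nat.find hex with hn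
    have hmem : y ∈ b n := by
      rw [Metric.mem_closedBall, Real.dist_eq]
      exact Nat.find_spec hex
    refine le_trans ?_ (ENNReal.le_tsum n)
    rw [Set.indicator_of_mem hmem, ← ENNReal.rpow_natCast, ← ENNReal.rpow_mul,
      ← ENNReal.rpow_add _ _ (by simp) (by simp)]
    have hgoal : I.relDist y ^ (-κ) ≤ (2 : ℝ) ^ (κ + -κ * n) := by
      rcases Nat.eq_zero_or_pos n with h0 | h0
      · rw [h0]
        calc I.relDist y ^ (-κ) ≤ 1 :=
              Real.rpow_le_one_of_one_le_of_nonpos (one_le_relDist y) (by linarith)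
          _ ≤ _ := Real.one_le_rpow (by norm_num) (by simp; linarith)
      · have h1 := Nat.find_min hex (m := n - 1) (by omega)
        rw [not_le] at h1
        have h2 : (2 : ℝ) ^ (n - 1) ≤ I.relDist y := by
          have := abs_sub_le_relDist (x := y) I.left_mem
          nlinarith
        have h3 := Real.rpow_le_rpow_of_nonpos (by positivity) h2 (show -κ ≤ 0 by linarith)
        refine h3.trans (le_of_eq ?_)
        rw [← Real.rpow_natCast, ← Real.rpow_mul (by norm_num)]
        congr 1
        push_cast [h0]
        ring
    unfold DyadicInterval.tail
    refine (ENNReal.ofReal_le_ofReal hgoal).trans (le_of_eq ?_)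
    rw [← ENNReal.ofReal_rpow_of_pos (by norm_num)]
    norm_num
  calc ∫⁻ y, g y * I.tail κ y
      ≤ ∫⁻ y, ∑' n : ℕ, (2 ^ κ * (2 ^ (-κ)) ^ n) * (b n).indicator g y := by
        refine lintegral_mono fun y => ?_
        refine (mul_le_mul_right (hpt y) (g y)).trans (le_of_eq ?_)
        rw [← ENNReal.tsum_mul_left]
        refine tsum_congr fun n => ?_
        by_cases hy : y ∈ b n
        · simp [hy, mul_comm]
        · simp [hy]
    _ = ∑' n : ℕ, (2 ^ κ * (2 ^ (-κ)) ^ n) * ∫⁻ y in b n, g y := by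
        rw [lintegral_tsum fun n => ((hg.indicator Metric.isClosed_closedBall.measurableSet).const_mul
          _).aemeasurable]
        refine tsum_congr fun n => ?_
        rw [lintegral_const_mul _ (hg.indicator Metric.isClosed_closedBall.measurableSet),
          lintegral_indicator Metric.isClosed_closedBall.measurableSet]
    _ ≤ ∑' n : ℕ, (2 ^ κ * (2 ^ (-κ)) ^ n) *
          ((1 - ρ) / 2 ^ κ * l * ENNReal.ofReal (2 ^ n * I.length)) := by
        refine ENNReal.tsum_le_tsum fun n => ?_
        gcongr
        refine (hc _ ?_).le
        nlinarith [one_le_pow₀ (show (1 : ℝ) ≤ 2 by norm_num) (n := n)]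
    _ = ∑' n : ℕ, (2 ^ κ * ((1 - ρ) / 2 ^ κ)) * (l * ENNReal.ofReal I.length) * ρ ^ n := by
        refine tsum_congr fun n => ?_
        rw [ENNReal.ofReal_mul (by positivity), ENNReal.ofReal_pow (by norm_num)]
        have e : ρ = 2 ^ (-κ) * 2 := by
          rw [hρ, sub_eq_add_neg, add_comm, ENNReal.rpow_add _ _ (by simp) (by simp), ENNReal.rpow_one]
        rw [e, mul_pow, show ENNReal.ofReal 2 = 2 by norm_num]
        ring
    _ = l * ENNReal.ofReal I.length := by
        rw [ENNReal.tsum_mul_left, ENNReal.tsum_geometric, ENNReal.mul_div_cancel h2k' h2k]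
        rw [mul_comm (1 - ρ), mul_assoc, ENNReal.mul_inv_cancel hpos hle, mul_one]

/-- The weak type `(1, 1)` bound. -/
lemma exists_weak_type {κ : ℝ} (hκ : 1 < κ) :
    ∃ C : ℝ≥0, ∀ (𝓘 : Finset DyadicInterval) (g : ℝ → ℝ≥0∞) (l : ℝ≥0∞), Measurable g →
      l * volume {x | ∃ I ∈ 𝓘, x ∈ I.toSet ∧ l < tailAvg I κ 1 g} ≤ C * ∫⁻ y, g y := by
  classical
  obtain ⟨c, hc0, hc⟩ := exists_ball_of_lt_lintegral_tail hκ
  refine ⟨c⁻¹ * 8, fun 𝓘 g l hg => ?_⟩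
  have h1 : ∀ I ∈ 𝓘.filter fun I => l < tailAvg I κ 1 g, ∃ R : ℝ, I.length ≤ R ∧
        c * l * ENNReal.ofReal R ≤ ∫⁻ y in Metric.closedBall I.left R, g y := by
    intro I hI
    refine hc I g l hg ?_
    have h2 := (Finset.mem_filter.1 hI).2
    unfold tailAvg at h2
    simp only [ENNReal.rpow_one, div_one] at h2
    rwa [ENNReal.lt_div_iff_mul_lt (by left; exact I.ofReal_length_pos.ne')
      (by left; exact ENNReal.ofReal_ne_top)] at h2
  set bad := 𝓘.filter fun I => l < tailAvg I κ 1 g with hbad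
  choose! R hR hR' using h1
  have hR0 : ∀ I ∈ bad, 0 ≤ R I := fun I hI => I.length_pos.le.trans (hR I hI)
  -- Vitali selection. Any enlargement factor above 3 would serve; with 4 an enlarged ball has
  -- length 8R, which is the 8 in the constant.
  obtain ⟨u, hu, hdisj, hcov⟩ := Vitali.exists_disjoint_subfamily_covering_enlargement_closedBall
    (bad : Set DyadicInterval) (fun I => I.left) R (∑ I ∈ bad, R I)
    (fun I hI => Finset.single_le_sum hR0 hI) 4 (by norm_num)
  have hufin : u.Finite := bad.finite_toSet.subset hu
  set v := hufin.toFinset with hv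
  have hvb : ∀ I ∈ v, I ∈ bad := fun I hI => hu (hufin.mem_toFinset.1 hI)
  have hsub : {x | ∃ I ∈ 𝓘, x ∈ I.toSet ∧ l < tailAvg I κ 1 g} ⊆
      ⋃ I ∈ v, Metric.closedBall I.left (4 * R I) := by
    rintro x ⟨I, hI, hxI, hl⟩
    have hIb : I ∈ bad := Finset.mem_filter.2 ⟨hI, hl⟩
    obtain ⟨J, hJ, hJ'⟩ := hcov I hIb
    refine Set.mem_iUnion₂.2 ⟨J, hufin.mem_toFinset.2 hJ, hJ' ?_⟩
    rw [Metric.mem_closedBall, Real.dist_eq]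
    exact (abs_sub_le_length hxI I.left_mem).trans (hR I hIb)
  have key : c * (l * volume {x | ∃ I ∈ 𝓘, x ∈ I.toSet ∧ l < tailAvg I κ 1 g}) ≤
      8 * ∫⁻ y, g y := by
    calc _ ≤ c * (l * ∑ I ∈ v, volume (Metric.closedBall I.left (4 * R I))) := by
          gcongr
          exact (measure_mono hsub).trans (measure_biUnion_finset_le _ _)
      _ = 8 * ∑ I ∈ v, c * l * ENNReal.ofReal (R I) := by
          rw [← mul_assoc, Finset.mul_sum, Finset.mul_sum]
          refine Finset.sum_congr rfl fun I hI => ?_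
          rw [Real.volume_closedBall, show 2 * (4 * R I) = 8 * R I by ring,
            ENNReal.ofReal_mul (by norm_num), show ENNReal.ofReal 8 = 8 by norm_num]
          ring
      _ ≤ 8 * ∑ I ∈ v, ∫⁻ y in Metric.closedBall I.left (R I), g y := by
          gcongr with I hI
          exact hR' I (hvb I hI)
      _ = 8 * ∫⁻ y in ⋃ I ∈ v, Metric.closedBall I.left (R I), g y := by
          rw [lintegral_biUnion_finset _ fun I _ => Metric.isClosed_closedBall.measurableSet]
          rw [hv, hufin.coe_toFinset]
          exact hdisj
      _ ≤ 8 * ∫⁻ y, g y := by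
          gcongr
          exact Measure.restrict_le_self
  rw [ENNReal.coe_mul, ENNReal.coe_inv hc0.ne', mul_assoc]
  rw [← ENNReal.mul_le_iff_le_inv (by simpa using hc0.ne') (by simp)]
  exact key

/-- Geometric sums of powers of two below a threshold. -/
lemma exists_tsum_two_rpow_le {r : ℝ} (hr : 0 < r) :
    ∃ C : ℝ≥0, 0 < C ∧ ∀ c : ℝ≥0∞,
      ∑' j : ℤ, (if (2 : ℝ≥0∞) ^ j ≤ c then ((2 : ℝ≥0∞) ^ j) ^ r else 0) ≤ C * c ^ r := by
  set ρ : ℝ≥0∞ := 2 ^ (-r) with hρ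
  have hρ1 : ρ < 1 := ENNReal.rpow_lt_one_of_one_lt_of_neg (by norm_num) (by linarith)
  have hfin : (1 - ρ)⁻¹ ≠ ∞ := ENNReal.inv_ne_top.2 (tsub_pos_of_lt hρ1).ne'
  have hpos : (1 - ρ)⁻¹ ≠ 0 := ENNReal.inv_ne_zero.2 (tsub_le_self.trans_lt (by simp)).ne
  refine ⟨((1 - ρ)⁻¹).toNNReal, ENNReal.toNNReal_pos hpos hfin, fun c => ?_⟩
  rw [ENNReal.coe_toNNReal hfin]
  rcases eq_or_ne c ∞ with rfl | hc
  · rw [ENNReal.top_rpow_of_pos hr, ENNReal.mul_top hpos]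
    exact le_top
  rcases eq_or_ne c 0 with rfl | hc0
  · have : ∀ j : ℤ, ¬ (2 : ℝ≥0∞) ^ j ≤ 0 := fun j =>
      not_le.2 (ENNReal.zpow_pos (by simp) (by simp) j)
    simp [this]
  obtain ⟨j₀, h1, h2⟩ := ENNReal.exists_mem_Ico_zpow hc0 hc (show (1 : ℝ≥0∞) < 2 by norm_num)
    (by simp)
  have hinj : Function.Injective fun n : ℕ => j₀ - (n : ℤ) := fun a b h => by
    simp only at h
    omega
  have hsupp : Function.support (fun j : ℤ => if (2 : ℝ≥0∞) ^ j ≤ c then ((2 : ℝ≥0∞) ^ j) ^ r else 0) ⊆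
      Set.range fun n : ℕ => j₀ - (n : ℤ) := by
    intro j hj
    have hjc : (2 : ℝ≥0∞) ^ j ≤ c := by
      by_contra hcon
      simp [hcon] at hj
    have : j < j₀ + 1 := by
      by_contra! hcon
      have := ENNReal.zpow_le_of_le (show (1 : ℝ≥0∞) ≤ 2 by norm_num) hcon
      exact absurd (this.trans hjc) (not_le.2 h2)
    obtain ⟨n, hn⟩ := Int.eq_ofNat_of_zero_le (show 0 ≤ j₀ - j by omega)
    exact ⟨n, by simp only; omega⟩
  rw [← hinj.tsum_eq hsupp]
  have hz : ∀ (j : ℤ), ((2 : ℝ≥0∞) ^ j) ^ r = 2 ^ ((j : ℝ) * r) := fun j => by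
    rw [← ENNReal.rpow_intCast, ← ENNReal.rpow_mul]
  calc _ ≤ ∑' n : ℕ, c ^ r * ρ ^ n := by
        refine ENNReal.tsum_le_tsum fun n => ?_
        split_ifs
        · calc ((2 : ℝ≥0∞) ^ (j₀ - (n : ℤ))) ^ r = ((2 : ℝ≥0∞) ^ j₀) ^ r * ρ ^ n := by
                rw [hz, hz, hρ, ← ENNReal.rpow_natCast, ← ENNReal.rpow_mul,
                  ← ENNReal.rpow_add _ _ (by simp) (by simp)]
                congr 1
                push_cast
                ring
            _ ≤ _ := by gcongr
        · exact zero_le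
    _ = _ := by rw [ENNReal.tsum_mul_left, ENNReal.tsum_geometric, mul_comm]

/-- The largest power of two strictly below a finite nonzero `x` is at least x / 2, and that single
term suffices. At infinity the sum diverges. -/
lemma rpow_le_tsum_two_rpow {s : ℝ} (hs : 0 < s) (x : ℝ≥0∞) :
    x ^ s ≤ 2 ^ s * ∑' j : ℤ, (if (2 : ℝ≥0∞) ^ j < x then ((2 : ℝ≥0∞) ^ j) ^ s else 0) := by
  rcases eq_or_ne x ∞ with rfl | hc
  · have hlt : ∀ j : ℤ, (2 : ℝ≥0∞) ^ j < ∞ := fun j => ENNReal.zpow_lt_top (by simp) (by simp) j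
    have : ∑' j : ℤ, (if (2 : ℝ≥0∞) ^ j < ∞ then ((2 : ℝ≥0∞) ^ j) ^ s else 0) = ∞ := by
      refine top_le_iff.1 ?_
      have hinj : Function.Injective fun n : ℕ => (n : ℤ) := Nat.cast_injective
      calc ∞ = ∑' n : ℕ, (1 : ℝ≥0∞) := (ENNReal.tsum_const_eq_top_of_ne_zero one_ne_zero).symm
        _ ≤ ∑' n : ℕ, (if (2 : ℝ≥0∞) ^ (n : ℤ) < ∞ then ((2 : ℝ≥0∞) ^ (n : ℤ)) ^ s else 0) := by
            refine ENNReal.tsum_le_tsum fun n => ?_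
            rw [if_pos (hlt _), zpow_natCast]
            exact ENNReal.one_le_rpow (one_le_pow₀ (by norm_num)) hs
        _ ≤ _ := ENNReal.tsum_comp_le_tsum_of_injective hinj _
    rw [this, ENNReal.mul_top (by simp)]
    exact le_top
  rcases eq_or_ne x 0 with rfl | hc0
  · simp [ENNReal.zero_rpow_of_pos hs]
  obtain ⟨j₀, h1, h2⟩ := ENNReal.exists_mem_Ioc_zpow hc0 hc (show (1 : ℝ≥0∞) < 2 by norm_num)
    (by simp)
  calc x ^ s ≤ (2 ^ (j₀ + 1) : ℝ≥0∞) ^ s := ENNReal.rpow_le_rpow h2 hs.le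
    _ = 2 ^ s * ((2 : ℝ≥0∞) ^ j₀) ^ s := by
        rw [ENNReal.zpow_add (by simp) (by simp), zpow_one, ENNReal.mul_rpow_of_nonneg _ _ hs.le,
          mul_comm]
    _ ≤ _ := by
        gcongr
        refine le_trans ?_ (ENNReal.le_tsum j₀)
        rw [if_pos h1]

/-- The strong type bound for the maximal function with exponent `1`. -/
lemma exists_strong_type_one {κ : ℝ} (hκ : 1 < κ) {s : ℝ} (hs : 1 < s) :
    ∃ C : ℝ≥0, ∀ (𝓘 : Finset DyadicInterval) (g : ℝ → ℝ≥0∞), Measurable g →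
      ∫⁻ x, tailMax 𝓘 κ 1 g x ^ s ≤ C * ∫⁻ x, g x ^ s := by
  classical
  obtain ⟨B, hB⟩ := exists_tailAvg_one_le hκ one_pos
  obtain ⟨C₁, hC₁⟩ := exists_weak_type hκ
  obtain ⟨C₂, -, hC₂⟩ := exists_tsum_two_rpow_le (r := s - 1) (by linarith)
  have hs0 : 0 < s := by linarith
  refine ⟨(B + 1) ^ s * (2 ^ s * (C₁ * C₂)), fun 𝓘 g hg => ?_⟩
  -- The part of `g` below `l` has tail averages at most l B. After division by B + 1, a value above
  -- `l` forces the part of `g` above `l` to have an average above `l`, and the weak type bound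
  -- applies to that part alone.
  set m : ℝ → ℝ≥0∞ := fun x => tailMax 𝓘 κ 1 g x / (B + 1 : ℝ≥0) with hm
  have hBpos : ((B + 1 : ℝ≥0) : ℝ≥0∞) ≠ 0 := by
    rw [ENNReal.coe_ne_zero]
    positivity
  have hmm : Measurable m := (measurable_tailMax 𝓘 κ 1 g).div_const _
  have hvol : ∀ j : ℤ, ((2 : ℝ≥0∞) ^ j) ^ s * volume {x | (2 : ℝ≥0∞) ^ j < m x} ≤
      C₁ * ∫⁻ y, (if (2 : ℝ≥0∞) ^ j ≤ g y then ((2 : ℝ≥0∞) ^ j) ^ (s - 1) else 0) * g y := by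
    intro j
    set l : ℝ≥0∞ := 2 ^ j with hl
    have hl0 : l ≠ 0 := (ENNReal.zpow_pos (by simp) (by simp) j).ne'
    have hlt : l ≠ ∞ := (ENNReal.zpow_lt_top (by simp) (by simp) j).ne
    have hms : MeasurableSet {y | l ≤ g y} := measurableSet_le measurable_const hg
    set g₁ : ℝ → ℝ≥0∞ := {y | l ≤ g y}.indicator g with hg₁
    have hsub : {x | l < m x} ⊆ {x | ∃ I ∈ 𝓘, x ∈ I.toSet ∧ l < tailAvg I κ 1 g₁} := by
      intro x hx
      by_contra hcon
      simp only [Set.mem_ofPred_eq, not_exists, not_and, not_lt] at hcon hx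
      refine absurd hx (not_lt.2 ?_)
      rw [hm]
      refine ENNReal.div_le_of_le_mul (tailMax_le fun I hI hxI => ?_)
      have h1 : tailAvg I κ 1 g ≤ tailAvg I κ 1 g₁ + l * tailAvg I κ 1 (fun _ => 1) := by
        unfold tailAvg
        simp only [ENNReal.rpow_one, div_one, one_mul]
        rw [← mul_div_assoc, ← lintegral_const_mul _ (measurable_tail I κ), ← ENNReal.add_div,
          ← lintegral_add_right _ ((measurable_tail I κ).const_mul _)]
        gcongr with y
        rw [← add_mul]
        gcongr
        by_cases hy : l ≤ g y
        · rw [hg₁, Set.indicator_of_mem (show y ∈ {y | l ≤ g y} from hy)]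
          exact le_self_add
        · exact (not_le.1 hy).le.trans le_add_self
      calc tailAvg I κ 1 g ≤ l + l * B := by
            refine h1.trans ?_
            gcongr
            · exact hcon I hI hxI
            · exact hB I
        _ = _ := by
            push_cast
            ring
    have h2 := (mul_le_mul_right (measure_mono hsub) l).trans
      (hC₁ 𝓘 g₁ l (hg.indicator hms))
    calc l ^ s * volume {x | l < m x} = l ^ (s - 1) * (l * volume {x | l < m x}) := by
          rw [← mul_assoc]
          congr 1
          conv_rhs => rw [← ENNReal.rpow_one l, ← ENNReal.rpow_mul, one_mul,
            ← ENNReal.rpow_add _ _ hl0 hlt]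
          simp
      _ ≤ l ^ (s - 1) * (C₁ * ∫⁻ y, g₁ y) := by gcongr
      _ = C₁ * ∫⁻ y, l ^ (s - 1) * g₁ y := by
          rw [lintegral_const_mul _ (hg.indicator hms)]
          ring
      _ = _ := by
          congr 2
          ext y
          by_cases hy : l ≤ g y
          · simp [hg₁, hy]
          · simp [hg₁, hy]
  have hmeas : ∀ j : ℤ, Measurable fun x =>
      (if (2 : ℝ≥0∞) ^ j < m x then ((2 : ℝ≥0∞) ^ j) ^ s else 0) := fun j =>
    Measurable.ite (measurableSet_lt measurable_const hmm) measurable_const measurable_const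
  have hmeas' : ∀ j : ℤ, Measurable fun y =>
      (if (2 : ℝ≥0∞) ^ j ≤ g y then ((2 : ℝ≥0∞) ^ j) ^ (s - 1) else 0) * g y := fun j =>
    (Measurable.ite (measurableSet_le measurable_const hg) measurable_const measurable_const).mul hg
  calc ∫⁻ x, tailMax 𝓘 κ 1 g x ^ s = (B + 1 : ℝ≥0) ^ s * ∫⁻ x, m x ^ s := by
        rw [← lintegral_const_mul _ (hmm.pow_const _)]
        refine lintegral_congr fun x => ?_
        rw [← ENNReal.mul_rpow_of_nonneg _ _ hs0.le, hm]
        simp only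
        rw [ENNReal.mul_div_cancel hBpos ENNReal.coe_ne_top]
    _ ≤ (B + 1 : ℝ≥0) ^ s * ∫⁻ x, 2 ^ s *
          ∑' j : ℤ, (if (2 : ℝ≥0∞) ^ j < m x then ((2 : ℝ≥0∞) ^ j) ^ s else 0) := by
        gcongr with x
        exact rpow_le_tsum_two_rpow hs0 _
    _ = (B + 1 : ℝ≥0) ^ s * (2 ^ s *
          ∑' j : ℤ, ((2 : ℝ≥0∞) ^ j) ^ s * volume {x | (2 : ℝ≥0∞) ^ j < m x}) := by
        rw [lintegral_const_mul _ (Measurable.tsum hmeas),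
          lintegral_tsum fun j => (hmeas j).aemeasurable]
        congr 3
        ext j
        have : (fun x => (if (2 : ℝ≥0∞) ^ j < m x then ((2 : ℝ≥0∞) ^ j) ^ s else 0)) =
            {x | (2 : ℝ≥0∞) ^ j < m x}.indicator fun _ => ((2 : ℝ≥0∞) ^ j) ^ s := by
          ext x
          simp [Set.indicator_apply]
        rw [this, lintegral_indicator (measurableSet_lt measurable_const hmm), setLIntegral_const]
    _ ≤ (B + 1 : ℝ≥0) ^ s * (2 ^ s * ∑' j : ℤ, C₁ *
          ∫⁻ y, (if (2 : ℝ≥0∞) ^ j ≤ g y then ((2 : ℝ≥0∞) ^ j) ^ (s - 1) else 0) * g y) := by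
        exact mul_le_mul_right (mul_le_mul_right (ENNReal.tsum_le_tsum fun j => hvol j) _) _
    _ = (B + 1 : ℝ≥0) ^ s * (2 ^ s * (C₁ * ∫⁻ y,
          (∑' j : ℤ, (if (2 : ℝ≥0∞) ^ j ≤ g y then ((2 : ℝ≥0∞) ^ j) ^ (s - 1) else 0)) * g y)) := by
        rw [ENNReal.tsum_mul_left, ← lintegral_tsum fun j => (hmeas' j).aemeasurable]
        simp_rw [ENNReal.tsum_mul_right]
    _ ≤ (B + 1 : ℝ≥0) ^ s * (2 ^ s * (C₁ * ∫⁻ y, C₂ * g y ^ s)) := by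
        refine mul_le_mul_right (mul_le_mul_right (mul_le_mul_right
          (lintegral_mono fun y => ?_) _) _) _
        refine (mul_le_mul_left (hC₂ (g y)) (g y)).trans (le_of_eq ?_)
        rw [mul_assoc]
        congr 1
        conv_lhs => rw [← ENNReal.rpow_one (g y), ← ENNReal.rpow_mul, one_mul,
          ← ENNReal.rpow_add_of_nonneg _ _ (by linarith) zero_le_one]
        simp
    _ = _ := by
        rw [lintegral_const_mul _ (hg.pow_const _)]
        push_cast
        rw [ENNReal.coe_rpow_of_nonneg _ hs0.le, ENNReal.coe_rpow_of_nonneg _ hs0.le]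
        push_cast
        ring

/-- The strong type bound. -/
lemma exists_strong_type {κ : ℝ} (hκ : 1 < κ) {t s : ℝ} (ht : 0 < t) (hs : t < s) :
    ∃ C : ℝ≥0, ∀ (𝓘 : Finset DyadicInterval) (g : ℝ → ℝ≥0∞), Measurable g →
      ∫⁻ x, tailMax 𝓘 κ t g x ^ s ≤ C * ∫⁻ x, g x ^ s := by
  obtain ⟨C, hC⟩ := exists_strong_type_one hκ (s := s / t) ((one_lt_div ht).2 hs)
  have hs0 : 0 < s := ht.trans hs
  refine ⟨C, fun 𝓘 g hg => ?_⟩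
  have h := hC 𝓘 (fun x => g x ^ t) (hg.pow_const _)
  simp only [← ENNReal.rpow_mul, mul_div_cancel₀ s ht.ne'] at h
  refine le_trans (lintegral_mono fun x => ?_) h
  have h1 : tailMax 𝓘 κ t g x ≤ tailMax 𝓘 κ 1 (fun x => g x ^ t) x ^ (1 / t) := by
    refine tailMax_le fun I hI hx => ?_
    refine le_trans (le_of_eq ?_) (ENNReal.rpow_le_rpow (tailAvg_le_tailMax hI hx κ 1 _)
      (by positivity))
    unfold tailAvg
    simp
  calc _ ≤ (tailMax 𝓘 κ 1 (fun x => g x ^ t) x ^ (1 / t)) ^ s := ENNReal.rpow_le_rpow h1 hs0.le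
    _ = _ := by
        rw [← ENNReal.rpow_mul]
        congr 1
        ring

/-! ### Extrapolation of weighted bounds. -/

/-- Weighted bounds with a small exponent extrapolate to larger exponents. -/
lemma exists_extrapolation {κ : ℝ} (hκ : 1 < κ) {r p τ : ℝ} (hr : 0 < r) (hrp : r < p)
    (hτ : 1 < τ) :
    ∃ t : ℝ, 1 < t ∧ ∀ C : ℝ≥0, ∃ C' : ℝ≥0, ∀ (𝓘 : Finset DyadicInterval) (F G : ℝ → ℝ≥0∞),
      Measurable F → Measurable G →
      (∀ w : ℝ → ℝ≥0∞, Measurable w →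
        ∫⁻ x, F x ^ r * w x ≤ C * ∫⁻ x, G x ^ r * tailMax 𝓘 κ t w x) →
      ∀ w : ℝ → ℝ≥0∞, Measurable w →
        ∫⁻ x, F x ^ p * w x ≤ C' * ∫⁻ x, G x ^ p * tailMax 𝓘 κ τ w x := by
  have hp : 0 < p := hr.trans hrp
  have hpr : 0 < p - r := sub_pos.2 hrp
  have hτ0 : 0 < τ := one_pos.trans hτ
  have hrτ : r / τ < r := div_lt_self hr hτ
  have hD : 0 < p - r + r / τ := by positivity
  -- The condition t (p - r + r / τ) < p is exactly what makes the exponent σ below smaller than p /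
  -- (p - r). Since τ > 1 it leaves room for some t > 1.
  obtain ⟨t, ht1, ht⟩ := exists_between ((one_lt_div hD).2 (show p - r + r / τ < p by linarith))
  have ht0 : 0 < t := one_pos.trans ht1
  rw [lt_div_iff₀ hD] at ht
  have hθ1 : t * (r / p) / τ < 1 := by
    rw [div_lt_one hτ0, mul_div_assoc', div_lt_iff₀ hp]
    have h1 : t * (r / τ) < p := by nlinarith
    rw [mul_div_assoc', div_lt_iff₀ hτ0] at h1
    linarith
  set θ := t * (r / p) / τ with hθ
  have hθ0 : 0 < θ := by positivity
  have hθ' : 0 < 1 - θ := by linarith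
  set σ := t / (1 - θ) with hσ
  have hσ0 : 0 < σ := by positivity
  have hσp : σ < p / (p - r) := by
    rw [hσ, div_lt_div_iff₀ hθ' hpr]
    have : p * θ = t * (r / τ) := by
      rw [hθ]
      field_simp
    nlinarith
  obtain ⟨C₁, hC₁⟩ := exists_strong_type hκ hσ0 hσp
  refine ⟨t, ht1, fun C => ⟨(C * C₁ ^ ((p - r) / p)) ^ (p / r), fun 𝓘 F G hF hG h w hw => ?_⟩⟩
  have hrp0 : 0 ≤ r / p := by positivity
  have hprp : 0 < (p - r) / p := by positivity
  have hsum : r / p + (p - r) / p = 1 := by field_simp; ring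
  set X := ∫⁻ x, G x ^ p * tailMax 𝓘 κ τ w x with hX
  -- `F` and `w` are truncated so that the left side is finite and a power of it can be cancelled
  -- later.
  have main : ∀ n : ℕ, ∫⁻ x, (Set.Icc (-(n : ℝ)) n).indicator (fun x => min (F x) n) x ^ p *
      min (w x) n ≤ ((C * C₁ ^ ((p - r) / p)) ^ (p / r) : ℝ≥0) * X := by
    intro n
    set Fn : ℝ → ℝ≥0∞ := (Set.Icc (-(n : ℝ)) n).indicator fun x => min (F x) n with hFn
    set wn : ℝ → ℝ≥0∞ := fun x => min (w x) n with hwn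
    have hFnm : Measurable Fn := (hF.min measurable_const).indicator measurableSet_Icc
    have hwnm : Measurable wn := hw.min measurable_const
    have hFle : ∀ x, Fn x ≤ F x := fun x =>
      (Set.indicator_le_self _ _ x).trans (min_le_left _ _)
    have hwle : wn ≤ w := fun x => min_le_left _ _
    set L := ∫⁻ x, Fn x ^ p * wn x with hL
    have hLfin : L ≠ ∞ := by
      have : L ≤ ∫⁻ x in Set.Icc (-(n : ℝ)) n, (n : ℝ≥0∞) ^ p * n := by
        rw [← lintegral_indicator measurableSet_Icc]
        refine lintegral_mono fun x => ?_
        by_cases hx : x ∈ Set.Icc (-(n : ℝ)) n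
        · rw [Set.indicator_of_mem hx, hFn, Set.indicator_of_mem hx]
          gcongr
          · exact min_le_right _ _
          · exact min_le_right _ _
        · rw [Set.indicator_of_notMem hx, hFn, Set.indicator_of_notMem hx,
            ENNReal.zero_rpow_of_pos hp, zero_mul]
      refine (this.trans_lt ?_).ne
      rw [setLIntegral_const]
      refine ENNReal.mul_lt_top (ENNReal.mul_lt_top ?_ (by simp)) (by simp)
      exact ENNReal.rpow_lt_top_of_nonneg hp.le (by simp)
    -- With this factor F^p w = F^r (w^{r/p} h) for the truncated functions, so the hypothesis is
    -- applied to the weight w^{r/p} h, and the p / (p - r) power of h integrates back to L.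
    set hh : ℝ → ℝ≥0∞ := fun x => (Fn x ^ p * wn x) ^ ((p - r) / p) with hhh
    have hhm : Measurable hh := ((hFnm.pow_const _).mul hwnm).pow_const _
    have hvm : Measurable fun x => wn x ^ (r / p) * hh x := (hwnm.pow_const _).mul hhm
    have e1 : L = ∫⁻ x, Fn x ^ r * (wn x ^ (r / p) * hh x) := by
      refine lintegral_congr fun x => ?_
      rw [hhh, ← mul_assoc]
      have : Fn x ^ r * wn x ^ (r / p) = (Fn x ^ p * wn x) ^ (r / p) := by
        rw [ENNReal.mul_rpow_of_nonneg _ _ hrp0, ← ENNReal.rpow_mul, mul_div_cancel₀ _ hp.ne']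
      rw [this]
      simp only
      rw [← ENNReal.rpow_add_of_nonneg _ _ hrp0 hprp.le, hsum, ENNReal.rpow_one]
    have e2 : L ≤ C * ∫⁻ x, G x ^ r * tailMax 𝓘 κ t (fun x => wn x ^ (r / p) * hh x) x := by
      rw [e1]
      refine (lintegral_mono fun x => ?_).trans (h _ hvm)
      gcongr
      exact hFle x
    -- Hölder inside the averages separates the weight `w` from `hh`. Hölder in x then leaves `hh`
    -- under the maximal operator with exponent σ, which is bounded on L^{p/(p-r)}.
    have e3 : ∫⁻ x, G x ^ r * tailMax 𝓘 κ t (fun x => wn x ^ (r / p) * hh x) x ≤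
        ∫⁻ x, (G x ^ p * tailMax 𝓘 κ τ w x) ^ (r / p) *
          (tailMax 𝓘 κ σ hh x ^ (p / (p - r))) ^ ((p - r) / p) := by
      refine lintegral_mono fun x => ?_
      have := tailMax_mul_le 𝓘 κ (t := t) (τ := τ) (σ := σ) (β := r / p) (θ := θ) ht0 hτ0 hσ0
        (by positivity) hθ0 hθ1 (by rw [hθ]; field_simp) (by rw [hσ]; field_simp) hwnm hhm x
      rw [ENNReal.mul_rpow_of_nonneg _ _ hrp0, ← ENNReal.rpow_mul, ← ENNReal.rpow_mul,
        mul_div_cancel₀ _ hp.ne', show p / (p - r) * ((p - r) / p) = 1 by field_simp,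
        ENNReal.rpow_one, mul_assoc]
      gcongr
      refine this.trans ?_
      gcongr
      exact tailMax_mono hτ0.le hwle x
    have e4 := ENNReal.lintegral_mul_norm_pow_le (μ := volume)
      (f := fun x => G x ^ p * tailMax 𝓘 κ τ w x)
      (g := fun x => tailMax 𝓘 κ σ hh x ^ (p / (p - r)))
      ((hG.pow_const _).mul (measurable_tailMax _ _ _ _)).aemeasurable
      ((measurable_tailMax _ _ _ _).pow_const _).aemeasurable hrp0 hprp.le hsum
    have e5 : ∫⁻ x, hh x ^ (p / (p - r)) = L := by
      refine lintegral_congr fun x => ?_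
      rw [hhh]
      simp only
      rw [← ENNReal.rpow_mul, show (p - r) / p * (p / (p - r)) = 1 by field_simp, ENNReal.rpow_one]
    have e6 : L ≤ (C * C₁ ^ ((p - r) / p) : ℝ≥0) * X ^ (r / p) * L ^ ((p - r) / p) := by
      calc L ≤ C * (X ^ (r / p) * (C₁ * L) ^ ((p - r) / p)) := by
            refine e2.trans ?_
            gcongr
            refine (e3.trans e4).trans ?_
            gcongr
            rw [← e5]
            exact hC₁ 𝓘 hh hhm
        _ = _ := by
            rw [ENNReal.mul_rpow_of_nonneg _ _ hprp.le]
            push_cast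
            rw [ENNReal.coe_rpow_of_nonneg _ hprp.le]
            ring
    rcases eq_or_ne L 0 with h0 | h0
    · rw [h0]
      exact zero_le
    have e7 : L ^ (r / p) ≤ (C * C₁ ^ ((p - r) / p) : ℝ≥0) * X ^ (r / p) := by
      have e8 : L ^ (r / p) * L ^ ((p - r) / p) ≤
          (C * C₁ ^ ((p - r) / p) : ℝ≥0) * X ^ (r / p) * L ^ ((p - r) / p) := by
        rw [← ENNReal.rpow_add _ _ h0 hLfin, hsum, ENNReal.rpow_one]
        exact e6
      refine (ENNReal.mul_le_mul_iff_left ?_ ?_).1 e8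
      · exact (ENNReal.rpow_pos (pos_iff_ne_zero.2 h0) hLfin).ne'
      · exact ENNReal.rpow_ne_top_of_nonneg hprp.le hLfin
    have e9 := ENNReal.rpow_le_rpow e7 (show 0 ≤ p / r by positivity)
    rw [← ENNReal.rpow_mul, ENNReal.mul_rpow_of_nonneg _ _ (by positivity), ← ENNReal.rpow_mul,
      show r / p * (p / r) = 1 by field_simp, ENNReal.rpow_one, ENNReal.rpow_one,
      ← ENNReal.coe_rpow_of_nonneg _ (by positivity)] at e9
    exact e9
  have hm : ∀ n : ℕ, Measurable fun x =>
      (Set.Icc (-(n : ℝ)) n).indicator (fun x => min (F x) (n : ℝ≥0∞)) x ^ p * min (w x) n :=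
    fun n => (((hF.min measurable_const).indicator measurableSet_Icc).pow_const _).mul
      (hw.min measurable_const)
  -- Fatou removes the truncation. Points where `F` or `w` vanishes are treated apart, because
  -- multiplication is discontinuous at 0 · ∞.
  refine (lintegral_mono fun x => ?_).trans ((lintegral_liminf_le (μ := volume) (u := Filter.atTop) hm).trans
    (Filter.liminf_le_of_le (by isBoundedDefault) fun b hb => ?_))
  · rcases eq_or_ne (F x) 0 with h0 | h0
    · simp [h0, ENNReal.zero_rpow_of_pos hp]
    rcases eq_or_ne (w x) 0 with h1 | h1
    · simp [h1]
    refine le_of_eq (Filter.Tendsto.liminf_eq ?_).symm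
    have t1 : Filter.Tendsto (fun n : ℕ => min (w x) (n : ℝ≥0∞)) Filter.atTop (nhds (w x)) := by
      simpa using (tendsto_const_nhds (x := w x)).min ENNReal.tendsto_nat_nhds_top
    have t2 : Filter.Tendsto (fun n : ℕ => (Set.Icc (-(n : ℝ)) n).indicator
        (fun x => min (F x) (n : ℝ≥0∞)) x) Filter.atTop (nhds (F x)) := by
      have : Filter.Tendsto (fun n : ℕ => min (F x) (n : ℝ≥0∞)) Filter.atTop (nhds (F x)) := by
        simpa using (tendsto_const_nhds (x := F x)).min ENNReal.tendsto_nat_nhds_top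
      refine this.congr' ?_
      obtain ⟨m, hm⟩ := exists_nat_ge |x|
      filter_upwards [Filter.eventually_ge_atTop m] with n hn
      have hmn : (m : ℝ) ≤ n := by exact_mod_cast hn
      rw [Set.indicator_of_mem]
      exact abs_le.1 (hm.trans hmn)
    refine ENNReal.Tendsto.mul (t2.ennrpow_const p) (Or.inl ?_) t1 (Or.inl h1)
    simp [h0, hp, hp.le]
  · obtain ⟨n, hn⟩ := hb.exists
    exact hn.trans (main n)

/-! ### Mixed norms. -/

section MixedNorm

variable {n : ℕ}

lemma mixedNorm_succ (S : Fin (n + 1) → Type u) [∀ i, MeasurableSpace (S i)]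
    (μ : ∀ i, Measure (S i)) {q : Fin (n + 1) → ℝ} (hq : 0 < q 0) (g : (∀ i, S i) → ℝ≥0∞) :
    mixedNorm S μ q g = (∫⁻ s₁, mixedNorm (fun i => S i.succ) (fun i => μ i.succ)
      (fun i => q i.succ) (fun t => g (Fin.cons s₁ t)) ^ q 0 ∂μ 0) ^ (1 / q 0) := by
  rw [mixedNorm, eLpNorm_eq_lintegral_rpow_enorm_toReal (by simpa using hq) ENNReal.ofReal_ne_top,
    ENNReal.toReal_ofReal hq.le]
  simp only [enorm_eq_self]

lemma mixedNorm_succ_rpow (S : Fin (n + 1) → Type u) [∀ i, MeasurableSpace (S i)]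
    (μ : ∀ i, Measure (S i)) {q : Fin (n + 1) → ℝ} (hq : 0 < q 0) (g : (∀ i, S i) → ℝ≥0∞) :
    mixedNorm S μ q g ^ q 0 = ∫⁻ s₁, mixedNorm (fun i => S i.succ) (fun i => μ i.succ)
      (fun i => q i.succ) (fun t => g (Fin.cons s₁ t)) ^ q 0 ∂μ 0 := by
  rw [mixedNorm_succ S μ hq, ← ENNReal.rpow_mul, one_div_mul_cancel hq.ne', ENNReal.rpow_one]

lemma measurable_finCons (S : Fin (n + 1) → Type u) [∀ i, MeasurableSpace (S i)] :
    Measurable fun z : S 0 × (∀ i : Fin n, S i.succ) => (Fin.cons z.1 z.2 : ∀ i, S i) := by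
  refine measurable_pi_iff.2 fun i => ?_
  refine Fin.cases ?_ (fun j => ?_) i
  · exact measurable_fst
  · exact (measurable_pi_apply j).comp measurable_snd

/-- Each induction step adds the outermost variable to the parameter space; `Z` therefore ranges
over a universe that also contains the spaces `S i`. -/
lemma measurable_mixedNorm_aux (S : Fin n → Type u) [∀ i, MeasurableSpace (S i)]
    (μ : ∀ i, Measure (S i)) [∀ i, SigmaFinite (μ i)] {q : Fin n → ℝ} (hq : ∀ i, 0 < q i)
    {Z : Type (max u v)} [MeasurableSpace Z] {g : Z → (∀ i, S i) → ℝ≥0∞}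
    (hg : Measurable fun z : Z × (∀ i, S i) => g z.1 z.2) :
    Measurable fun z => mixedNorm S μ q (g z) := by
  induction n generalizing Z with
  | zero =>
    simp only [mixedNorm]
    exact hg.comp (measurable_id.prodMk measurable_const)
  | succ n ih =>
    simp only [mixedNorm_succ S μ (hq 0)]
    refine Measurable.pow_const ?_ _
    have h := ih (fun i => S i.succ) (fun i => μ i.succ) (q := fun i => q i.succ)
      (fun i => hq i.succ) (Z := Z × S 0) (g := fun z t => g z.1 (Fin.cons z.2 t))
      (hg.comp ((measurable_fst.comp measurable_fst).prodMk ((measurable_finCons S).comp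
        ((measurable_snd.comp measurable_fst).prodMk measurable_snd))))
    exact (h.pow_const (q 0)).lintegral_prod_right'

lemma measurable_mixedNorm (S : Fin n → Type u) [∀ i, MeasurableSpace (S i)]
    (μ : ∀ i, Measure (S i)) [∀ i, SigmaFinite (μ i)] {q : Fin n → ℝ} (hq : ∀ i, 0 < q i)
    {Z : Type v} [MeasurableSpace Z] {g : Z → (∀ i, S i) → ℝ≥0∞}
    (hg : Measurable fun z : Z × (∀ i, S i) => g z.1 z.2) :
    Measurable fun z => mixedNorm S μ q (g z) := by
  have h := measurable_mixedNorm_aux.{u, v} S μ hq (Z := ULift.{u} Z) (g := fun z => g z.down)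
    (hg.comp ((measurable_down.comp measurable_fst).prodMk measurable_snd))
  exact h.comp measurable_up

lemma mixedNorm_mono (S : Fin n → Type u) [∀ i, MeasurableSpace (S i)]
    (μ : ∀ i, Measure (S i)) {q : Fin n → ℝ} (hq : ∀ i, 0 < q i) {g h : (∀ i, S i) → ℝ≥0∞}
    (hgh : ∀ s, g s ≤ h s) : mixedNorm S μ q g ≤ mixedNorm S μ q h := by
  induction n with
  | zero => exact hgh _
  | succ n ih =>
    rw [mixedNorm_succ S μ (hq 0), mixedNorm_succ S μ (hq 0)]
    have := hq 0
    gcongr with s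
    exact ih _ _ (fun i => hq i.succ) fun t => hgh _

lemma mixedNorm_const_mul (S : Fin n → Type u) [∀ i, MeasurableSpace (S i)]
    (μ : ∀ i, Measure (S i)) {q : Fin n → ℝ} (hq : ∀ i, 0 < q i) {c : ℝ≥0∞} (hc : c ≠ ∞)
    (g : (∀ i, S i) → ℝ≥0∞) :
    mixedNorm S μ q (fun s => c * g s) = c * mixedNorm S μ q g := by
  induction n with
  | zero => rfl
  | succ n ih =>
    rw [mixedNorm_succ S μ (hq 0), mixedNorm_succ S μ (hq 0)]
    simp_rw [ih _ _ (fun i => hq (Fin.succ i)), ENNReal.mul_rpow_of_nonneg _ _ (hq 0).le]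
    rw [lintegral_const_mul' _ _ (ENNReal.rpow_ne_top_of_nonneg (hq 0).le hc),
      ENNReal.mul_rpow_of_nonneg _ _ (by have := hq 0; positivity), ← ENNReal.rpow_mul,
      mul_one_div_cancel (hq 0).ne', ENNReal.rpow_one]

lemma mixedNorm_zero (S : Fin n → Type u) [∀ i, MeasurableSpace (S i)]
    (μ : ∀ i, Measure (S i)) {q : Fin n → ℝ} (hq : ∀ i, 0 < q i) :
    mixedNorm S μ q (fun _ => 0) = 0 := by
  have := mixedNorm_const_mul S μ hq (c := 0) (by simp) (fun _ => 0)
  simpa using this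

/-- The r-th power of the norm is the L^{q₁/r} norm of the r-th power of the inner norm. As q₁ / r ≥
1, Minkowski's inequality applies, and the recursion ends with subadditivity of u ↦ u^r for r ≤ 1.
-/
lemma mixedNorm_add_rpow_le (S : Fin n → Type u) [∀ i, MeasurableSpace (S i)]
    (μ : ∀ i, Measure (S i)) [∀ i, SigmaFinite (μ i)] {q : Fin n → ℝ} {r : ℝ} (hr : 0 < r)
    (hr1 : r ≤ 1) (hq : ∀ i, r ≤ q i) {g h : (∀ i, S i) → ℝ≥0∞} (hg : Measurable g)
    (hh : Measurable h) :
    mixedNorm S μ q (fun s => g s + h s) ^ r ≤ mixedNorm S μ q g ^ r + mixedNorm S μ q h ^ r := by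
  induction n with
  | zero => exact ENNReal.rpow_add_le_add_rpow _ _ hr.le hr1
  | succ n ih =>
    have hq0 : ∀ i, 0 < q i := fun i => hr.trans_le (hq i)
    have hcons : ∀ s, Measurable fun t : (∀ i : Fin n, S i.succ) => (Fin.cons s t : ∀ i, S i) :=
      fun s => (measurable_finCons S).comp (measurable_const.prodMk measurable_id)
    set ρ := fun (g : (∀ i, S i) → ℝ≥0∞) (s : S 0) => mixedNorm (fun i => S i.succ)
      (fun i => μ i.succ) (fun i => q i.succ) (fun t => g (Fin.cons s t)) with hρ
    have hmeas : ∀ {g : (∀ i, S i) → ℝ≥0∞}, Measurable g → Measurable (ρ g) := fun hg =>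
      measurable_mixedNorm _ _ (fun i => hq0 i.succ) (hg.comp (measurable_finCons S))
    have key : ∀ g : (∀ i, S i) → ℝ≥0∞,
        mixedNorm S μ q g ^ r = (∫⁻ s, (ρ g s ^ r) ^ (q 0 / r) ∂μ 0) ^ (1 / (q 0 / r)) := by
      intro g
      rw [mixedNorm_succ S μ (hq0 0), ← ENNReal.rpow_mul, show 1 / q 0 * r = 1 / (q 0 / r) by
        rw [one_div_div]; ring]
      congr 2
      ext s
      rw [← ENNReal.rpow_mul, mul_div_cancel₀ _ hr.ne']
    have h1 : 1 ≤ q 0 / r := (one_le_div hr).2 (hq 0)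
    rw [key, key, key]
    refine le_trans ?_ (ENNReal.lintegral_Lp_add_le ((hmeas hg).pow_const r).aemeasurable
      ((hmeas hh).pow_const r).aemeasurable h1)
    gcongr with s
    exact ih _ _ (fun i => hq i.succ) (hg.comp (hcons s)) (hh.comp (hcons s))

lemma mixedNorm_sum_rpow_le (S : Fin n → Type u) [∀ i, MeasurableSpace (S i)]
    (μ : ∀ i, Measure (S i)) [∀ i, SigmaFinite (μ i)] {q : Fin n → ℝ} {r : ℝ} (hr : 0 < r)
    (hr1 : r ≤ 1) (hq : ∀ i, r ≤ q i) {ι : Type*} (T : Finset ι) {g : ι → (∀ i, S i) → ℝ≥0∞}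
    (hg : ∀ i ∈ T, Measurable (g i)) :
    mixedNorm S μ q (fun s => ∑ i ∈ T, g i s) ^ r ≤ ∑ i ∈ T, mixedNorm S μ q (g i) ^ r := by
  classical
  induction T using Finset.induction_on with
  | empty =>
    simp only [Finset.sum_empty]
    rw [mixedNorm_zero S μ fun i => hr.trans_le (hq i), ENNReal.zero_rpow_of_pos hr]
  | insert i T hi ih =>
    simp only [Finset.sum_insert hi]
    refine (mixedNorm_add_rpow_le S μ hr hr1 hq (hg i (Finset.mem_insert_self _ _))
      (Finset.measurable_sum _ fun j hj => hg j (Finset.mem_insert_of_mem hj))).trans ?_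
    gcongr
    exact ih fun j hj => hg j (Finset.mem_insert_of_mem hj)

end MixedNorm

/-! ### The weighted inequality and Fubini. -/

section WeightedBound

variable {n : ℕ} {S : Fin n → Type u} [∀ i, MeasurableSpace (S i)]

/-- Measurable families of coefficients and molecules that depend on a parameter. -/
structure IsMoleculeFamily (N : ℕ) (A : ℝ) (𝓘 : Finset DyadicInterval)
    (a : DyadicInterval → (∀ i, S i) → ℂ) (ψ : DyadicInterval → (∀ i, S i) → ℝ → ℂ) : Prop where
  measurable_coeff : ∀ I ∈ 𝓘, Measurable (a I)
  measurable_molecule : ∀ I ∈ 𝓘, Measurable fun z : (∀ i, S i) × ℝ => ψ I z.1 z.2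
  isMolecule : ∀ I ∈ 𝓘, ∀ s, IsMolecule N A I (ψ I s)

/-- The sum of molecules. -/
noncomputable def moleculeSum (𝓘 : Finset DyadicInterval) (a : DyadicInterval → (∀ i, S i) → ℂ)
    (ψ : DyadicInterval → (∀ i, S i) → ℝ → ℂ) (s : ∀ i, S i) (x : ℝ) : ℂ :=
  ∑ I ∈ 𝓘, a I s * ψ I s x

/-- The square function of a family of coefficients. -/
@[irreducible] noncomputable def squareSum (𝓘 : Finset DyadicInterval)
    (a : DyadicInterval → (∀ i, S i) → ℂ) (s : ∀ i, S i) (x : ℝ) : ℝ≥0∞ :=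
  (∑ I ∈ 𝓘, I.toSet.indicator (fun _ => ‖a I s‖ₑ ^ 2) x) ^ (1 / 2 : ℝ)

/-- The mixed norm in `s` of a sum of molecules. -/
noncomputable def sumNorm (μ : ∀ i, Measure (S i)) (q : Fin n → ℝ) (𝓘 : Finset DyadicInterval)
    (a : DyadicInterval → (∀ i, S i) → ℂ) (ψ : DyadicInterval → (∀ i, S i) → ℝ → ℂ) (x : ℝ) :
    ℝ≥0∞ := mixedNorm S μ q fun s => ‖moleculeSum 𝓘 a ψ s x‖ₑ

/-- The mixed norm in `s` of the square function. -/
noncomputable def squareNorm (μ : ∀ i, Measure (S i)) (q : Fin n → ℝ)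
    (𝓘 : Finset DyadicInterval) (a : DyadicInterval → (∀ i, S i) → ℂ) (x : ℝ) :
    ℝ≥0∞ := mixedNorm S μ q fun s => squareSum 𝓘 a s x

variable {N : ℕ} {A : ℝ} {𝓘 : Finset DyadicInterval} {a : DyadicInterval → (∀ i, S i) → ℂ}
  {ψ : DyadicInterval → (∀ i, S i) → ℝ → ℂ}

namespace IsMoleculeFamily

lemma mono (h : IsMoleculeFamily N A 𝓘 a ψ) {𝓙 : Finset DyadicInterval} (h𝓙 : 𝓙 ⊆ 𝓘) :
    IsMoleculeFamily N A 𝓙 a ψ :=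
  ⟨fun I hI => h.1 I (h𝓙 hI), fun I hI => h.2 I (h𝓙 hI), fun I hI => h.3 I (h𝓙 hI)⟩

lemma measurable_moleculeSum (h : IsMoleculeFamily N A 𝓘 a ψ) :
    Measurable fun z : (∀ i, S i) × ℝ => moleculeSum 𝓘 a ψ z.1 z.2 :=
  Finset.measurable_sum _ fun I hI =>
    ((h.1 I hI).comp measurable_fst).mul (h.2 I hI)

lemma measurable_squareSum (h : IsMoleculeFamily N A 𝓘 a ψ) :
    Measurable fun z : (∀ i, S i) × ℝ => squareSum 𝓘 a z.1 z.2 := by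
  unfold squareSum
  refine Measurable.pow_const (Finset.measurable_sum _ fun I hI => ?_) _
  have e : (fun z : (∀ i, S i) × ℝ => I.toSet.indicator (fun _ => ‖a I z.1‖ₑ ^ 2) z.2) =
      (Prod.snd ⁻¹' I.toSet).indicator fun z => ‖a I z.1‖ₑ ^ 2 := by
    ext z
    by_cases hz : z.2 ∈ I.toSet <;> simp [hz]
  rw [e]
  exact (((h.1 I hI).comp measurable_fst).enorm.pow_const 2).indicator
    (measurable_snd I.measurableSet_toSet)

lemma measurable_sumNorm (h : IsMoleculeFamily N A 𝓘 a ψ) (μ : ∀ i, Measure (S i))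
    [∀ i, SigmaFinite (μ i)] {q : Fin n → ℝ} (hq : ∀ i, 0 < q i) :
    Measurable (sumNorm μ q 𝓘 a ψ) :=
  measurable_mixedNorm S μ hq (g := fun x s => ‖moleculeSum 𝓘 a ψ s x‖ₑ)
    (h.measurable_moleculeSum.comp measurable_swap).enorm

lemma measurable_squareNorm (h : IsMoleculeFamily N A 𝓘 a ψ) (μ : ∀ i, Measure (S i))
    [∀ i, SigmaFinite (μ i)] {q : Fin n → ℝ} (hq : ∀ i, 0 < q i) :
    Measurable (squareNorm μ q 𝓘 a) := by
  have h1 : Measurable fun z : ℝ × (∀ i, S i) => squareSum 𝓘 a z.2 z.1 :=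
    h.measurable_squareSum.comp (measurable_swap (α := ℝ) (β := ∀ i, S i))
  exact measurable_mixedNorm S μ hq (g := fun x s => squareSum 𝓘 a s x) h1

end IsMoleculeFamily

/-- The weighted inequality `∫ ‖T‖_Q ^ p w ≤ C ∫ ‖S‖_Q ^ p M w`. -/
def WeightedBound (n : ℕ) (q : Fin n → ℝ) (N : ℕ) (A κ p t : ℝ) : Prop :=
  ∃ C : ℝ≥0, ∀ (S : Fin n → Type u) [∀ i, MeasurableSpace (S i)]
    (μ : ∀ i, Measure (S i)) [∀ i, SigmaFinite (μ i)] (𝓘 : Finset DyadicInterval)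
    (a : DyadicInterval → (∀ i, S i) → ℂ) (ψ : DyadicInterval → (∀ i, S i) → ℝ → ℂ),
    IsMoleculeFamily N A 𝓘 a ψ → ∀ w : ℝ → ℝ≥0∞, Measurable w →
    ∫⁻ x, sumNorm μ q 𝓘 a ψ x ^ p * w x ≤
      C * ∫⁻ x, squareNorm μ q 𝓘 a x ^ p * tailMax 𝓘 κ t w x

/-- Extrapolating to the weight exponent `t` uses the bound for `r` with another exponent above 1,
possibly very close to 1; hence the hypothesis for all of them. -/
lemma WeightedBound.of_le_exponent {q : Fin n → ℝ} (hq : ∀ i, 0 < q i) {κ : ℝ} (hκ : 1 < κ)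
    {r p : ℝ} (hr : 0 < r) (hrp : r ≤ p)
    (h : ∀ t, 1 < t → WeightedBound.{u} n q N A κ r t) (t : ℝ) (ht : 1 < t) :
    WeightedBound.{u} n q N A κ p t := by
  rcases hrp.eq_or_lt with rfl | hrp
  · exact h t ht
  obtain ⟨t', ht', H⟩ := exists_extrapolation hκ hr hrp ht
  obtain ⟨C, hC⟩ := h t' ht'
  obtain ⟨C', hC'⟩ := H C
  exact ⟨C', fun S _ μ _ 𝓘 a ψ hfam w hw => hC' 𝓘 _ _ (hfam.measurable_sumNorm μ hq)
    (hfam.measurable_squareNorm μ hq) (fun w hw => hC S μ 𝓘 a ψ hfam w hw) w hw⟩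

lemma squareSum_cons {S : Fin (n + 1) → Type u} (𝓘 : Finset DyadicInterval)
    (a : DyadicInterval → (∀ i, S i) → ℂ) (s : S 0) (t : ∀ i : Fin n, S i.succ) (x : ℝ) :
    squareSum (S := fun i : Fin n => S i.succ) 𝓘 (fun I t => a I (Fin.cons s t)) t x =
      squareSum 𝓘 a (Fin.cons s t) x := by
  unfold squareSum
  rfl

/-- Fubini: the bound in one variable less gives the bound with `p = q₁`. -/
lemma WeightedBound.succ {q : Fin (n + 1) → ℝ} (hq : ∀ i, 0 < q i) {κ t : ℝ}
    (h : WeightedBound.{u} n (fun i => q i.succ) N A κ (q 0) t) :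
    WeightedBound.{u} (n + 1) q N A κ (q 0) t := by
  obtain ⟨C, hC⟩ := h
  refine ⟨C, fun S _ μ _ 𝓘 a ψ hfam w hw => ?_⟩
  have hcons : ∀ s, Measurable fun t : (∀ i : Fin n, S i.succ) => (Fin.cons s t : ∀ i, S i) :=
    fun s => (measurable_finCons S).comp (measurable_const.prodMk measurable_id)
  have hfam' : ∀ s : S 0, IsMoleculeFamily N A 𝓘 (S := fun i : Fin n => S i.succ)
      (fun I t => a I (Fin.cons s t)) (fun I t => ψ I (Fin.cons s t)) := fun s =>
    { measurable_coeff := fun I hI => (hfam.1 I hI).comp (hcons s)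
      measurable_molecule := fun I hI => (hfam.2 I hI).comp
        (((hcons s).comp measurable_fst).prodMk measurable_snd)
      isMolecule := fun I hI t => hfam.3 I hI _ }
  have hmap : Measurable fun z : (S 0 × ℝ) × (∀ i : Fin n, S i.succ) =>
      ((Fin.cons z.1.1 z.2 : ∀ i, S i), z.1.2) :=
    ((measurable_finCons S).comp ((measurable_fst.comp measurable_fst).prodMk
      measurable_snd)).prodMk (measurable_snd.comp measurable_fst)
  set Φ : S 0 → ℝ → ℝ≥0∞ := fun s x => sumNorm (fun i : Fin n => μ i.succ)
      (fun i => q i.succ) 𝓘 (fun I t => a I (Fin.cons s t)) (fun I t => ψ I (Fin.cons s t)) x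
    with hΦ
  set Γ : S 0 → ℝ → ℝ≥0∞ := fun s x => squareNorm (fun i : Fin n => μ i.succ)
      (fun i => q i.succ) 𝓘 (fun I t => a I (Fin.cons s t)) x with hΓ
  have hF : Measurable fun z : S 0 × ℝ => Φ z.1 z.2 :=
    measurable_mixedNorm _ _ (fun i => hq i.succ)
      (g := fun (z : S 0 × ℝ) t => ‖moleculeSum 𝓘 a ψ (Fin.cons z.1 t) z.2‖ₑ)
      (hfam.measurable_moleculeSum.comp hmap).enorm
  have hG : Measurable fun z : S 0 × ℝ => Γ z.1 z.2 := by
    simp only [hΓ, squareNorm, squareSum_cons]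
    exact measurable_mixedNorm _ _ (fun i => hq i.succ)
      (g := fun (z : S 0 × ℝ) t => squareSum 𝓘 a (Fin.cons z.1 t) z.2)
      (hfam.measurable_squareSum.comp hmap)
  have hF' : ∀ x, Measurable fun s => Φ s x ^ q 0 := fun x =>
    (hF.comp (measurable_id.prodMk measurable_const)).pow_const _
  have hG' : ∀ x, Measurable fun s => Γ s x ^ q 0 := fun x =>
    (hG.comp (measurable_id.prodMk measurable_const)).pow_const _
  -- When p is the outermost exponent q₁, the p-th power of the norm is an integral over S₁. Neither
  -- `w` nor its maximal function depends on that variable, so the integrals can be exchanged.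
  have e1 : ∀ x, sumNorm μ q 𝓘 a ψ x ^ q 0 * w x = ∫⁻ s, Φ s x ^ q 0 * w x ∂μ 0 := by
    intro x
    rw [lintegral_mul_const _ (hF' x)]
    congr 1
    exact mixedNorm_succ_rpow S μ (hq 0) _
  have e2 : ∀ x, squareNorm μ q 𝓘 a x ^ q 0 * tailMax 𝓘 κ t w x =
      ∫⁻ s, Γ s x ^ q 0 * tailMax 𝓘 κ t w x ∂μ 0 := by
    intro x
    rw [lintegral_mul_const _ (hG' x)]
    congr 1
    simp only [hΓ, squareNorm, squareSum_cons]
    exact mixedNorm_succ_rpow S μ (hq 0) _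
  have hFw : Measurable fun z : S 0 × ℝ => Φ z.1 z.2 ^ q 0 * w z.2 :=
    (hF.pow_const _).mul (hw.comp measurable_snd)
  have hGw : Measurable fun z : S 0 × ℝ => Γ z.1 z.2 ^ q 0 * tailMax 𝓘 κ t w z.2 :=
    (hG.pow_const _).mul ((measurable_tailMax 𝓘 κ t w).comp measurable_snd)
  have hFw' : AEMeasurable (Function.uncurry fun x s => Φ s x ^ q 0 * w x)
      (volume.prod (μ 0)) := (hFw.comp measurable_swap).aemeasurable
  have hGw' : AEMeasurable (Function.uncurry fun x s => Γ s x ^ q 0 * tailMax 𝓘 κ t w x)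
      (volume.prod (μ 0)) := (hGw.comp measurable_swap).aemeasurable
  calc ∫⁻ x, sumNorm μ q 𝓘 a ψ x ^ q 0 * w x = ∫⁻ x, ∫⁻ s, Φ s x ^ q 0 * w x ∂μ 0 :=
        lintegral_congr e1
    _ = ∫⁻ s, ∫⁻ x, Φ s x ^ q 0 * w x ∂volume ∂μ 0 := lintegral_lintegral_swap hFw'
    _ ≤ ∫⁻ s, C * ∫⁻ x, Γ s x ^ q 0 * tailMax 𝓘 κ t w x ∂volume ∂μ 0 :=
        lintegral_mono fun s => hC _ _ 𝓘 _ _ (hfam' s) w hw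
    _ = C * ∫⁻ s, ∫⁻ x, Γ s x ^ q 0 * tailMax 𝓘 κ t w x ∂volume ∂μ 0 :=
        lintegral_const_mul _ hGw.lintegral_prod_right'
    _ = C * ∫⁻ x, ∫⁻ s, Γ s x ^ q 0 * tailMax 𝓘 κ t w x ∂μ 0 := by
        rw [lintegral_lintegral_swap hGw']
    _ = _ := by rw [← lintegral_congr e2]

end WeightedBound

/-! ### Tails of the subintervals of an interval. -/

section Geometry

/-- The assumption on `x` says dist(x, K) ≥ |K|, so |K| + dist(x, K) ≤ 2 dist(x, K) ≤ 2 dist(x, I).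
-/
lemma relDist_mul_le {I K : DyadicInterval} (h : I.toSet ⊆ K.toSet) {x : ℝ}
    (hx : 2 ≤ K.relDist x) : K.relDist x * K.length ≤ 2 * (I.relDist x * I.length) := by
  have h1 : Metric.infDist x K.toSet ≤ Metric.infDist x I.toSet :=
    Metric.infDist_le_infDist_of_subset h ⟨_, I.left_mem⟩
  have hI := I.length_pos
  have hK := K.length_pos
  have e1 : I.relDist x * I.length = I.length + Metric.infDist x I.toSet := by
    unfold relDist
    field_simp
  have e2 : K.relDist x * K.length = K.length + Metric.infDist x K.toSet := by
    unfold relDist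
    field_simp
  nlinarith

/-- The dyadic subintervals of an interval are summable with any power larger than one. -/
lemma exists_sum_length_rpow_le {κ : ℝ} (hκ : 1 < κ) :
    ∃ C : ℝ, 0 ≤ C ∧ ∀ (K : DyadicInterval) (𝓢 : Finset DyadicInterval),
      (∀ I ∈ 𝓢, I.toSet ⊆ K.toSet) → ∑ I ∈ 𝓢, (I.length / K.length) ^ κ ≤ C := by
  classical
  set ρ : ℝ := (1 / 2) ^ (κ - 1) with hρ
  have hρ0 : 0 ≤ ρ := by positivity
  have hρ1 : ρ < 1 := Real.rpow_lt_one (by norm_num) (by norm_num) (by linarith)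
  refine ⟨(1 - ρ)⁻¹, inv_nonneg.2 (by linarith), fun K 𝓢 h𝓢 => ?_⟩
  have hK := K.length_pos
  set ν : DyadicInterval → ℕ := fun I => (K.k - I.k).natAbs with hν
  -- One power of |I| / |K| pays for adding up a generation, whose total length is at most |K|; the
  -- remaining κ - 1 powers give a geometric series over generations.
  have hterm : ∀ I ∈ 𝓢, (I.length / K.length) ^ κ = ρ ^ ν I * (I.length / K.length) := by
    intro I hI
    have hI0 := I.length_pos
    have e : I.length / K.length = (1 / 2) ^ ν I :=
      length_div_length_eq (k_le_of_subset (h𝓢 I hI))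
    have e2 : ρ ^ ν I = (I.length / K.length) ^ (κ - 1) := by
      rw [e, hρ, ← Real.rpow_natCast, ← Real.rpow_natCast, ← Real.rpow_mul (by norm_num),
        ← Real.rpow_mul (by norm_num), mul_comm]
    rw [e2, ← Real.rpow_add_one (by positivity)]
    simp
  rw [Finset.sum_congr rfl hterm,
    ← Finset.sum_fiberwise_of_maps_to (g := ν) (t := 𝓢.image ν)
      (fun I hI => Finset.mem_image_of_mem _ hI)]
  have hfib : ∀ m, ∑ I ∈ 𝓢 with ν I = m, I.length ≤ K.length := by
    intro m
    have hd : ∀ I ∈ 𝓢.filter (fun I => ν I = m), ∀ J ∈ 𝓢.filter (fun I => ν I = m), I ≠ J →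
        Disjoint I.toSet J.toSet := by
      intro I hI J hJ hne
      rw [Finset.mem_filter] at hI hJ
      have h1 := k_le_of_subset (h𝓢 I hI.1)
      have h2 := k_le_of_subset (h𝓢 J hJ.1)
      refine disjoint_of_k_eq ?_ hne
      have h3 : (K.k - I.k).natAbs = m := hI.2
      have h4 : (K.k - J.k).natAbs = m := hJ.2
      omega
    have h1 : ∑ I ∈ 𝓢 with ν I = m, volume I.toSet ≤ volume K.toSet := by
      rw [← measure_biUnion_finset hd fun I _ => I.measurableSet_toSet]
      exact measure_mono (Set.iUnion₂_subset fun I hI => h𝓢 I (Finset.mem_filter.1 hI).1)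
    simp only [volume_toSet] at h1
    rw [← ENNReal.ofReal_sum_of_nonneg fun I _ => I.length_pos.le] at h1
    exact (ENNReal.ofReal_le_ofReal_iff hK.le).1 h1
  calc ∑ m ∈ 𝓢.image ν, ∑ I ∈ 𝓢 with ν I = m, ρ ^ ν I * (I.length / K.length)
      ≤ ∑ m ∈ 𝓢.image ν, ρ ^ m := by
        refine Finset.sum_le_sum fun m _ => ?_
        have : ∑ I ∈ 𝓢 with ν I = m, ρ ^ ν I * (I.length / K.length) =
            ρ ^ m * ((∑ I ∈ 𝓢 with ν I = m, I.length) / K.length) := by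
          rw [Finset.sum_div, Finset.mul_sum]
          exact Finset.sum_congr rfl fun I hI => by rw [(Finset.mem_filter.1 hI).2]
        rw [this]
        exact mul_le_of_le_one_right (by positivity) ((div_le_one hK).2 (hfib m))
    _ ≤ ∑' m, ρ ^ m := (summable_geometric_of_lt_one hρ0 hρ1).sum_le_tsum _
        fun m _ => by positivity
    _ = _ := tsum_geometric_of_lt_one hρ0 hρ1

/-- Away from `K`, the tails of the dyadic subintervals of `K` add up to the tail of `K`. -/
lemma exists_sum_tail_le {κ : ℝ} (hκ : 1 < κ) :
    ∃ C : ℝ≥0, ∀ (K : DyadicInterval) (𝓢 : Finset DyadicInterval),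
      (∀ I ∈ 𝓢, I.toSet ⊆ K.toSet) → ∀ x, 2 ≤ K.relDist x →
      ∑ I ∈ 𝓢, I.tail κ x ≤ C * K.tail κ x := by
  obtain ⟨C, hC0, hC⟩ := exists_sum_length_rpow_le hκ
  refine ⟨(2 ^ κ * C).toNNReal, fun K 𝓢 h𝓢 x hx => ?_⟩
  have hK := K.length_pos
  have hR := relDist_pos (I := K) x
  have hterm : ∀ I ∈ 𝓢, I.relDist x ^ (-κ) ≤
      (2 ^ κ * K.relDist x ^ (-κ)) * (I.length / K.length) ^ κ := by
    intro I hI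
    have hI0 := I.length_pos
    have h1 := relDist_mul_le (h𝓢 I hI) hx
    have h2 : K.relDist x * K.length / (2 * I.length) ≤ I.relDist x := by
      rw [div_le_iff₀ (by positivity)]
      linarith
    refine (Real.rpow_le_rpow_of_nonpos (by positivity) h2 (by linarith)).trans (le_of_eq ?_)
    rw [show K.relDist x * K.length / (2 * I.length) =
      (2 * (K.relDist x)⁻¹ * (I.length / K.length))⁻¹ by field_simp,
      Real.rpow_neg (by positivity), Real.inv_rpow (by positivity), inv_inv,
      Real.mul_rpow (by positivity) (by positivity), Real.mul_rpow (by positivity) (by positivity),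
      Real.inv_rpow hR.le, Real.rpow_neg hR.le]
  unfold DyadicInterval.tail
  rw [← ENNReal.ofReal_sum_of_nonneg fun I _ => by
    have := relDist_pos (I := I) x
    positivity]
  change _ ≤ ENNReal.ofReal (2 ^ κ * C) * _
  rw [← ENNReal.ofReal_mul (by positivity)]
  refine ENNReal.ofReal_le_ofReal ((Finset.sum_le_sum hterm).trans ?_)
  rw [← Finset.mul_sum]
  calc _ ≤ (2 ^ κ * K.relDist x ^ (-κ)) * C :=
        mul_le_mul_of_nonneg_left (hC K 𝓢 h𝓢) (by positivity)
    _ = _ := by ring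

end Geometry

/-! ### Pointwise bounds for sums and square functions. -/

section Pointwise

lemma squareSum_le_squareSum {n : ℕ} {S : Fin n → Type u} {𝓘 𝓙 : Finset DyadicInterval}
    {a : DyadicInterval → (∀ i, S i) → ℂ} {x y : ℝ} (h : ∀ I ∈ 𝓘, x ∈ I.toSet → I ∈ 𝓙 ∧ y ∈ I.toSet)
    (s : ∀ i, S i) : squareSum 𝓘 a s x ≤ squareSum 𝓙 a s y := by
  classical
  unfold squareSum
  refine ENNReal.rpow_le_rpow ?_ (by norm_num)
  calc ∑ I ∈ 𝓘, I.toSet.indicator (fun _ => ‖a I s‖ₑ ^ 2) x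
      = ∑ I ∈ 𝓘 with x ∈ I.toSet, ‖a I s‖ₑ ^ 2 := by
        rw [Finset.sum_filter]
        exact Finset.sum_congr rfl fun I _ => by simp [Set.indicator_apply]
    _ ≤ ∑ I ∈ 𝓙 with y ∈ I.toSet, ‖a I s‖ₑ ^ 2 := by
        refine Finset.sum_le_sum_of_subset fun I hI => ?_
        rw [Finset.mem_filter] at hI ⊢
        exact h I hI.1 hI.2
    _ = _ := by
        rw [Finset.sum_filter]
        exact Finset.sum_congr rfl fun I _ => by simp [Set.indicator_apply]

variable {n : ℕ} {S : Fin n → Type u} [∀ i, MeasurableSpace (S i)] {N : ℕ} {A : ℝ}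
  {𝓘 𝓙 : Finset DyadicInterval} {a : DyadicInterval → (∀ i, S i) → ℂ}
  {ψ : DyadicInterval → (∀ i, S i) → ℝ → ℂ} {μ : ∀ i, Measure (S i)} {q : Fin n → ℝ}

lemma squareNorm_le_squareNorm (hq : ∀ i, 0 < q i) {x y : ℝ}
    (h : ∀ I ∈ 𝓘, x ∈ I.toSet → I ∈ 𝓙 ∧ y ∈ I.toSet) :
    squareNorm μ q 𝓘 a x ≤ squareNorm μ q 𝓙 a y :=
  mixedNorm_mono S μ hq fun s => squareSum_le_squareSum h s

lemma squareNorm_eq_zero (hq : ∀ i, 0 < q i) {x : ℝ} (h : ∀ I ∈ 𝓘, x ∉ I.toSet) :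
    squareNorm μ q 𝓘 a x = 0 := by
  rw [← mixedNorm_zero S μ hq]
  unfold squareNorm
  congr 1
  ext s
  unfold squareSum
  rw [Finset.sum_eq_zero fun I hI => Set.indicator_of_notMem (h I hI) _]
  simp

lemma mixedNorm_coeff_le (hq : ∀ i, 0 < q i) {I : DyadicInterval} (hI : I ∈ 𝓘) {x : ℝ}
    (hx : x ∈ I.toSet) : mixedNorm S μ q (fun s => ‖a I s‖ₑ) ≤ squareNorm μ q 𝓘 a x := by
  refine mixedNorm_mono S μ hq fun s => ?_
  unfold squareSum
  calc ‖a I s‖ₑ = (‖a I s‖ₑ ^ 2) ^ (1 / 2 : ℝ) := by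
        rw [← ENNReal.rpow_natCast, ← ENNReal.rpow_mul]
        norm_num
    _ ≤ _ := by
        refine ENNReal.rpow_le_rpow ?_ (by norm_num)
        refine le_trans (le_of_eq ?_) (Finset.single_le_sum
          (f := fun I => I.toSet.indicator (fun _ => ‖a I s‖ₑ ^ 2) x) (fun _ _ => zero_le) hI)
        simp [hx]

variable [∀ i, SigmaFinite (μ i)] {r : ℝ}

/-- Subadditivity of the r-th power and the decay of the molecules. The latter becomes
relDist^{-Nr}, so κ ≤ N r is where the decay exponent limits the admissible exponents. -/
lemma sumNorm_rpow_le_sum (h : IsMoleculeFamily N A 𝓘 a ψ) (hA : 0 ≤ A) (hr : 0 < r)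
    (hr1 : r ≤ 1) (hq : ∀ i, r ≤ q i) {κ : ℝ} (hκ : κ ≤ N * r) (x : ℝ) :
    sumNorm μ q 𝓘 a ψ x ^ r ≤ ∑ I ∈ 𝓘, ENNReal.ofReal (A ^ r) *
      mixedNorm S μ q (fun s => ‖a I s‖ₑ) ^ r * I.tail κ x := by
  have hq0 : ∀ i, 0 < q i := fun i => hr.trans_le (hq i)
  have h1 : sumNorm μ q 𝓘 a ψ x ≤ mixedNorm S μ q (fun s => ∑ I ∈ 𝓘,
      ENNReal.ofReal (A * (I.relDist x ^ N)⁻¹) * ‖a I s‖ₑ) := by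
    refine mixedNorm_mono S μ hq0 fun s => (enorm_sum_le _ _).trans ?_
    refine Finset.sum_le_sum fun I hI => ?_
    rw [enorm_mul, mul_comm]
    gcongr
    rw [← ofReal_norm]
    exact ENNReal.ofReal_le_ofReal ((h.isMolecule I hI s).norm_le x)
  refine (ENNReal.rpow_le_rpow h1 hr.le).trans ((mixedNorm_sum_rpow_le S μ hr hr1 hq 𝓘
    fun I hI => (h.measurable_coeff I hI).enorm.const_mul _).trans ?_)
  refine Finset.sum_le_sum fun I hI => ?_
  have hR := relDist_pos (I := I) x
  rw [mixedNorm_const_mul S μ hq0 ENNReal.ofReal_ne_top, ENNReal.mul_rpow_of_nonneg _ _ hr.le,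
    mul_right_comm]
  gcongr
  unfold DyadicInterval.tail
  rw [ENNReal.ofReal_rpow_of_nonneg (by positivity) hr.le, ← ENNReal.ofReal_mul (by positivity),
    Real.mul_rpow hA (by positivity)]
  refine ENNReal.ofReal_le_ofReal (mul_le_mul_of_nonneg_left ?_ (by positivity))
  rw [← Real.rpow_natCast, ← Real.rpow_neg hR.le, ← Real.rpow_mul hR.le]
  exact Real.rpow_le_rpow_of_exponent_le (one_le_relDist x) (by linarith)

lemma sumNorm_rpow_le_sum_fiber (h : IsMoleculeFamily N A 𝓘 a ψ) (hr : 0 < r)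
    (hr1 : r ≤ 1) (hq : ∀ i, r ≤ q i) {ι : Type*} [DecidableEq ι] (c : DyadicInterval → ι)
    (x : ℝ) : sumNorm μ q 𝓘 a ψ x ^ r ≤
      ∑ l ∈ 𝓘.image c, sumNorm μ q {I ∈ 𝓘 | c I = l} a ψ x ^ r := by
  have hq0 : ∀ i, 0 < q i := fun i => hr.trans_le (hq i)
  refine le_trans (ENNReal.rpow_le_rpow (mixedNorm_mono S μ hq0 fun s => ?_) hr.le)
    (mixedNorm_sum_rpow_le S μ hr hr1 hq (𝓘.image c)
      (g := fun l s => ‖moleculeSum {I ∈ 𝓘 | c I = l} a ψ s x‖ₑ) fun l _ => ?_)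
  · refine le_trans (le_of_eq ?_) (enorm_sum_le _ _)
    congr 1
    exact (Finset.sum_fiberwise_of_maps_to (fun I hI => Finset.mem_image_of_mem _ hI) _).symm
  · exact ((h.mono (Finset.filter_subset _ _)).measurable_moleculeSum.comp
      (measurable_id.prodMk measurable_const)).enorm

end Pointwise

/-! ### A single tree: intervals below one top. -/

section SingleTree

variable {n : ℕ} {q : Fin n → ℝ} {N : ℕ} {A : ℝ}

/-- The localized bound near an interval that contains all intervals of the family. -/
def LocalBound (n : ℕ) (q : Fin n → ℝ) (N : ℕ) (A p : ℝ) : Prop :=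
  ∃ C : ℝ≥0, ∀ (S : Fin n → Type u) [∀ i, MeasurableSpace (S i)]
    (μ : ∀ i, Measure (S i)) [∀ i, SigmaFinite (μ i)] (𝓘 : Finset DyadicInterval)
    (a : DyadicInterval → (∀ i, S i) → ℂ) (ψ : DyadicInterval → (∀ i, S i) → ℝ → ℂ),
    IsMoleculeFamily N A 𝓘 a ψ → ∀ (K : DyadicInterval) (l : ℝ≥0∞), l ≠ 0 → l ≠ ∞ →
    (∀ I ∈ 𝓘, I.toSet ⊆ K.toSet) → (∀ x, squareNorm μ q 𝓘 a x ≤ l) →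
    ∫⁻ x in {x | K.relDist x < 2}, sumNorm μ q 𝓘 a ψ x ^ p ≤ C * l ^ p * ENNReal.ofReal K.length

lemma tailAvg_rpow (I : DyadicInterval) (κ : ℝ) {t : ℝ} (ht : 0 < t) (w : ℝ → ℝ≥0∞) :
    ∫⁻ y, w y ^ t * I.tail κ y = tailAvg I κ t w ^ t * ENNReal.ofReal I.length := by
  unfold tailAvg
  rw [← ENNReal.rpow_mul, one_div_mul_cancel ht.ne', ENNReal.rpow_one,
    ENNReal.div_mul_cancel I.ofReal_length_pos.ne' ENNReal.ofReal_ne_top]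

lemma measurable_rpow_mul_tail (I : DyadicInterval) (κ t : ℝ) {w : ℝ → ℝ≥0∞} (hw : Measurable w) :
    Measurable fun y => w y ^ t * I.tail κ y :=
  (hw.pow_const _).mul (measurable_tail I κ)

/-- On this neighbourhood the tail weight of `K` is at least 2^{-κ}. -/
lemma setLIntegral_near_le (K : DyadicInterval) {κ : ℝ} (hκ : 0 ≤ κ) {s : ℝ} (hs : 0 < s)
    {w : ℝ → ℝ≥0∞} (hw : Measurable w) :
    ∫⁻ x in {x | K.relDist x < 2}, w x ^ s ≤
      2 ^ κ * (tailAvg K κ s w ^ s * ENNReal.ofReal K.length) := by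
  rw [← tailAvg_rpow K κ hs, ← lintegral_const_mul _ (measurable_rpow_mul_tail K κ _ hw)]
  refine le_trans ?_ (setLIntegral_le_lintegral {x | K.relDist x < 2} _)
  refine setLIntegral_mono' (measurableSet_lt measurable_relDist measurable_const) fun x hx => ?_
  have hR := relDist_pos (I := K) x
  have h1 : 1 ≤ 2 ^ κ * K.tail κ x := by
    unfold DyadicInterval.tail
    rw [show (2 : ℝ≥0∞) ^ κ = ENNReal.ofReal (2 ^ κ) by
      rw [← ENNReal.ofReal_rpow_of_pos (by norm_num)]; norm_num,
      ← ENNReal.ofReal_mul (by positivity), ← ENNReal.ofReal_one]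
    refine ENNReal.ofReal_le_ofReal ?_
    rw [Real.rpow_neg hR.le, ← div_eq_mul_inv, one_le_div (by positivity)]
    exact Real.rpow_le_rpow hR.le (le_of_lt hx) hκ
  calc w x ^ s = w x ^ s * 1 := (mul_one _).symm
    _ ≤ w x ^ s * (2 ^ κ * K.tail κ x) := mul_le_mul_right h1 _
    _ = _ := by ring

/-- The weighted bound for a family below an interval `K` whose square function is bounded. -/
lemma exists_lintegral_sumNorm_le {r κ t : ℝ} (hA : 0 ≤ A) (hr : 0 < r) (hr1 : r ≤ 1)
    (hq : ∀ i, r ≤ q i) (hκ : 1 < κ) (hκr : κ ≤ N * r) (ht : 1 < t)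
    (hloc : ∀ p₁ : ℝ, ∃ p₀, p₁ ≤ p₀ ∧ LocalBound.{u} n q N A p₀) :
    ∃ C : ℝ≥0, ∀ (S : Fin n → Type u) [∀ i, MeasurableSpace (S i)]
      (μ : ∀ i, Measure (S i)) [∀ i, SigmaFinite (μ i)] (𝓘 : Finset DyadicInterval)
      (a : DyadicInterval → (∀ i, S i) → ℂ) (ψ : DyadicInterval → (∀ i, S i) → ℝ → ℂ),
      IsMoleculeFamily N A 𝓘 a ψ → ∀ (K : DyadicInterval) (l : ℝ≥0∞), l ≠ 0 → l ≠ ∞ →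
      (∀ I ∈ 𝓘, I.toSet ⊆ K.toSet) → (∀ x, squareNorm μ q 𝓘 a x ≤ l) →
      ∀ w : ℝ → ℝ≥0∞, Measurable w →
      ∫⁻ x, sumNorm μ q 𝓘 a ψ x ^ r * w x ≤
        C * (l ^ r * (tailAvg K κ t w * ENNReal.ofReal K.length)) := by
  have ht' : 0 < t - 1 := sub_pos.2 ht
  have hq0 : ∀ i, 0 < q i := fun i => hr.trans_le (hq i)
  -- The condition p₀ ≥ t r / (t - 1) means that the conjugate exponent `s` of p₀ / r is at most
  -- `t`.
  obtain ⟨p₀, hp₀, C₀, hC₀⟩ := hloc (t * r / (t - 1))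
  rw [div_le_iff₀ ht'] at hp₀
  have hrp : r < p₀ := by nlinarith
  have hp0 : 0 < p₀ := hr.trans hrp
  have hd : 0 < p₀ - r := sub_pos.2 hrp
  set s := p₀ / (p₀ - r) with hs
  have hs0 : 0 < s := by positivity
  have hst : s ≤ t := by
    rw [hs, div_le_iff₀ hd]
    linarith
  have hα : 0 ≤ r / p₀ := by positivity
  have hβ : 0 ≤ (p₀ - r) / p₀ := by positivity
  have hαβ : r / p₀ + (p₀ - r) / p₀ = 1 := by field_simp; ring
  obtain ⟨C₁, hC₁⟩ := exists_tailAvg_le_tailAvg hκ hs0 hst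
  obtain ⟨C₂, hC₂⟩ := exists_tailAvg_le_tailAvg hκ one_pos ht.le
  obtain ⟨C₃, hC₃⟩ := exists_sum_tail_le hκ
  refine ⟨C₀ ^ (r / p₀) * (2 ^ κ) ^ ((p₀ - r) / p₀) * C₁ + (A ^ r).toNNReal * C₃ * C₂,
    fun S _ μ _ 𝓘 a ψ hfam K l hl0 hl hK hG w hw => ?_⟩
  have hF := hfam.measurable_sumNorm μ hq0
  set L := ENNReal.ofReal K.length with hL
  have hL0 : L ≠ 0 := K.ofReal_length_pos.ne'
  have hLt : L ≠ ∞ := ENNReal.ofReal_ne_top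
  have hms : MeasurableSet {x | K.relDist x < 2} :=
    measurableSet_lt measurable_relDist measurable_const
  -- Hölder with exponents p₀ / r and `s`: the local bound controls the sum, a tail average of
  -- exponent `s` ≤ `t` controls the weight.
  have near : ∫⁻ x in {x | K.relDist x < 2}, sumNorm μ q 𝓘 a ψ x ^ r * w x ≤
      (C₀ ^ (r / p₀) * (2 ^ κ) ^ ((p₀ - r) / p₀) * C₁ : ℝ≥0) * (l ^ r * (tailAvg K κ t w * L)) := by
    have h1 := ENNReal.lintegral_mul_norm_pow_le (μ := volume.restrict {x | K.relDist x < 2})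
      (f := fun x => sumNorm μ q 𝓘 a ψ x ^ p₀) (g := fun x => w x ^ s)
      (hF.pow_const _).aemeasurable (hw.pow_const _).aemeasurable hα hβ hαβ
    simp only [← ENNReal.rpow_mul, mul_div_cancel₀ _ hp0.ne',
      show s * ((p₀ - r) / p₀) = 1 by rw [hs]; field_simp, ENNReal.rpow_one] at h1
    refine h1.trans ?_
    calc _ ≤ (C₀ * l ^ p₀ * L) ^ (r / p₀) *
          (2 ^ κ * ((C₁ * tailAvg K κ t w) ^ s * L)) ^ ((p₀ - r) / p₀) := by
          refine mul_le_mul' (ENNReal.rpow_le_rpow (hC₀ S μ 𝓘 a ψ hfam K l hl0 hl hK hG) hα)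
            (ENNReal.rpow_le_rpow ((setLIntegral_near_le K (κ := κ) (by linarith) hs0 hw).trans ?_) hβ)
          exact mul_le_mul_right (mul_le_mul_left (ENNReal.rpow_le_rpow (hC₁ K w hw) hs0.le) _) _
      _ = _ := by
          rw [ENNReal.mul_rpow_of_nonneg _ _ hα, ENNReal.mul_rpow_of_nonneg _ _ hα,
            ENNReal.mul_rpow_of_nonneg _ _ hβ, ENNReal.mul_rpow_of_nonneg _ _ hβ,
            ← ENNReal.rpow_mul l, ← ENNReal.rpow_mul (C₁ * _), mul_div_cancel₀ _ hp0.ne',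
            show s * ((p₀ - r) / p₀) = 1 by rw [hs]; field_simp, ENNReal.rpow_one]
          have e : L = L ^ (r / p₀) * L ^ ((p₀ - r) / p₀) := by
            rw [← ENNReal.rpow_add _ _ hL0 hLt, hαβ, ENNReal.rpow_one]
          conv_rhs => rw [e]
          push_cast
          rw [ENNReal.coe_rpow_of_nonneg _ hα, ENNReal.coe_rpow_of_nonneg _ hβ,
            ENNReal.coe_rpow_of_nonneg _ (by linarith)]
          push_cast
          ring
  -- Away from `K` no cancellation is needed: every coefficient has norm at most `l`, and the tails
  -- of the subintervals add up to the tail of `K`.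
  have far : ∫⁻ x in {x | K.relDist x < 2}ᶜ, sumNorm μ q 𝓘 a ψ x ^ r * w x ≤
      ((A ^ r).toNNReal * C₃ * C₂ : ℝ≥0) * (l ^ r * (tailAvg K κ t w * L)) := by
    have hpt : ∀ x ∈ {x | K.relDist x < 2}ᶜ, sumNorm μ q 𝓘 a ψ x ^ r * w x ≤
        ((A ^ r).toNNReal * l ^ r * C₃) * (w x ^ (1 : ℝ) * K.tail κ x) := by
      intro x hx
      have hx : 2 ≤ K.relDist x := not_lt.1 hx
      rw [ENNReal.rpow_one]
      calc _ ≤ (∑ I ∈ 𝓘, ENNReal.ofReal (A ^ r) *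
            mixedNorm S μ q (fun s => ‖a I s‖ₑ) ^ r * I.tail κ x) * w x :=
            mul_le_mul_left (sumNorm_rpow_le_sum hfam hA hr hr1 hq hκr x) _
        _ ≤ (∑ I ∈ 𝓘, ENNReal.ofReal (A ^ r) * l ^ r * I.tail κ x) * w x := by
            gcongr with I hI
            exact (mixedNorm_coeff_le hq0 hI I.left_mem).trans (hG _)
        _ ≤ (ENNReal.ofReal (A ^ r) * l ^ r * (C₃ * K.tail κ x)) * w x := by
            rw [← Finset.mul_sum]
            gcongr
            exact hC₃ K 𝓘 hK x hx
        _ = _ := by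
            change _ = ENNReal.ofReal (A ^ r) * l ^ r * C₃ * _
            ring
    calc _ ≤ ∫⁻ x in {x | K.relDist x < 2}ᶜ,
          ((A ^ r).toNNReal * l ^ r * C₃) * (w x ^ (1 : ℝ) * K.tail κ x) :=
          setLIntegral_mono' hms.compl hpt
      _ ≤ ∫⁻ x, ((A ^ r).toNNReal * l ^ r * C₃) * (w x ^ (1 : ℝ) * K.tail κ x) :=
          setLIntegral_le_lintegral _ _
      _ = ((A ^ r).toNNReal * l ^ r * C₃) * (tailAvg K κ 1 w * L) := by
          rw [lintegral_const_mul _ (measurable_rpow_mul_tail K κ _ hw),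
            tailAvg_rpow K κ one_pos, ENNReal.rpow_one]
      _ ≤ ((A ^ r).toNNReal * l ^ r * C₃) * ((C₂ * tailAvg K κ t w) * L) := by
          gcongr
          exact hC₂ K w hw
      _ = _ := by
          push_cast
          ring
  rw [← lintegral_add_compl _ hms, ENNReal.coe_add, add_mul]
  exact add_le_add near far

end SingleTree

/-! ### Selection of tree tops. -/

section Selection

/-- Every interval of a finite collection with levels lies below a maximal interval of its level. -/
lemma exists_top {α : Type*} (𝓘 : Finset DyadicInterval) (lv : DyadicInterval → α) :
    ∃ top : DyadicInterval → DyadicInterval, ∀ I ∈ 𝓘, top I ∈ 𝓘 ∧ I.toSet ⊆ (top I).toSet ∧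
      lv (top I) = lv I ∧
      ∀ J ∈ 𝓘, I.toSet ⊆ J.toSet → lv J = lv I → J.k ≤ (top I).k := by
  classical
  have h : ∀ I, ∃ K, I ∈ 𝓘 → K ∈ 𝓘 ∧ I.toSet ⊆ K.toSet ∧ lv K = lv I ∧
      ∀ J ∈ 𝓘, I.toSet ⊆ J.toSet → lv J = lv I → J.k ≤ K.k := by
    intro I
    by_cases hI : I ∈ 𝓘
    · obtain ⟨K, hK, hmax⟩ := Finset.exists_max_image
        (𝓘.filter fun J => I.toSet ⊆ J.toSet ∧ lv J = lv I) (fun J => J.k)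
        ⟨I, Finset.mem_filter.2 ⟨hI, subset_rfl, rfl⟩⟩
      rw [Finset.mem_filter] at hK
      exact ⟨K, fun _ => ⟨hK.1, hK.2.1, hK.2.2, fun J hJ h1 h2 =>
        hmax J (Finset.mem_filter.2 ⟨hJ, h1, h2⟩)⟩⟩
    · exact ⟨I, fun h => absurd h hI⟩
  choose top htop using h
  exact ⟨top, htop⟩

/-- Two tops that meet are nested. The longer one has the right level and contains the interval
below the shorter, so maximality of the shorter forces equal lengths. -/
lemma top_injOn {α : Type*} {𝓘 : Finset DyadicInterval} {lv : DyadicInterval → α}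
    {top : DyadicInterval → DyadicInterval}
    (htop : ∀ I ∈ 𝓘, top I ∈ 𝓘 ∧ I.toSet ⊆ (top I).toSet ∧ lv (top I) = lv I ∧
      ∀ J ∈ 𝓘, I.toSet ⊆ J.toSet → lv J = lv I → J.k ≤ (top I).k) {x : ℝ}
    {I J : DyadicInterval} (hI : I ∈ 𝓘) (hJ : J ∈ 𝓘) (hxI : x ∈ (top I).toSet)
    (hxJ : x ∈ (top J).toSet) (hlv : lv (top I) = lv (top J)) : top I = top J := by
  obtain ⟨a1, a2, a3, a4⟩ := htop I hI
  obtain ⟨b1, b2, b3, b4⟩ := htop J hJ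
  refine eq_of_mem_of_mem hxI hxJ ?_
  rcases le_total (top I).k (top J).k with h | h
  · exact le_antisymm h (a4 _ b1 (a2.trans (subset_of_mem_of_mem hxI hxJ h)) (hlv ▸ a3))
  · exact le_antisymm (b4 _ a1 (b2.trans (subset_of_mem_of_mem hxJ hxI h)) (hlv.symm ▸ b3)) h

end Selection

/-! ### From local bounds to a small exponent. -/

section Down

variable {n : ℕ} {q : Fin n → ℝ} {N : ℕ} {A : ℝ}

/-- A family whose coefficients have vanishing norm sums to zero. -/
lemma sumNorm_rpow_eq_zero {S : Fin n → Type u} [∀ i, MeasurableSpace (S i)]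
    {𝓘 : Finset DyadicInterval} {a : DyadicInterval → (∀ i, S i) → ℂ}
    {ψ : DyadicInterval → (∀ i, S i) → ℝ → ℂ} {μ : ∀ i, Measure (S i)} [∀ i, SigmaFinite (μ i)]
    (hfam : IsMoleculeFamily N A 𝓘 a ψ) {r : ℝ} (hA : 0 ≤ A) (hr : 0 < r) (hr1 : r ≤ 1)
    (hq : ∀ i, r ≤ q i) (h : ∀ I ∈ 𝓘, mixedNorm S μ q (fun s => ‖a I s‖ₑ) = 0) (x : ℝ) :
    sumNorm μ q 𝓘 a ψ x ^ r = 0 := by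
  refine le_antisymm ((sumNorm_rpow_le_sum hfam hA hr hr1 hq (κ := N * r) le_rfl x).trans ?_)
    zero_le
  refine le_of_eq (Finset.sum_eq_zero fun I hI => ?_)
  rw [h I hI, ENNReal.zero_rpow_of_pos hr]
  simp

lemma tailAvg_eq_zero_imp {I : DyadicInterval} {κ t : ℝ} (ht : 0 < t) {w : ℝ → ℝ≥0∞}
    (hw : Measurable w) (h : tailAvg I κ t w = 0) : w =ᵐ[volume] 0 := by
  have h1 := tailAvg_rpow I κ ht w
  rw [h, ENNReal.zero_rpow_of_pos ht, zero_mul,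
    lintegral_eq_zero_iff (measurable_rpow_mul_tail I κ t hw)] at h1
  filter_upwards [h1] with x hx
  have := (mul_eq_zero.1 hx).resolve_right (tail_ne_zero I κ x)
  simpa [ht, ht.le, ht.not_gt] using this

/-- The localized bounds with large exponents give the weighted bound with a small exponent. -/
lemma WeightedBound.of_localBound {r κ t : ℝ} (hA : 0 ≤ A) (hr : 0 < r) (hr1 : r ≤ 1)
    (hq : ∀ i, r ≤ q i) (hκ : 1 < κ) (hκr : κ ≤ N * r) (ht : 1 < t)
    (hloc : ∀ p₁ : ℝ, ∃ p₀, p₁ ≤ p₀ ∧ LocalBound.{u} n q N A p₀) :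
    WeightedBound.{u} n q N A κ r t := by
  classical
  have hq0 : ∀ i, 0 < q i := fun i => hr.trans_le (hq i)
  have ht0 : 0 < t := one_pos.trans ht
  obtain ⟨C₁, hC₁⟩ := exists_lintegral_sumNorm_le hA hr hr1 hq hκ hκr ht hloc
  obtain ⟨C₂, hC₂0, hC₂⟩ := exists_tsum_two_rpow_le hr
  -- The added 1 keeps the constant nonzero, so that an infinite integral on the right stays
  -- infinite.
  refine ⟨C₁ * 2 ^ r * C₂ + 1, fun S _ μ _ 𝓘 a ψ hfam w hw => ?_⟩
  set G := squareNorm μ q 𝓘 a with hG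
  have hGm : Measurable G := hfam.measurable_squareNorm μ hq0
  -- The infimum both dominates the norm of the coefficient and lies below `G` on all of `I`; its
  -- dyadic level sorts the intervals into trees.
  set g : DyadicInterval → ℝ≥0∞ := fun I => ⨅ x ∈ I.toSet, G x with hg
  have hgle : ∀ {I x}, x ∈ I.toSet → g I ≤ G x := fun hx => iInf₂_le _ hx
  have hbg : ∀ I ∈ 𝓘, mixedNorm S μ q (fun s => ‖a I s‖ₑ) ≤ g I := fun I hI =>
    le_iInf₂ fun x hx => mixedNorm_coeff_le hq0 hI hx
  -- An infinite value has no dyadic level. In that case either the weight vanishes almost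
  -- everywhere or the right side is infinite.
  by_cases htop : ∃ I ∈ 𝓘, g I = ∞
  · obtain ⟨I, hI, hgI⟩ := htop
    rcases eq_or_ne (tailAvg I κ t w) 0 with h0 | h0
    · have hw0 := tailAvg_eq_zero_imp ht0 hw h0
      have : ∫⁻ x, sumNorm μ q 𝓘 a ψ x ^ r * w x = ∫⁻ _ : ℝ, (0 : ℝ≥0∞) := by
        refine lintegral_congr_ae ?_
        filter_upwards [hw0] with x hx
        simp [hx]
      rw [this, lintegral_zero]
      exact zero_le
    · have h1 : ∞ ≤ ∫⁻ x, G x ^ r * tailMax 𝓘 κ t w x := by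
        calc (∞ : ℝ≥0∞) = ∫⁻ _ in I.toSet, (∞ : ℝ≥0∞) ∂(volume : Measure ℝ) := by
              rw [setLIntegral_const, volume_toSet, ENNReal.top_mul I.ofReal_length_pos.ne']
          _ ≤ ∫⁻ x in I.toSet, G x ^ r * tailMax 𝓘 κ t w x := by
              refine setLIntegral_mono' I.measurableSet_toSet fun x hx => ?_
              have h2 : G x = ∞ := top_le_iff.1 (hgI ▸ hgle hx)
              have h3 : tailMax 𝓘 κ t w x ≠ 0 := fun h =>
                h0 (le_antisymm (h ▸ tailAvg_le_tailMax hI hx κ t w) zero_le)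
              rw [h2, ENNReal.top_rpow_of_pos hr, ENNReal.top_mul h3]
          _ ≤ _ := setLIntegral_le_lintegral _ _
      rw [top_le_iff.1 h1, ENNReal.mul_top (by simp)]
      exact le_top
  push Not at htop
  have hlv : ∀ I, ∃ j : ℤ, I ∈ 𝓘 → g I ≠ 0 → (2 : ℝ≥0∞) ^ j ≤ g I ∧ g I < 2 ^ (j + 1) := by
    intro I
    by_cases hI : I ∈ 𝓘 ∧ g I ≠ 0
    · obtain ⟨j, hj⟩ := ENNReal.exists_mem_Ico_zpow hI.2 (htop I hI.1)
        (show (1 : ℝ≥0∞) < 2 by norm_num) (by simp)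
      exact ⟨j, fun _ _ => hj⟩
    · exact ⟨0, fun h1 h2 => absurd ⟨h1, h2⟩ hI⟩
  choose lv hlv using hlv
  set 𝓙 := 𝓘.filter fun I => g I ≠ 0 with h𝓙
  have h𝓙𝓘 : 𝓙 ⊆ 𝓘 := Finset.filter_subset _ _
  have hlv' : ∀ I ∈ 𝓙, (2 : ℝ≥0∞) ^ lv I ≤ g I ∧ g I < 2 ^ (lv I + 1) := fun I hI =>
    hlv I (h𝓙𝓘 hI) (Finset.mem_filter.1 hI).2
  obtain ⟨top, hT⟩ := exists_top 𝓙 lv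
  have hzero : ∀ j : ℤ, (2 : ℝ≥0∞) ^ j ≠ 0 := fun j => (ENNReal.zpow_pos (by simp) (by simp) j).ne'
  have hfin : ∀ j : ℤ, (2 : ℝ≥0∞) ^ j ≠ ∞ := fun j => (ENNReal.zpow_lt_top (by simp) (by simp) j).ne
  -- Intervals with `g I` = 0 have no level either, but their coefficients have norm zero and they
  -- drop out; the others are grouped by tops.
  have hF : ∀ x, sumNorm μ q 𝓘 a ψ x ^ r ≤
      ∑ K ∈ 𝓙.image top, sumNorm μ q {I ∈ 𝓙 | top I = K} a ψ x ^ r := by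
    intro x
    have h1 := sumNorm_rpow_le_sum_fiber (μ := μ) hfam hr hr1 hq (fun I => decide (g I ≠ 0)) x
    have h2 : ∑ l ∈ 𝓘.image (fun I => decide (g I ≠ 0)),
        sumNorm μ q {I ∈ 𝓘 | decide (g I ≠ 0) = l} a ψ x ^ r ≤
        ∑ l : Bool, sumNorm μ q {I ∈ 𝓘 | decide (g I ≠ 0) = l} a ψ x ^ r :=
      Finset.sum_le_sum_of_subset (Finset.subset_univ _)
    rw [Fintype.sum_bool] at h2
    have h3 : sumNorm μ q {I ∈ 𝓘 | decide (g I ≠ 0) = false} a ψ x ^ r = 0 := by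
      refine sumNorm_rpow_eq_zero (hfam.mono (Finset.filter_subset _ _)) hA hr hr1 hq
        (fun I hI => ?_) x
      rw [Finset.mem_filter] at hI
      have h4 : g I = 0 := by simpa using hI.2
      exact le_antisymm (h4 ▸ hbg I hI.1) zero_le
    rw [h3, add_zero] at h2
    refine (h1.trans h2).trans ?_
    have h5 : ({I ∈ 𝓘 | decide (g I ≠ 0) = true} : Finset DyadicInterval) = 𝓙 := by
      simp [h𝓙]
    rw [h5]
    exact sumNorm_rpow_le_sum_fiber (hfam.mono h𝓙𝓘) hr hr1 hq top x
  have hsq : ∀ K ∈ 𝓙.image top, ∀ x,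
      squareNorm μ q {I ∈ 𝓙 | top I = K} a x ≤ 2 ^ (lv K + 1) := by
    intro K hK x
    by_cases hx : ∃ I ∈ ({I ∈ 𝓙 | top I = K} : Finset DyadicInterval), x ∈ I.toSet
    -- The smallest interval of the tree containing `x` has a point y with G(y) < 2^{j+1}, j being
    -- the level. All intervals of the tree that contain `x` also contain y, so the square norm of
    -- the tree at `x` is at most G(y).
    · obtain ⟨I₀, hI₀, hmin⟩ := Finset.exists_min_image
        (({I ∈ 𝓙 | top I = K} : Finset DyadicInterval).filter fun I => x ∈ I.toSet)
        (fun I => I.k) (by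
          obtain ⟨I, hI, hxI⟩ := hx
          exact ⟨I, Finset.mem_filter.2 ⟨hI, hxI⟩⟩)
      rw [Finset.mem_filter, Finset.mem_filter] at hI₀
      obtain ⟨⟨hI₀𝓙, htopI₀⟩, hxI₀⟩ := hI₀
      have h1 := (hlv' I₀ hI₀𝓙).2
      have h2 : lv I₀ = lv K := by rw [← (hT I₀ hI₀𝓙).2.2.1, htopI₀]
      rw [h2] at h1
      simp only [hg, iInf_lt_iff] at h1
      obtain ⟨y, hy, hGy⟩ := h1
      refine le_trans (squareNorm_le_squareNorm hq0 fun I hI hxI => ⟨?_, ?_⟩) hGy.le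
      · exact h𝓙𝓘 (Finset.mem_filter.1 hI).1
      · exact subset_of_mem_of_mem hxI₀ hxI (hmin I (Finset.mem_filter.2 ⟨hI, hxI⟩)) hy
    · push Not at hx
      rw [squareNorm_eq_zero hq0 hx]
      exact zero_le
  have hKint : ∀ K ∈ 𝓙.image top,
      ∫⁻ x, sumNorm μ q {I ∈ 𝓙 | top I = K} a ψ x ^ r * w x ≤
      (C₁ * 2 ^ r : ℝ≥0) * ∫⁻ x, K.toSet.indicator (fun _ => ((2 : ℝ≥0∞) ^ lv K) ^ r) x *
        tailMax 𝓘 κ t w x := by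
    intro K hK
    obtain ⟨I₁, hI₁, rfl⟩ := Finset.mem_image.1 hK
    have hK𝓘 : top I₁ ∈ 𝓘 := h𝓙𝓘 (hT I₁ hI₁).1
    set K := top I₁ with hKdef
    have h1 := hC₁ S μ {I ∈ 𝓙 | top I = K} a ψ
      (hfam.mono ((Finset.filter_subset _ _).trans h𝓙𝓘)) K (2 ^ (lv K + 1)) (hzero _) (hfin _)
      (fun I hI => by
        rw [Finset.mem_filter] at hI
        exact hI.2 ▸ (hT I hI.1).2.1) (hsq K hK) w hw
    refine h1.trans ?_
    have h2 : tailAvg K κ t w * ENNReal.ofReal K.length ≤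
        ∫⁻ x in K.toSet, tailMax 𝓘 κ t w x := by
      rw [← volume_toSet, ← setLIntegral_const]
      exact setLIntegral_mono' K.measurableSet_toSet fun x hx => tailAvg_le_tailMax hK𝓘 hx κ t w
    have h3 : ∫⁻ x, K.toSet.indicator (fun _ => ((2 : ℝ≥0∞) ^ lv K) ^ r) x * tailMax 𝓘 κ t w x =
        ((2 : ℝ≥0∞) ^ lv K) ^ r * ∫⁻ x in K.toSet, tailMax 𝓘 κ t w x := by
      rw [← lintegral_const_mul _ (measurable_tailMax 𝓘 κ t w),
        ← lintegral_indicator K.measurableSet_toSet]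
      refine lintegral_congr fun x => ?_
      by_cases hx : x ∈ K.toSet <;> simp [hx]
    rw [h3]
    calc _ ≤ (C₁ : ℝ≥0∞) * ((2 ^ (lv K + 1)) ^ r * ∫⁻ x in K.toSet, tailMax 𝓘 κ t w x) :=
          mul_le_mul_right (mul_le_mul_right h2 _) _
      _ = _ := by
          rw [ENNReal.zpow_add (by simp) (by simp), zpow_one, ENNReal.mul_rpow_of_nonneg _ _ hr.le]
          push_cast
          rw [ENNReal.coe_rpow_of_nonneg _ hr.le]
          push_cast
          ring
  -- At most one top of each level contains `x`, and its level satisfies 2^j ≤ G(x), so the sum is a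
  -- geometric series with largest term at most G(x)^r.
  have hpt : ∀ x, ∑ K ∈ 𝓙.image top, K.toSet.indicator (fun _ => ((2 : ℝ≥0∞) ^ lv K) ^ r) x ≤
      C₂ * G x ^ r := by
    intro x
    refine le_trans ?_ (hC₂ (G x))
    calc ∑ K ∈ 𝓙.image top, K.toSet.indicator (fun _ => ((2 : ℝ≥0∞) ^ lv K) ^ r) x
        = ∑ K ∈ (𝓙.image top).filter (fun K => x ∈ K.toSet), ((2 : ℝ≥0∞) ^ lv K) ^ r := by
          rw [Finset.sum_filter]
          exact Finset.sum_congr rfl fun K _ => by simp [Set.indicator_apply]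
      _ = ∑ K ∈ (𝓙.image top).filter (fun K => x ∈ K.toSet),
            (if (2 : ℝ≥0∞) ^ lv K ≤ G x then ((2 : ℝ≥0∞) ^ lv K) ^ r else 0) := by
          refine Finset.sum_congr rfl fun K hK => ?_
          rw [Finset.mem_filter, Finset.mem_image] at hK
          obtain ⟨⟨I, hI, rfl⟩, hx⟩ := hK
          rw [if_pos (((hlv' _ (hT I hI).1).1).trans (hgle hx))]
      _ = ∑ j ∈ ((𝓙.image top).filter (fun K => x ∈ K.toSet)).image lv,
            (if (2 : ℝ≥0∞) ^ j ≤ G x then ((2 : ℝ≥0∞) ^ j) ^ r else 0) := by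
          refine (Finset.sum_image (f := fun j : ℤ =>
            if (2 : ℝ≥0∞) ^ j ≤ G x then ((2 : ℝ≥0∞) ^ j) ^ r else 0) fun K hK K' hK' h => ?_).symm
          rw [Finset.mem_coe, Finset.mem_filter, Finset.mem_image] at hK hK'
          obtain ⟨⟨I, hI, rfl⟩, hx⟩ := hK
          obtain ⟨⟨I', hI', rfl⟩, hx'⟩ := hK'
          exact top_injOn hT hI hI' hx hx' h
      _ ≤ _ := ENNReal.sum_le_tsum _
  calc ∫⁻ x, sumNorm μ q 𝓘 a ψ x ^ r * w x
      ≤ ∫⁻ x, ∑ K ∈ 𝓙.image top, sumNorm μ q {I ∈ 𝓙 | top I = K} a ψ x ^ r * w x := by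
        refine lintegral_mono fun x => ?_
        rw [← Finset.sum_mul]
        exact mul_le_mul_left (hF x) _
    _ = ∑ K ∈ 𝓙.image top, ∫⁻ x, sumNorm μ q {I ∈ 𝓙 | top I = K} a ψ x ^ r * w x :=
        lintegral_finsetSum _ fun K _ => (((hfam.mono ((Finset.filter_subset _ _).trans
          h𝓙𝓘)).measurable_sumNorm μ hq0).pow_const _).mul hw
    _ ≤ ∑ K ∈ 𝓙.image top, (C₁ * 2 ^ r : ℝ≥0) *
          ∫⁻ x, K.toSet.indicator (fun _ => ((2 : ℝ≥0∞) ^ lv K) ^ r) x * tailMax 𝓘 κ t w x :=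
        Finset.sum_le_sum hKint
    _ = (C₁ * 2 ^ r : ℝ≥0) * ∫⁻ x, (∑ K ∈ 𝓙.image top,
          K.toSet.indicator (fun _ => ((2 : ℝ≥0∞) ^ lv K) ^ r) x) * tailMax 𝓘 κ t w x := by
        rw [← Finset.mul_sum, ← lintegral_finsetSum]
        · simp_rw [Finset.sum_mul]
        · exact fun K _ => (measurable_const.indicator K.measurableSet_toSet).mul
            (measurable_tailMax 𝓘 κ t w)
    _ ≤ (C₁ * 2 ^ r : ℝ≥0) * ∫⁻ x, C₂ * (G x ^ r * tailMax 𝓘 κ t w x) := by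
        refine mul_le_mul_right (lintegral_mono fun x => ?_) _
        rw [← mul_assoc]
        exact mul_le_mul_left (hpt x) _
    _ = (C₁ * 2 ^ r * C₂ : ℝ≥0) * ∫⁻ x, G x ^ r * tailMax 𝓘 κ t w x := by
        have hm : Measurable fun x => G x ^ r * tailMax 𝓘 κ t w x :=
          (hGm.pow_const _).mul (measurable_tailMax 𝓘 κ t w)
        rw [lintegral_const_mul _ hm,
          ← mul_assoc]
        simp only [ENNReal.coe_mul]
    _ ≤ _ := mul_le_mul_left (by exact_mod_cast le_self_add) _

end Down

/-! ### The induction on the number of variables. -/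

section Induction

variable {n : ℕ} {q : Fin n → ℝ} {N : ℕ} {A : ℝ}

lemma near_subset_triple (K : DyadicInterval) : {x | K.relDist x < 2} ⊆ K.triple := by
  intro x hx
  by_contra h
  refine absurd (show K.relDist x < 2 from hx) (not_lt.2 ?_)
  have h1 : K.length ≤ Metric.infDist x K.toSet := by
    refine (Metric.le_infDist ⟨_, K.left_mem⟩).2 fun z hz => ?_
    rw [Real.dist_eq, abs_sub_comm]
    exact length_le_abs_sub hz h
  unfold relDist
  have := (one_le_div K.length_pos).2 h1
  linarith

/-- The translate of a dyadic interval by an integer multiple of its length. -/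
def DyadicInterval.shift (K : DyadicInterval) (d : ℤ) : DyadicInterval := ⟨K.k, K.m + d⟩

lemma length_shift (K : DyadicInterval) (d : ℤ) : (K.shift d).length = K.length := rfl

lemma left_shift (K : DyadicInterval) (d : ℤ) : (K.shift d).left = K.left + d * K.length := by
  unfold left shift length
  push_cast
  ring

lemma triple_subset_shift (K : DyadicInterval) :
    K.triple ⊆ (K.shift (-1)).toSet ∪ (K.shift 0).toSet ∪ (K.shift 1).toSet := by
  intro x hx
  simp only [triple, Set.mem_Ico] at hx
  simp only [toSet_eq, left_shift, length_shift, Set.mem_union, Set.mem_Ico]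
  push_cast
  by_cases h1 : x < K.left
  · exact Or.inl (Or.inl ⟨by linarith, by linarith⟩)
  by_cases h2 : x < K.left + K.length
  · exact Or.inl (Or.inr ⟨by linarith, by linarith⟩)
  · exact Or.inr ⟨by linarith, by linarith⟩

lemma subset_triple_shift (K : DyadicInterval) {d : ℤ} (hd : -1 ≤ d) (hd' : d ≤ 1) :
    K.toSet ⊆ (K.shift d).triple := by
  have h1 : (-1 : ℝ) ≤ d := by exact_mod_cast hd
  have h2 : (d : ℝ) ≤ 1 := by exact_mod_cast hd'
  have := K.length_pos
  rw [toSet_eq, triple, left_shift, length_shift]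
  exact Set.Ico_subset_Ico (by nlinarith) (by nlinarith)

/-- After division by `l` the John-Nirenberg inequality applies on `K` and its two neighbours. The
triple of each contains `K`, so each local sum is the full sum, and the three intervals cover the
neighbourhood of `K`. -/
lemma localBound_zero (q : Fin 0 → ℝ) (hN : 5 ≤ N) (hA : 0 ≤ A) {p : ℝ} (hp : 1 ≤ p) :
    LocalBound.{u} 0 q N A p := by
  classical
  obtain ⟨B, hB⟩ := exists_lintegral_localSum_rpow_le N hN hA hp
  have hp0 : 0 < p := by linarith
  refine ⟨3 * B, fun S _ μ _ 𝓘 a ψ hfam K l hl0 hl hK hG => ?_⟩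
  set s₀ : ∀ i, S i := fun i => i.elim0
  set c : ℝ := l.toReal with hc
  have hc0 : 0 < c := ENNReal.toReal_pos hl0 hl
  have hcl : ENNReal.ofReal c = l := ENNReal.ofReal_toReal hl
  set b : DyadicInterval → ℂ := fun I => (c⁻¹ : ℝ) * a I s₀ with hb
  have hsq : ∀ x, ∑ I ∈ 𝓘, I.toSet.indicator (fun _ => ‖b I‖ ^ 2) x ≤ 1 := by
    intro x
    have h1 : squareSum 𝓘 a s₀ x ≤ l := hG x
    unfold squareSum at h1
    have h2 := ENNReal.rpow_le_rpow h1 (show (0 : ℝ) ≤ 2 by norm_num)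
    rw [← ENNReal.rpow_mul, show (1 / 2 : ℝ) * 2 = 1 by norm_num, ENNReal.rpow_one, ← hcl,
      ENNReal.ofReal_rpow_of_pos hc0] at h2
    have h3 : ∑ I ∈ 𝓘, I.toSet.indicator (fun _ => ‖a I s₀‖ₑ ^ 2) x =
        ENNReal.ofReal (∑ I ∈ 𝓘, I.toSet.indicator (fun _ => ‖a I s₀‖ ^ 2) x) := by
      rw [ENNReal.ofReal_sum_of_nonneg fun I _ => Set.indicator_nonneg (fun _ _ => by positivity) _]
      refine Finset.sum_congr rfl fun I _ => ?_
      by_cases hx : x ∈ I.toSet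
      · simp [hx, ENNReal.ofReal_pow]
      · simp [hx]
    rw [h3, ENNReal.ofReal_le_ofReal_iff (by positivity), Real.rpow_two] at h2
    have h4 : ∑ I ∈ 𝓘, I.toSet.indicator (fun _ => ‖b I‖ ^ 2) x =
        (c⁻¹) ^ 2 * ∑ I ∈ 𝓘, I.toSet.indicator (fun _ => ‖a I s₀‖ ^ 2) x := by
      rw [Finset.mul_sum]
      refine Finset.sum_congr rfl fun I _ => ?_
      by_cases hx : x ∈ I.toSet
      · simp [hx, hb, mul_pow]
      · simp [hx]
    rw [h4, inv_pow, inv_mul_le_iff₀ (by positivity), mul_one]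
    exact h2
  have hmol : ∀ I ∈ 𝓘, IsMolecule N A I (ψ I s₀) := fun I hI => hfam.isMolecule I hI s₀
  have hint : ∀ d : ℤ, -1 ≤ d → d ≤ 1 → ∫⁻ x in (K.shift d).toSet, sumNorm μ q 𝓘 a ψ x ^ p ≤
      B * l ^ p * ENNReal.ofReal K.length := by
    intro d hd hd'
    have h1 := hB 𝓘 b (fun I => ψ I s₀) hmol hsq (K.shift d)
    have h2 : ∀ x, sumNorm μ q 𝓘 a ψ x = l * ‖localSum 𝓘 b (fun I => ψ I s₀) (K.shift d) x‖ₑ := by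
      intro x
      change ‖moleculeSum 𝓘 a ψ s₀ x‖ₑ = _
      have h3 : moleculeSum 𝓘 a ψ s₀ x =
          (c : ℂ) * localSum 𝓘 b (fun I => ψ I s₀) (K.shift d) x := by
        unfold moleculeSum localSum
        rw [Finset.filter_true_of_mem fun I hI => (hK I hI).trans (subset_triple_shift K hd hd'),
          Finset.mul_sum]
        refine Finset.sum_congr rfl fun I _ => ?_
        have : (c : ℂ) ≠ 0 := by exact_mod_cast hc0.ne'
        simp only [hb]
        push_cast
        field_simp
      rw [h3, enorm_mul]
      congr 1
      rw [← hcl, ← ofReal_norm, Complex.norm_real, Real.norm_of_nonneg hc0.le]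
    simp_rw [h2, ENNReal.mul_rpow_of_nonneg _ _ hp0.le]
    rw [lintegral_const_mul' _ _ (ENNReal.rpow_ne_top_of_nonneg hp0.le hl)]
    rw [length_shift] at h1
    refine (mul_le_mul_right h1 _).trans (le_of_eq ?_)
    ring
  calc _ ≤ ∫⁻ x in (K.shift (-1)).toSet ∪ (K.shift 0).toSet ∪ (K.shift 1).toSet,
        sumNorm μ q 𝓘 a ψ x ^ p :=
        lintegral_mono_set ((near_subset_triple K).trans (triple_subset_shift K))
    _ ≤ ((∫⁻ x in (K.shift (-1)).toSet, sumNorm μ q 𝓘 a ψ x ^ p) +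
          ∫⁻ x in (K.shift 0).toSet, sumNorm μ q 𝓘 a ψ x ^ p) +
          ∫⁻ x in (K.shift 1).toSet, sumNorm μ q 𝓘 a ψ x ^ p :=
        (lintegral_union_le _ _ _).trans (add_le_add_left (lintegral_union_le _ _ _) _)
    _ ≤ (B * l ^ p * ENNReal.ofReal K.length + B * l ^ p * ENNReal.ofReal K.length) +
          B * l ^ p * ENNReal.ofReal K.length :=
        add_le_add (add_le_add (hint _ le_rfl (by norm_num)) (hint _ (by norm_num) (by norm_num)))
          (hint _ (by norm_num) le_rfl)
    _ = _ := by
        push_cast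
        ring

/-- The unweighted bound localizes. -/
lemma WeightedBound.localBound (hq : ∀ i, 0 < q i) {κ p t : ℝ} (hκ : 1 < κ) (hp : 0 < p)
    (ht : 0 < t) (h : WeightedBound.{u} n q N A κ p t) : LocalBound.{u} n q N A p := by
  obtain ⟨C, hC⟩ := h
  obtain ⟨C', hC'⟩ := exists_tailAvg_one_le hκ ht
  refine ⟨C * C', fun S _ μ _ 𝓘 a ψ hfam K l hl0 hl hK hG => ?_⟩
  have h1 := hC S μ 𝓘 a ψ hfam (fun _ => 1) measurable_const
  simp only [mul_one] at h1
  have hpt : ∀ x, squareNorm μ q 𝓘 a x ^ p * tailMax 𝓘 κ t (fun _ => 1) x ≤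
      K.toSet.indicator (fun _ => l ^ p * C') x := by
    intro x
    by_cases hx : x ∈ K.toSet
    · rw [Set.indicator_of_mem hx]
      exact mul_le_mul' (ENNReal.rpow_le_rpow (hG x) hp.le) (tailMax_le fun I _ _ => hC' I)
    · rw [squareNorm_eq_zero hq fun I hI hxI => hx (hK I hI hxI), ENNReal.zero_rpow_of_pos hp,
        zero_mul]
      exact zero_le
  calc _ ≤ ∫⁻ x, sumNorm μ q 𝓘 a ψ x ^ p := setLIntegral_le_lintegral _ _
    _ ≤ C * ∫⁻ x, K.toSet.indicator (fun _ => l ^ p * C') x :=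
        h1.trans (mul_le_mul_right (lintegral_mono hpt) _)
    _ = _ := by
        rw [lintegral_indicator K.measurableSet_toSet, setLIntegral_const, volume_toSet]
        push_cast
        ring

/-- The weighted inequality between a sum of molecules and the square function. -/
theorem weightedBound (hN : 5 ≤ N) (hA : 0 ≤ A) {κ : ℝ} (hκ : 1 < κ) (hκN : κ ≤ N)
    (hq : ∀ i, 0 < q i) (hκq : ∀ i, κ ≤ N * q i) {p : ℝ} (hp : 0 < p) (hκp : κ ≤ N * p)
    {t : ℝ} (ht : 1 < t) : WeightedBound.{u} n q N A κ p t := by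
  induction n generalizing p t with
  | zero =>
    -- The descent needs r ≤ 1 and κ ≤ N r; the minimum keeps both κ ≤ N and κ ≤ N p in force.
    -- Extrapolation then returns to `p`.
    have hr : 0 < min 1 p := lt_min one_pos hp
    refine WeightedBound.of_le_exponent hq hκ hr (min_le_right _ _) (fun t ht => ?_) t ht
    refine WeightedBound.of_localBound hA hr (min_le_left _ _) (fun i => i.elim0) hκ ?_ ht
      fun p₁ => ⟨max 1 p₁, le_max_right _ _, localBound_zero q hN hA (le_max_left _ _)⟩
    rw [mul_min_of_nonneg _ _ (Nat.cast_nonneg N), mul_one]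
    exact le_min hκN hκp
  | succ n ih =>
    -- The induction hypothesis at exponent `q 0`, then Fubini, then extrapolation to a large
    -- exponent, then localization.
    have hloc : ∀ p₁ : ℝ, ∃ p₀, p₁ ≤ p₀ ∧ LocalBound.{u} (n + 1) q N A p₀ := fun p₁ =>
      ⟨max (q 0) p₁, le_max_right _ _, (WeightedBound.of_le_exponent hq hκ (hq 0) (le_max_left _ _)
        (fun t ht => (ih (fun i => hq i.succ) (fun i => hκq i.succ) (hq 0) (hκq 0) ht).succ hq)
        t ht).localBound hq hκ ((hq 0).trans_le (le_max_left _ _)) (one_pos.trans ht)⟩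
    obtain ⟨i₀, -, hi₀⟩ := Finset.exists_min_image Finset.univ q ⟨0, Finset.mem_univ _⟩
    have hr : 0 < min (min 1 p) (q i₀) := lt_min (lt_min one_pos hp) (hq i₀)
    refine WeightedBound.of_le_exponent hq hκ hr ((min_le_left _ _).trans (min_le_right _ _))
      (fun t ht => ?_) t ht
    refine WeightedBound.of_localBound hA hr ((min_le_left _ _).trans (min_le_left _ _))
      (fun i => (min_le_right _ _).trans (hi₀ i (Finset.mem_univ i))) hκ ?_ ht hloc
    rw [mul_min_of_nonneg _ _ (Nat.cast_nonneg N), mul_min_of_nonneg _ _ (Nat.cast_nonneg N),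
      mul_one]
    exact le_min (le_min hκN hκp) (hκq i₀)

end Induction

/-! ### From lacunary families to molecules. -/

section Lacunary

variable {n : ℕ} {S : Fin n → Type u} {N : ℕ} {A : ℝ}
  {𝓘 : Finset DyadicInterval} {φ₁ φ₂ : DyadicInterval → (∀ i, S i) → SchwartzMap ℝ ℂ}
  {f : (∀ i, S i) → ℝ → ℂ}

/-- The factor √|I| changes the L² normalization into the `L^∞` one; only derivatives of order 0 and
1 are involved. The constant is `max A 0` because nonnegativity is assumed of molecule constants
throughout. -/
lemma IsLacunary.isMolecule {φ : DyadicInterval → SchwartzMap ℝ ℂ} (h : IsLacunary N A 𝓘 φ)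
    {I : DyadicInterval} (hI : I ∈ 𝓘) :
    IsMolecule N (max A 0) I fun x => (√I.length : ℝ) * φ I x := by
  have hL := I.length_pos
  have hs : 0 < √I.length := Real.sqrt_pos.2 hL
  have hle : ∀ x, A * (I.relDist x ^ N)⁻¹ ≤ max A 0 * (I.relDist x ^ N)⁻¹ := fun x => by
    have := relDist_pos (I := I) x
    exact mul_le_mul_of_nonneg_right (le_max_left _ _) (by positivity)
  have hn : ∀ z : ℂ, ‖((√I.length : ℝ) : ℂ) * z‖ = √I.length * ‖z‖ := fun z => by
    rw [norm_mul, Complex.norm_real, Real.norm_of_nonneg hs.le]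
  refine ⟨(φ I).differentiable.const_mul _, fun x => ?_, fun x => ?_, ?_⟩
  · refine le_trans ?_ (hle x)
    have h1 := h.bound I hI 0 (by norm_num) x
    simp only [iteratedDeriv_zero] at h1
    rw [hn]
    refine (mul_le_mul_of_nonneg_left h1 hs.le).trans (le_of_eq ?_)
    field_simp
  · have h1 := h.bound I hI 1 (by norm_num) x
    simp only [iteratedDeriv_one] at h1
    rw [deriv_const_mul _ (φ I).differentiable.differentiableAt, hn]
    calc _ ≤ √I.length * _ := mul_le_mul_of_nonneg_left h1 hs.le
      _ = A * (I.relDist x ^ N)⁻¹ / I.length := by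
          field_simp
      _ ≤ max A 0 * (I.relDist x ^ N)⁻¹ / I.length := div_le_div_of_nonneg_right (hle x) hL.le
      _ = _ := by ring
  · rw [integral_const_mul, h.integral_eq_zero I hI, mul_zero]

/-- The normalized coefficients of `f`. -/
noncomputable def coeff (φ₁ : DyadicInterval → (∀ i, S i) → SchwartzMap ℝ ℂ)
    (f : (∀ i, S i) → ℝ → ℂ) (I : DyadicInterval) (s : ∀ i, S i) : ℂ :=
  pairing (f s) (φ₁ I s) / (√I.length : ℝ)

lemma moleculeSum_coeff (s : ∀ i, S i) (x : ℝ) :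
    moleculeSum 𝓘 (coeff φ₁ f) (fun I s x => (√I.length : ℝ) * φ₂ I s x) s x =
      discreteSum 𝓘 (fun I => φ₁ I s) (fun I => φ₂ I s) (f s) x := by
  unfold moleculeSum discreteSum coeff
  refine Finset.sum_congr rfl fun I _ => ?_
  have : ((√I.length : ℝ) : ℂ) ≠ 0 := by
    exact_mod_cast (Real.sqrt_pos.2 I.length_pos).ne'
  field_simp

lemma squareSum_coeff (s : ∀ i, S i) (x : ℝ) :
    squareSum 𝓘 (coeff φ₁ f) s x = ‖squareFun 𝓘 (fun I => φ₁ I s) (f s) x‖ₑ := by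
  unfold squareSum squareFun
  have h0 : ∀ I ∈ 𝓘, 0 ≤ ‖pairing (f s) (φ₁ I s)‖ ^ 2 / I.length *
      I.toSet.indicator (fun _ => (1 : ℝ)) x := fun I _ => by
    have := I.length_pos
    have : 0 ≤ I.toSet.indicator (fun _ => (1 : ℝ)) x :=
      Set.indicator_nonneg (fun _ _ => zero_le_one) _
    positivity
  rw [← ofReal_norm, Real.norm_of_nonneg (Real.sqrt_nonneg _), Real.sqrt_eq_rpow,
    ← ENNReal.ofReal_rpow_of_nonneg (Finset.sum_nonneg h0) (by norm_num),
    ENNReal.ofReal_sum_of_nonneg h0]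
  congr 1
  refine Finset.sum_congr rfl fun I _ => ?_
  by_cases hx : x ∈ I.toSet
  · rw [Set.indicator_of_mem hx, Set.indicator_of_mem hx, mul_one, ← ofReal_norm,
      ← ENNReal.ofReal_pow (norm_nonneg _)]
    congr 1
    rw [coeff, norm_div, Complex.norm_real, Real.norm_of_nonneg (Real.sqrt_nonneg _), div_pow,
      Real.sq_sqrt I.length_pos.le]
  · simp [hx]

variable [∀ i, MeasurableSpace (S i)]

lemma IsAdmissible.isMoleculeFamily (h : IsAdmissible N A 𝓘 φ₁ φ₂ f) :
    IsMoleculeFamily N (max A 0) 𝓘 (coeff φ₁ f)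
      fun I s x => (√I.length : ℝ) * φ₂ I s x where
  measurable_coeff I hI := by
    refine Measurable.div_const ?_ _
    have h1 : Measurable fun z : (∀ i, S i) × ℝ => f z.1 z.2 * conj (φ₁ I z.1 z.2) :=
      h.measurable_f.mul (Complex.continuous_conj.measurable.comp (h.measurable₁ I hI))
    exact h1.stronglyMeasurable.integral_prod_right.measurable
  measurable_molecule I hI := (h.measurable₂ I hI).const_mul _
  isMolecule I hI s := (h.lacunary₂ s).isMolecule hI

lemma lpMixedNorm_eq {F : Type*} [NormedAddCommGroup F] (μ : ∀ i, Measure (S i)) (q : Fin n → ℝ)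
    {p : ℝ} (hp : 0 < p) (h : (∀ i, S i) → ℝ → F) :
    lpMixedNorm μ q p h = (∫⁻ x, mixedNorm S μ q (fun s => ‖h s x‖ₑ) ^ p) ^ (1 / p) := by
  rw [lpMixedNorm, eLpNorm_eq_lintegral_rpow_enorm_toReal (by simpa using hp)
    ENNReal.ofReal_ne_top, ENNReal.toReal_ofReal hp.le]
  simp only [enorm_eq_self]

lemma lpMixedNorm_squareFun (μ : ∀ i, Measure (S i)) (q : Fin n → ℝ) {p : ℝ} (hp : 0 < p) :
    lpMixedNorm μ q p (fun s => squareFun 𝓘 (fun I => φ₁ I s) (f s)) =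
      (∫⁻ x, squareNorm μ q 𝓘 (coeff φ₁ f) x ^ p) ^ (1 / p) := by
  rw [lpMixedNorm_eq μ q hp]
  unfold squareNorm
  simp_rw [squareSum_coeff]

/-- The restriction to `E` becomes the weight 1_E; with `E` the whole line this also covers the
unrestricted sum. -/
lemma lpMixedNorm_indicator_discreteSum (μ : ∀ i, Measure (S i)) {q : Fin n → ℝ}
    (hq : ∀ i, 0 < q i) {p : ℝ} (hp : 0 < p) (E : Set ℝ) :
    lpMixedNorm μ q p (fun s => E.indicator
        (discreteSum 𝓘 (fun I => φ₁ I s) (fun I => φ₂ I s) (f s))) =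
      (∫⁻ x, sumNorm μ q 𝓘 (coeff φ₁ f) (fun I s x => (√I.length : ℝ) * φ₂ I s x) x ^ p *
        E.indicator (fun _ => 1) x) ^ (1 / p) := by
  rw [lpMixedNorm_eq μ q hp]
  congr 1
  refine lintegral_congr fun x => ?_
  unfold sumNorm
  simp_rw [moleculeSum_coeff]
  by_cases hx : x ∈ E
  · simp [hx]
  · simp [hx, mixedNorm_zero S μ hq, ENNReal.zero_rpow_of_pos hp]

end Lacunary

/-! ### The size of a set. -/

section Size

lemma exists_size_le : ∃ C : ℝ≥0, ∀ (𝓘 : Finset DyadicInterval) (M : ℤ) (E : Set ℝ),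
    size 𝓘 M E ≤ C := by
  obtain ⟨C, hC⟩ := lintegral_tail_le (κ := 100) (by norm_num)
  refine ⟨C, fun 𝓘 M E => iSup₂_le fun J _ => ?_⟩
  have hJ := J.length_pos
  have h1 : ∫⁻ x in E, ENNReal.ofReal (1 / J.relDist x ^ 100) ≤ C * ENNReal.ofReal J.length := by
    refine (setLIntegral_le_lintegral _ _).trans (le_trans (le_of_eq ?_) (hC J))
    refine lintegral_congr fun x => ?_
    unfold DyadicInterval.tail
    rw [Real.rpow_neg (relDist_pos x).le, one_div]
    norm_cast
  calc _ ≤ ENNReal.ofReal (1 / J.length) * (C * ENNReal.ofReal J.length) := mul_le_mul_right h1 _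
    _ = C * ENNReal.ofReal (1 / J.length * J.length) := by
        rw [ENNReal.ofReal_mul (by positivity)]
        ring
    _ = C := by
        rw [one_div_mul_cancel hJ.ne']
        simp

/-- The maximal function runs over intervals of 𝓘, each of which is itself relevant for the size.
For κ = 100 the averages of 1_E are exactly the quantities in the supremum. -/
lemma tailMax_indicator_le {𝓘 : Finset DyadicInterval} {M : ℤ}
    (hM : ∀ I ∈ 𝓘, I.length ≤ (2 : ℝ) ^ M) {E : Set ℝ} (hE : MeasurableSet E) {t : ℝ} (ht : 0 < t)
    (x : ℝ) : tailMax 𝓘 100 t (E.indicator fun _ => 1) x ≤ size 𝓘 M E ^ (1 / t) := by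
  refine tailMax_le fun I hI _ => ENNReal.rpow_le_rpow ?_ (by positivity)
  refine le_trans (le_of_eq ?_) (le_iSup₂ (f := fun (J : DyadicInterval) (_ : J ∈ relevant 𝓘 M) =>
    ENNReal.ofReal (1 / J.length) * ∫⁻ x in E, ENNReal.ofReal (1 / J.relDist x ^ 100)) I
    ⟨⟨I, hI, subset_rfl⟩, hM I hI⟩)
  rw [← lintegral_indicator hE, ENNReal.div_eq_inv_mul, one_div,
    ENNReal.ofReal_inv_of_pos I.length_pos]
  congr 1
  refine lintegral_congr fun y => ?_
  by_cases hy : y ∈ E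
  · rw [Set.indicator_of_mem hy, Set.indicator_of_mem hy, ENNReal.one_rpow, one_mul]
    unfold DyadicInterval.tail
    rw [Real.rpow_neg (relDist_pos y).le, one_div]
    norm_cast
  · rw [Set.indicator_of_notMem hy, Set.indicator_of_notMem hy, ENNReal.zero_rpow_of_pos ht,
      zero_mul]

/-- The size is bounded by an absolute constant, so a larger power is controlled by a smaller one;
`β` may even be negative, as happens for 1 / p - ε. -/
lemma exists_rpow_size_le {α β : ℝ} (hα : 0 < α) (hβ : β ≤ α) :
    ∃ C : ℝ≥0, ∀ (𝓘 : Finset DyadicInterval) (M : ℤ) (E : Set ℝ),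
      size 𝓘 M E ^ α ≤ C * size 𝓘 M E ^ β := by
  obtain ⟨C, hC⟩ := exists_size_le
  refine ⟨C ^ (α - β), fun 𝓘 M E => ?_⟩
  rcases eq_or_ne (size 𝓘 M E) 0 with h0 | h0
  · rw [h0, ENNReal.zero_rpow_of_pos hα]
    exact zero_le
  have htop : size 𝓘 M E ≠ ∞ := ((hC 𝓘 M E).trans_lt ENNReal.coe_lt_top).ne
  rw [ENNReal.coe_rpow_of_nonneg _ (sub_nonneg.2 hβ)]
  calc size 𝓘 M E ^ α = size 𝓘 M E ^ (α - β) * size 𝓘 M E ^ β := by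
        rw [← ENNReal.rpow_add _ _ h0 htop]
        simp
    _ ≤ _ := mul_le_mul_left (ENNReal.rpow_le_rpow (hC 𝓘 M E) (sub_nonneg.2 hβ)) _

end Size

theorem theorem3p1 (n : ℕ) (q : Fin n → ℝ) (hq : ∀ i, 0 < q i) (p : ℝ) (hp : 0 < p)
    (N : ℕ) (hN : 100 ≤ N) (A : ℝ) :
    (1 < N * p → (∀ i, 1 < N * q i) →
      ∃ C : ℝ≥0, ∀ (S : Fin n → Type u) [∀ i, MeasurableSpace (S i)]
        (μ : ∀ i, Measure (S i)) [∀ i, SigmaFinite (μ i)]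
        (𝓘 : Finset DyadicInterval)
        (φ₁ φ₂ : DyadicInterval → (∀ i, S i) → SchwartzMap ℝ ℂ)
        (f : (∀ i, S i) → ℝ → ℂ),
        IsAdmissible N A 𝓘 φ₁ φ₂ f →
        lpMixedNorm μ q p (fun s => discreteSum 𝓘 (fun I => φ₁ I s) (fun I => φ₂ I s) (f s)) ≤
          C * lpMixedNorm μ q p (fun s => squareFun 𝓘 (fun I => φ₁ I s) (f s))) ∧
    (100 ≤ N * p → (∀ i, 100 ≤ N * q i) → ∀ ε : ℝ, 0 < ε →
      ∃ C : ℝ≥0, ∀ (S : Fin n → Type u) [∀ i, MeasurableSpace (S i)]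
        (μ : ∀ i, Measure (S i)) [∀ i, SigmaFinite (μ i)]
        (𝓘 : Finset DyadicInterval)
        (φ₁ φ₂ : DyadicInterval → (∀ i, S i) → SchwartzMap ℝ ℂ)
        (f : (∀ i, S i) → ℝ → ℂ) (M : ℤ) (E : Set ℝ),
        IsAdmissible N A 𝓘 φ₁ φ₂ f →
        (∀ I ∈ 𝓘, I.length ≤ (2 : ℝ) ^ M) → MeasurableSet E →
        lpMixedNorm μ q p (fun s => E.indicator
            (discreteSum 𝓘 (fun I => φ₁ I s) (fun I => φ₂ I s) (f s))) ≤
          C * lpMixedNorm μ q p (fun s => squareFun 𝓘 (fun I => φ₁ I s) (f s)) *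
            size 𝓘 M E ^ (1 / p - ε)) := by
  have hA : 0 ≤ max A 0 := le_max_right _ _
  have hN100 : (100 : ℝ) ≤ N := by exact_mod_cast hN
  have hp' : 0 ≤ 1 / p := by positivity
  refine ⟨fun hNp hNq => ?_, fun hNp hNq ε hε => ?_⟩
  -- The strict inequalities leave room for κ > 1 below N, N p and all N q_i. For the weight 1 any t
  -- > 1 serves, and 2 is taken.
  · obtain ⟨κ, ⟨⟨h1, h2⟩, h3⟩, hκ⟩ :
        ∃ κ : ℝ, ((κ ≤ N ∧ κ ≤ N * p) ∧ ∀ i, κ ≤ N * q i) ∧ 1 < κ := by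
      have hev : ∀ {b : ℝ}, 1 < b → ∀ᶠ κ in nhdsWithin (1 : ℝ) (Set.Ioi 1), κ ≤ b := fun hb =>
        nhdsWithin_le_nhds (Iic_mem_nhds hb)
      exact ((((hev (by linarith)).and (hev hNp)).and
        (Filter.eventually_all.2 fun i => hev (hNq i))).and self_mem_nhdsWithin).exists
    obtain ⟨C₁, hC₁⟩ := weightedBound.{u} (by omega) hA hκ h1 hq h3 hp h2 one_lt_two
    obtain ⟨C₂, hC₂⟩ := exists_tailAvg_one_le hκ two_pos
    refine ⟨(C₁ * C₂) ^ (1 / p), fun S _ μ _ 𝓘 φ₁ φ₂ f h => ?_⟩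
    have hfam := h.isMoleculeFamily
    have e := lpMixedNorm_indicator_discreteSum (𝓘 := 𝓘) (φ₁ := φ₁) (φ₂ := φ₂) (f := f) μ hq hp
      Set.univ
    simp only [Set.indicator_univ] at e
    rw [e, lpMixedNorm_squareFun μ q hp, ENNReal.coe_rpow_of_nonneg _ hp',
      ← ENNReal.mul_rpow_of_nonneg _ _ hp']
    refine ENNReal.rpow_le_rpow ((hC₁ S μ 𝓘 _ _ hfam (fun _ => 1) measurable_const).trans ?_) hp'
    rw [ENNReal.coe_mul, mul_assoc, ← lintegral_const_mul _
      ((hfam.measurable_squareNorm μ hq).pow_const p)]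
    refine mul_le_mul_right (lintegral_mono fun x => ?_) _
    rw [mul_comm]
    exact mul_le_mul_left (tailMax_le fun I _ _ => hC₂ I) _
  · have hpε : 0 < p * ε := mul_pos hp hε
    have ht : 1 < 1 + p * ε := by linarith
    have ht0 : 0 < 1 + p * ε := by linarith
    -- The weighted bound yields the power 1 / (t p) of the size, and (1 / p - ε) t p = 1 - (pε)² ≤
    -- 1, so this power is at least 1 / p - ε.
    set t := 1 + p * ε with htdef
    obtain ⟨C₁, hC₁⟩ := weightedBound.{u} (q := q) (N := N) (κ := 100) (p := p) (by omega) hA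
      (by norm_num) hN100 hq hNq hp hNp ht
    obtain ⟨C₂, hC₂⟩ := exists_rpow_size_le (α := 1 / t * (1 / p)) (β := 1 / p - ε)
      (by positivity) (by
        rw [show 1 / t * (1 / p) = 1 / (t * p) by field_simp, le_div_iff₀ (by positivity)]
        have : (1 / p - ε) * (t * p) = 1 - (p * ε) ^ 2 := by
          rw [htdef]
          field_simp
          ring
        rw [this]
        nlinarith)
    refine ⟨C₁ ^ (1 / p) * C₂, fun S _ μ _ 𝓘 φ₁ φ₂ f M E h hM hE => ?_⟩
    have hfam := h.isMoleculeFamily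
    rw [lpMixedNorm_indicator_discreteSum μ hq hp, lpMixedNorm_squareFun μ q hp]
    set X := ∫⁻ x, squareNorm μ q 𝓘 (coeff φ₁ f) x ^ p
    have h1 := hC₁ S μ 𝓘 _ _ hfam (E.indicator fun _ => 1) (measurable_const.indicator hE)
    have h2 : ∫⁻ x, squareNorm μ q 𝓘 (coeff φ₁ f) x ^ p *
        tailMax 𝓘 100 t (E.indicator fun _ => 1) x ≤ X * size 𝓘 M E ^ (1 / t) := by
      rw [← lintegral_mul_const _ ((hfam.measurable_squareNorm μ hq).pow_const p)]
      exact lintegral_mono fun x => mul_le_mul_right (tailMax_indicator_le hM hE ht0 x) _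
    calc _ ≤ (C₁ * (X * size 𝓘 M E ^ (1 / t))) ^ (1 / p) :=
          ENNReal.rpow_le_rpow (h1.trans (mul_le_mul_right h2 _)) hp'
      _ = C₁ ^ (1 / p) * X ^ (1 / p) * size 𝓘 M E ^ (1 / t * (1 / p)) := by
          rw [ENNReal.mul_rpow_of_nonneg _ _ hp', ENNReal.mul_rpow_of_nonneg _ _ hp',
            ← ENNReal.rpow_mul]
          ring
      _ ≤ C₁ ^ (1 / p) * X ^ (1 / p) * (C₂ * size 𝓘 M E ^ (1 / p - ε)) :=
          mul_le_mul_right (hC₂ 𝓘 M E) _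
      _ = _ := by
          rw [ENNReal.coe_mul, ENNReal.coe_rpow_of_nonneg _ hp']
          ring
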